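/- Let $(P,\Pi)$ be a (smooth, finite-dimensional, Hausdorff, second countable) Poisson manifold and let $\sharp\colon T^*P\to TP$ be the contraction with $\Pi$, so that $\langle\eta,\sharp\xi\rangle=\Pi(\xi,\eta)$. For an embedded submanifold $S\subset P$ let $N^*S\subset T^*P|_S$ be the annihilator of $TS$. The submanifold $S$ is called pre-Poisson if $TS+\sharp N^*S$ has constant rank along $S$, coisotropic if $\sharp N^*S\subset TS$, and cosymplectic if $TS\oplus\sharp N^*S=TP|_S$. A cosymplectic submanifold $S$ carries an induced Poisson bivector $\Pi_S$, given by $\Pi_S(\tilde\xi,\tilde\eta)=\Pi(\xi,\eta)$, where $\xi,\eta\in T_x^*P$ are the extensions of $\tilde\xi,\tilde\eta\in T^*_xS$ that annihilate $\sharp N_x^*S$. Let $C$ be a (nonempty) pre-Poisson submanifold of $(P,\Pi)$, and let $\tilde P_0$ and $\tilde P_1$ be cosymplectic submanifolds of $(P,\Pi)$ that contain $C$ and in each of which $C$ is coisotropic with respect to the induced Poisson structure. Then there are tubular neighborhoods $V_0$ of $C$ in $\tilde P_0$ and $V_1$ of $C$ in $\tilde P_1$ and a diffeomorphism $\Phi\colon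 V_0\to V_1$ which maps $\Pi_{\tilde P_0}|_{V_0}$ to $\Pi_{\tilde P_1}|_{V_1}$ and is the identity on $C$. Moreover, $\Phi$ can be chosen to be the restriction to $V_0$ of the time-one map of a Hamiltonian flow: there are an open set $U\subset P$ containing $C$ and a smooth family of functions $H_t\colon U\to\mathbb R$, $t\in\mathbb R$, such that for every $x\in V_0$ the integral curve of the time-dependent vector field $X_{H_t}=\sharp\, dH_t$ that starts at $x$ at time $0$ exists and stays in $U$ for all $t\in[0,1]$, and is at $\Phi(x)$ at time $1$. Here a tubular neighborhood of $C$ in a manifold $S\supset C$ is an open subset of $S$ that is the diffeomorphic image of an open, fiberwise star-shaped neighborhood of the zero section of a smooth vector bundle over $C$, the zero section being mapped to $C$ by the identity. -/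

import Mathlib

open scoped Manifold ContDiff Topology

noncomputable section

namespace PrePoisson

/-! ### Linear algebra of bivectors

A bivector on a finite-dimensional real vector space `V` is an alternating bilinear form on the
dual space `V*`. -/

section Linear

variable {V W : Type*} [AddCommGroup V] [Module ℝ V] [FiniteDimensional ℝ V]
  [AddCommGroup W] [Module ℝ W]

/-- The sharp map `V* → V` of `Π`, i.e. contraction with `Π`:
it is characterized by `η (♯ ξ) = Π ξ η`. -/
def sharp (B : LinearMap.BilinForm ℝ (Module.Dual ℝ V)) : Module.Dual ℝ V →ₗ[ℝ] V :=
  (Module.evalEquiv ℝ V).symm.toLinearMap ∘ₗ B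

/-- The subspace `♯ W°` for a subspace `W` of `V`. -/
def sharpAnn (B : LinearMap.BilinForm ℝ (Module.Dual ℝ V)) (S : Submodule ℝ V) :
    Submodule ℝ V :=
  S.dualAnnihilator.map (sharp B)

/-- The bivector induced on a cosymplectic subspace, presented as the range of an injective linear
map `L : W → V` with `L(W) ⊕ ♯ L(W)° = V`. A covector on `W` is extended to `V` by zero on
`♯ L(W)°` (i.e. it is composed with the projection `V → W` along `♯ L(W)°`), and `Π` is evaluated on
the extensions. -/
def inducedForm (B : LinearMap.BilinForm ℝ (Module.Dual ℝ V)) (L : W →ₗ[ℝ] V)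
    (hL : Function.Injective L) (h : IsCompl (LinearMap.range L) (sharpAnn B (LinearMap.range L))) :
    LinearMap.BilinForm ℝ (Module.Dual ℝ W) :=
  let pr : V →ₗ[ℝ] W := LinearMap.linearProjOfIsCompl (sharpAnn B (LinearMap.range L)) L hL h
  B.compl₁₂ pr.dualMap pr.dualMap

end Linear

/-! ### Manifolds -/

section Manifolds

variable {E : Type*} [NormedAddCommGroup E] [NormedSpace ℝ E]
  {M : Type*} [TopologicalSpace M] [ChartedSpace E M]
  {E' : Type*} [NormedAddCommGroup E'] [NormedSpace ℝ E']
  {M' : Type*} [TopologicalSpace M'] [ChartedSpace E' M']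

instance tangentSpace_finiteDimensional [FiniteDimensional ℝ E] (p : M) :
    FiniteDimensional ℝ (TangentSpace 𝓘(ℝ, E) p) :=
  inferInstanceAs (FiniteDimensional ℝ E)

/-- The differential of `f : M → M'` at `p`, as a linear map of tangent spaces. -/
def tangentMapAt (f : M → M') (p : M) :
    TangentSpace 𝓘(ℝ, E) p →ₗ[ℝ] TangentSpace 𝓘(ℝ, E') (f p) :=
  (mfderiv 𝓘(ℝ, E) 𝓘(ℝ, E') f p).toLinearMap

/-- The tangent space at `p` of the submanifold parametrized by `f : M → M'`, as a subspace of the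
tangent space of the ambient manifold. -/
def tangentRange (f : M → M') (p : M) : Submodule ℝ (TangentSpace 𝓘(ℝ, E') (f p)) :=
  LinearMap.range (tangentMapAt (E := E) (E' := E') f p)

/-- The differential of a real-valued function, as a covector. -/
def differential (f : M → ℝ) (p : M) : Module.Dual ℝ (TangentSpace 𝓘(ℝ, E) p) :=
  (mvfderiv 𝓘(ℝ, E) f p).toLinearMap

/-- A smooth embedding has injective differentials. -/
theorem tangentMapAt_injective [IsManifold 𝓘(ℝ, E) ∞ M] [IsManifold 𝓘(ℝ, E') ∞ M']
    {f : M → M'} (hf : Manifold.IsSmoothEmbedding 𝓘(ℝ, E) 𝓘(ℝ, E') ∞ f) (p : M) :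
    Function.Injective (tangentMapAt (E := E) (E' := E') f p) := by
  have h := hf.isImmersion.isImmersionAt p
  have hn : (∞ : WithTop ℕ∞) ≠ 0 := by simp
  have hd : MDifferentiableAt 𝓘(ℝ, E) 𝓘(ℝ, E) h.domChart p :=
    ((contMDiffOn_of_mem_maximalAtlas h.domChart_mem_maximalAtlas).contMDiffAt
      (h.domChart.open_source.mem_nhds h.mem_domChart_source)).mdifferentiableAt hn
  have hc : MDifferentiableAt 𝓘(ℝ, E') 𝓘(ℝ, E') h.codChart (f p) :=
    ((contMDiffOn_of_mem_maximalAtlas h.codChart_mem_maximalAtlas).contMDiffAt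
      (h.codChart.open_source.mem_nhds h.mem_codChart_source)).mdifferentiableAt hn
  have hds : MDifferentiableAt 𝓘(ℝ, E) 𝓘(ℝ, E) h.domChart.symm (h.domChart p) :=
    ((contMDiffOn_symm_of_mem_maximalAtlas h.domChart_mem_maximalAtlas).contMDiffAt
      (h.domChart.open_target.mem_nhds
        (h.domChart.map_source h.mem_domChart_source))).mdifferentiableAt hn
  have hfp : MDifferentiableAt 𝓘(ℝ, E) 𝓘(ℝ, E') f p :=
    (hf.contMDiff p).mdifferentiableAt hn
  let A : E →L[ℝ] E' := h.equiv.toContinuousLinearMap ∘L ContinuousLinearMap.inl ℝ E h.complement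
  have hA : MDifferentiableAt 𝓘(ℝ, E) 𝓘(ℝ, E') A (h.domChart p) :=
    A.differentiableAt.mdifferentiableAt
  have key : h.codChart ∘ f =ᶠ[𝓝 p] A ∘ h.domChart := by
    filter_upwards [h.domChart.open_source.mem_nhds h.mem_domChart_source] with y hy
    have hy' : h.domChart y ∈ (h.domChart.extend 𝓘(ℝ, E)).target := by
      simpa using h.domChart.map_source hy
    simpa [A, h.domChart.left_inv hy] using h.writtenInCharts hy'
  have hinv : h.domChart.symm ∘ h.domChart =ᶠ[𝓝 p] id := by
    filter_upwards [h.domChart.open_source.mem_nhds h.mem_domChart_source] with y hy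
    exact h.domChart.left_inv hy
  rw [injective_iff_map_eq_zero]
  intro v hv
  have hv' : mfderiv 𝓘(ℝ, E) 𝓘(ℝ, E') f p v = 0 := hv
  have e1 := key.mfderiv_eq (I := 𝓘(ℝ, E)) (I' := 𝓘(ℝ, E'))
  rw [mfderiv_comp p hc hfp, mfderiv_comp p hA hd] at e1
  have e2 := hinv.mfderiv_eq (I := 𝓘(ℝ, E)) (I' := 𝓘(ℝ, E))
  rw [mfderiv_comp p hds hd] at e2
  have e3 : mfderiv 𝓘(ℝ, E) 𝓘(ℝ, E') A (h.domChart p) (mfderiv 𝓘(ℝ, E) 𝓘(ℝ, E) h.domChart p v)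
      = 0 := by
    have := congrArg (fun T => T v) e1
    refine Eq.trans this.symm ?_
    change mfderiv 𝓘(ℝ, E') 𝓘(ℝ, E') h.codChart (f p) (mfderiv 𝓘(ℝ, E) 𝓘(ℝ, E') f p v) = 0
    rw [hv']
    exact map_zero _
  have e4 : mfderiv 𝓘(ℝ, E) 𝓘(ℝ, E) h.domChart p v = 0 := by
    rw [mfderiv_eq_fderiv, A.fderiv] at e3
    have e5 : h.equiv (mfderiv 𝓘(ℝ, E) 𝓘(ℝ, E) h.domChart p v, (0 : h.complement)) = 0 := e3
    rw [map_eq_zero_iff _ h.equiv.injective] at e5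
    exact (Prod.mk.inj e5).1
  have e6 := congrArg (fun T => T v) e2
  change mfderiv 𝓘(ℝ, E) 𝓘(ℝ, E) h.domChart.symm (h.domChart p)
    (mfderiv 𝓘(ℝ, E) 𝓘(ℝ, E) h.domChart p v) = mfderiv 𝓘(ℝ, E) 𝓘(ℝ, E) id p v at e6
  rw [e4] at e6
  rw [mfderiv_id] at e6
  exact (e6.symm.trans (map_zero _))

variable (E M) in
/-- A (not necessarily smooth) field of bilinear forms on the cotangent spaces of `M`. -/
abbrev BilinField : Type _ :=
  ∀ p : M, LinearMap.BilinForm ℝ (Module.Dual ℝ (TangentSpace 𝓘(ℝ, E) p))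

/-- The bracket `{f, g} = Π(df, dg)`. -/
def bracket (B : BilinField E M) (f g : M → ℝ) : M → ℝ :=
  fun p => B p (differential f p) (differential g p)

/-- `B` is a Poisson bivector field on `M`: it is alternating, smooth, and satisfies `[B, B] = 0`,
which is expressed as the Jacobi identity for the bracket of smooth functions. -/
structure IsPoisson (B : BilinField E M) : Prop where
  alt : ∀ p ξ, B p ξ ξ = 0
  smooth : ∀ f g : M → ℝ, ContMDiff 𝓘(ℝ, E) 𝓘(ℝ, ℝ) ∞ f → ContMDiff 𝓘(ℝ, E) 𝓘(ℝ, ℝ) ∞ g →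
    ContMDiff 𝓘(ℝ, E) 𝓘(ℝ, ℝ) ∞ (bracket B f g)
  jacobi : ∀ f g h : M → ℝ, ContMDiff 𝓘(ℝ, E) 𝓘(ℝ, ℝ) ∞ f → ContMDiff 𝓘(ℝ, E) 𝓘(ℝ, ℝ) ∞ g →
    ContMDiff 𝓘(ℝ, E) 𝓘(ℝ, ℝ) ∞ h → ∀ p,
      bracket B f (bracket B g h) p + bracket B g (bracket B h f) p
        + bracket B h (bracket B f g) p = 0

variable [FiniteDimensional ℝ E] [FiniteDimensional ℝ E']

/-- The submanifold `i : M → M'` of `(M', B)` is pre-Poisson: `TC + ♯ N*C` has constant rank. -/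
def IsPrePoisson (B : BilinField E' M') (i : M → M') : Prop :=
  ∃ r : ℕ, ∀ c : M, Module.finrank ℝ
    ↥(tangentRange (E := E) (E' := E') i c ⊔
      sharpAnn (B (i c)) (tangentRange (E := E) (E' := E') i c)) = r

/-- The submanifold `i : M → M'` of `(M', B)` is coisotropic: `♯ N*C ⊆ TC`. -/
def IsCoisotropic (B : BilinField E' M') (i : M → M') : Prop :=
  ∀ c : M, sharpAnn (B (i c)) (tangentRange (E := E) (E' := E') i c) ≤
    tangentRange (E := E) (E' := E') i c

/-- `j : M → M'` is an embedded cosymplectic submanifold of `(M', B)`: `TM ⊕ ♯ N*M = TM'` at the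
points of `M`. -/
structure IsCosymplectic (B : BilinField E' M') (j : M → M') : Prop where
  embedding : Manifold.IsSmoothEmbedding 𝓘(ℝ, E) 𝓘(ℝ, E') ∞ j
  isCompl : ∀ x : M, IsCompl (tangentRange (E := E) (E' := E') j x)
    (sharpAnn (B (j x)) (tangentRange (E := E) (E' := E') j x))

/-- The bivector field induced on a cosymplectic submanifold. -/
def IsCosymplectic.induced [IsManifold 𝓘(ℝ, E) ∞ M] [IsManifold 𝓘(ℝ, E') ∞ M']
    {B : BilinField E' M'} {j : M → M'} (h : IsCosymplectic (E := E) B j) : BilinField E M :=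
  fun x => inducedForm (B (j x)) (tangentMapAt j x) (tangentMapAt_injective h.embedding x) (h.isCompl x)

/-- `f` is a Poisson map at all points of `s`: the pushforward of `B` by `f` is `B'`. -/
def IsPoissonMapOn (B : BilinField E M) (B' : BilinField E' M') (f : M → M') (s : Set M) : Prop :=
  ∀ x ∈ s, ∀ ξ η : Module.Dual ℝ (TangentSpace 𝓘(ℝ, E') (f x)),
    B' (f x) ξ η =
      B x (ξ ∘ₗ tangentMapAt (E := E) (E' := E') f x) (η ∘ₗ tangentMapAt (E := E) (E' := E') f x)

/-- `V` is a tubular neighborhood in `M'` of the submanifold `i : M → M'`: there are a smooth vector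
bundle `N` over `M` and a diffeomorphism onto the open set `V` from an open neighborhood of the zero
section of `N`, star-shaped in each fiber, which restricts to `i` on the zero section. -/
def IsTubularNeighborhood (i : M → M') (V : Set M') : Prop :=
  ∃ (k : ℕ) (N : M → Type) (_ : ∀ c, AddCommGroup (N c)) (_ : ∀ c, Module ℝ (N c))
    (_ : TopologicalSpace (Bundle.TotalSpace (EuclideanSpace ℝ (Fin k)) N))
    (_ : ∀ c, TopologicalSpace (N c)) (_ : FiberBundle (EuclideanSpace ℝ (Fin k)) N)
    (_ : VectorBundle ℝ (EuclideanSpace ℝ (Fin k)) N)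
    (_ : ContMDiffVectorBundle ∞ (EuclideanSpace ℝ (Fin k)) N 𝓘(ℝ, E))
    (ψ : PartialDiffeomorph (𝓘(ℝ, E).prod 𝓘(ℝ, EuclideanSpace ℝ (Fin k))) 𝓘(ℝ, E')
      (Bundle.TotalSpace (EuclideanSpace ℝ (Fin k)) N) M' ∞),
    ψ.target = V ∧
    (∀ c : M, (⟨c, 0⟩ : Bundle.TotalSpace (EuclideanSpace ℝ (Fin k)) N) ∈ ψ.source ∧
      ψ ⟨c, 0⟩ = i c) ∧
    ∀ (c : M) (v : N c), (⟨c, v⟩ : Bundle.TotalSpace (EuclideanSpace ℝ (Fin k)) N) ∈ ψ.source →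
      ∀ s ∈ Set.Icc (0 : ℝ) 1,
        (⟨c, s • v⟩ : Bundle.TotalSpace (EuclideanSpace ℝ (Fin k)) N) ∈ ψ.source

/-- The Hamiltonian vector field `X_H = ♯ dH`. -/
def hamiltonianVectorField (B : BilinField E M) (H : M → ℝ) (p : M) : TangentSpace 𝓘(ℝ, E) p :=
  sharp (B p) (differential H p)

/-- On the time interval `[0, 1]`, the curve `γ` stays in `U` and is an integral curve of the
time-dependent Hamiltonian vector field of the family of functions `H t`. -/
def IsHamiltonianTrajectory (B : BilinField E M) (U : Set M) (H : ℝ → M → ℝ) (γ : ℝ → M) : Prop :=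
  ∀ t ∈ Set.Icc (0 : ℝ) 1, γ t ∈ U ∧
    HasMFDerivWithinAt 𝓘(ℝ, ℝ) 𝓘(ℝ, E) γ (Set.Icc 0 1) t
      ((1 : ℝ →L[ℝ] ℝ).smulRight (hamiltonianVectorField B (H t) (γ t)))

end Manifolds

end PrePoisson

end

set_option linter.unusedSectionVars false

noncomputable section

namespace PrePoisson

open Set Filter

/-! Linear algebra. Let `K` be the tangent space of `C` at a point. A cosymplectic submanifold in
which `C` is coisotropic meets `K + ♯K°` only in `K` and spans the ambient tangent space together
with it (`isTransverse_of_coisotropic`). Conversely, a subspace containing `K` in this position is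
cosymplectic (`IsTransverse.eq_zero`), and the position survives deformations in the direction of `K
+ ♯K°` that fix `K` (`IsTransverse.deform`). So the two submanifolds have equal dimension and can be
joined, near `C`, by cosymplectic ones.

Interpolation. Choose a map `σ` from the first submanifold to the second that fixes `C` and whose
differential along `C` is the projection along the sharp image of the conormal space of the second
(`exists_projected_map`). Embed `P` in a Hilbert space with a smooth retraction and retract the
segments from `x` to `σ x` (`exists_interpolation`). Along `C` the tangent maps then change only by
elements of `♯K°`.

Moser's argument. The velocity of the family splits uniquely and smoothly as `dφ(w) + ♯ξ` with `ξ`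
conormal (`exists_decomposition`). A conormal field `ξ` is the differential, along the submanifold,
of a function `f` (`exists_generating_function`), so `X_f = ♯ξ` there. Letting the parameter move
with `-w` cancels the tangential part and turns the family into trajectories of `X_f`
(`exists_hamiltonian_isotopy`). Along `C` everything is at rest, so these flows reach time one on a
neighborhood of `C`.

Conclusion. By the Jacobi identity Hamiltonian flows preserve the bivector
(`IsPoissonOn.flow_invariant`), and the induced bivectors are natural (`inducedForm_natural`); hence
the resulting map of submanifolds is Poisson. It is an immersion along `C` that embeds `C`, so it
has a smooth left inverse near `C` (`exists_leftInverse`), and equality of dimensions makes it a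
diffeomorphism onto an open set (`exists_partialDiffeomorph`). It remains to shrink its domain to a
tubular neighborhood.

Two tools recur. Smooth dependence of flows comes from the implicit function theorem for the
integral equation in a space of curves (`exists_smooth_flow`). As `C` need not be compact, local
constructions are made around each of its points and glued by uniqueness (`exists_glued`); this
yields both the left inverses and the flows. -/

/-! ### The implicit function theorem on a neighborhood -/

section Implicit

variable {X Y Z : Type*} [NormedAddCommGroup X] [NormedSpace ℝ X] [CompleteSpace X]
  [NormedAddCommGroup Y] [NormedSpace ℝ Y] [CompleteSpace Y]
  [NormedAddCommGroup Z] [NormedSpace ℝ Z] [CompleteSpace Z]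

/-- The implicit function theorem for smooth equations, with an implicit function that is smooth on
an open set and unique among all solutions in a neighborhood. -/
theorem exists_contDiffOn_implicit {F : X × Y → Z} {Ω : Set (X × Y)} (hΩ : IsOpen Ω)
    (hF : ContDiffOn ℝ ∞ F Ω) {x₀ : X} {y₀ : Y} (h₀ : (x₀, y₀) ∈ Ω) (hF₀ : F (x₀, y₀) = 0)
    (hinv : (fderiv ℝ F (x₀, y₀) ∘L .inr ℝ X Y).IsInvertible) :
    ∃ (A : Set X) (B : Set Y) (g : X → Y), IsOpen A ∧ IsOpen B ∧ x₀ ∈ A ∧ y₀ ∈ B ∧ A ×ˢ B ⊆ Ω ∧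
      ContDiffOn ℝ ∞ g A ∧ MapsTo g A B ∧ ∀ x ∈ A, ∀ y ∈ B, F (x, y) = 0 ↔ y = g x := by
  have hn : (∞ : WithTop ℕ∞) ≠ 0 := by simp
  have cd : ∀ v ∈ Ω, ContDiffAt ℝ ∞ F v := fun v hv => hF.contDiffAt (hΩ.mem_nhds hv)
  let g := (cd _ h₀).implicitFunction hn hinv
  have hg0 : g x₀ = y₀ := (cd _ h₀).implicitFunction_apply_self hn hinv
  have hgc : ContDiffAt ℝ ∞ g x₀ := (cd _ h₀).contDiffAt_implicitFunction hn hinv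
  have hiff : ∀ᶠ v in 𝓝 (x₀, y₀), F v = 0 ↔ g v.1 = v.2 := by
    have := (cd _ h₀).eventually_apply_eq_iff_implicitFunction hn hinv
    rwa [hF₀] at this
  have hinv' : ∀ᶠ v in 𝓝 (x₀, y₀), (fderiv ℝ F v ∘L .inr ℝ X Y).IsInvertible := by
    have hc : ContinuousAt (fun v => fderiv ℝ F v ∘L .inr ℝ X Y) (x₀, y₀) := by
      have : ContinuousAt (fderiv ℝ F) (x₀, y₀) :=
        ((cd _ h₀).fderiv_right (m := 0) (by simp)).continuousAt
      fun_prop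
    exact hc.eventually_mem ((ContinuousLinearEquiv.isOpen).mem_nhds hinv)
  have hgood : ∀ᶠ v in 𝓝 (x₀, y₀), (F v = 0 ↔ g v.1 = v.2) ∧
      (fderiv ℝ F v ∘L .inr ℝ X Y).IsInvertible ∧ v ∈ Ω :=
    hiff.and (hinv'.and (hΩ.mem_nhds h₀))
  obtain ⟨A₁, hA₁, B, hB, hAB⟩ := mem_nhds_prod_iff.1 hgood
  obtain ⟨B', hB'B, hB'o, hyB'⟩ := mem_nhds_iff.1 hB
  have hgcont : ∀ᶠ x in 𝓝 x₀, ContinuousAt g x := by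
    have := (hgc.of_le (m := 1) (by simp)).eventually (by simp)
    exact this.mono fun x hx => hx.continuousAt
  have hgB : ∀ᶠ x in 𝓝 x₀, g x ∈ B' :=
    hgc.continuousAt.eventually_mem (by rw [hg0]; exact hB'o.mem_nhds hyB')
  obtain ⟨A, hA, hAo, hxA⟩ := mem_nhds_iff.1 (hgcont.and (hgB.and hA₁))
  refine ⟨A, B', g, hAo, hB'o, hxA, hyB', ?_, ?_, fun x hx => (hA hx).2.1, ?_⟩
  · rintro ⟨x, y⟩ ⟨hx, hy⟩
    exact (hAB (mk_mem_prod (hA hx).2.2 (hB'B hy))).2.2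
  · intro x hx
    have hx' : (x, g x) ∈ A₁ ×ˢ B := ⟨(hA hx).2.2, hB'B (hA hx).2.1⟩
    obtain ⟨h1, h2, h3⟩ := hAB hx'
    have hFx : F (x, g x) = 0 := h1.2 rfl
    -- Smoothness of order `∞` at `x₀` only gives neighborhoods that may shrink with the order.
    -- Applying the theorem again at `(x, g x)` gives a germ that is smooth at `x`, and uniqueness
    -- of solutions identifies it with `g`.
    let g' := (cd _ h3).implicitFunction hn h2
    have hg'c : ContDiffAt ℝ ∞ g' x := (cd _ h3).contDiffAt_implicitFunction hn h2
    have hiff' : ∀ᶠ v in 𝓝 (x, g x), F v = 0 ↔ g' v.1 = v.2 := by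
      have := (cd _ h3).eventually_apply_eq_iff_implicitFunction hn h2
      rwa [hFx] at this
    have hc : ContinuousAt (fun z => (z, g z)) x := continuousAt_id.prodMk (hA hx).1
    have heq : g =ᶠ[𝓝 x] g' := by
      filter_upwards [hc.eventually hiff', hAo.mem_nhds hx] with z hz hzA
      have hz' : (z, g z) ∈ A₁ ×ˢ B := ⟨(hA hzA).2.2, hB'B (hA hzA).2.1⟩
      exact (hz.1 ((hAB hz').1.2 rfl)).symm
    exact (hg'c.congr_of_eventuallyEq heq).contDiffWithinAt
  · intro x hx y hy
    have := (hAB (mk_mem_prod (hA hx).2.2 (hB'B hy))).1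
    exact this.trans eq_comm

end Implicit

/-! ### Composition operators on spaces of continuous curves -/

section Nemytskii

universe u

open unitInterval

variable {E F : Type u} [NormedAddCommGroup E] [NormedSpace ℝ E]
  [NormedAddCommGroup F] [NormedSpace ℝ F]

/-- The composition operator `γ ↦ (t ↦ f (t, γ t))` on continuous curves. -/
def compOp (f : ℝ × E → F) (hf : Continuous f) (γ : C(I, E)) : C(I, F) :=
  ⟨fun t => f (t, γ t), by fun_prop⟩

@[simp] theorem compOp_apply (f : ℝ × E → F) (hf : Continuous f) (γ : C(I, E)) (t : I) :
    compOp f hf γ t = f (t, γ t) := rfl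

/-- Pointwise application of a curve of operators to a curve of vectors, as a bounded linear map. -/
def curveApply : C(I, E →L[ℝ] F) →L[ℝ] C(I, E) →L[ℝ] C(I, F) :=
  LinearMap.mkContinuous₂
    (LinearMap.mk₂ ℝ (fun (a : C(I, E →L[ℝ] F)) (h : C(I, E)) =>
        (⟨fun t => a t (h t), by fun_prop⟩ : C(I, F)))
      (by intros; ext; simp) (by intros; ext; simp) (by intros; ext; simp) (by intros; ext; simp))
    1 (by
      intro a h
      rw [ContinuousMap.norm_le _ (by positivity)]
      intro t
      calc ‖a t (h t)‖ ≤ ‖a t‖ * ‖h t‖ := (a t).le_opNorm _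
        _ ≤ 1 * ‖a‖ * ‖h‖ := by
          rw [one_mul]
          gcongr
          · exact a.norm_coe_le_norm t
          · exact h.norm_coe_le_norm t)

@[simp] theorem curveApply_apply (a : C(I, E →L[ℝ] F)) (h : C(I, E)) (t : I) :
    curveApply a h t = a t (h t) := rfl

theorem contDiff_curveApply {n : WithTop ℕ∞} :
    ContDiff ℝ n (fun a : C(I, E →L[ℝ] F) => (curveApply a : C(I, E) →L[ℝ] C(I, F))) := by
  fun_prop

/-- The partial derivative in the second variable. -/
def partialSnd {E F : Type*} [NormedAddCommGroup E] [NormedSpace ℝ E] [NormedAddCommGroup F]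
    [NormedSpace ℝ F] (f : ℝ × E → F) (v : ℝ × E) : E →L[ℝ] F :=
  fderiv ℝ f v ∘L .inr ℝ ℝ E

theorem contDiff_partialSnd {f : ℝ × E → F} (hf : ContDiff ℝ ∞ f) :
    ContDiff ℝ ∞ (partialSnd f) := by
  have : ContDiff ℝ ∞ (fderiv ℝ f) := hf.fderiv_right (by simp)
  unfold partialSnd
  fun_prop

theorem hasFDerivAt_partialSnd {f : ℝ × E → F} (hf : ContDiff ℝ ∞ f) (t : ℝ) (u : E) :
    HasFDerivAt (fun v => f (t, v)) (partialSnd f (t, u)) u := by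
  have h1 : HasFDerivAt f (fderiv ℝ f (t, u)) (t, u) :=
    (hf.differentiable (by simp) _).hasFDerivAt
  exact h1.comp u (hasFDerivAt_prodMk_right t u)

/-- Compactness of the interval makes `partialSnd f` uniformly continuous along the graph of `γ`.
The mean value inequality on a ball then bounds the remainder at each time by `ε` times the sup norm
of `h`, uniformly in time. -/
theorem hasFDerivAt_compOp {f : ℝ × E → F} (hf : ContDiff ℝ ∞ f) (γ : C(I, E)) :
    HasFDerivAt (compOp f hf.continuous)
      (curveApply (compOp (partialSnd f) (contDiff_partialSnd hf).continuous γ)) γ := by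
  have hc' := (contDiff_partialSnd hf).continuous
  rw [hasFDerivAt_iff_isLittleO_nhds_zero, Asymptotics.isLittleO_iff]
  intro ε hε
  have key : ∀ᶠ v in 𝓝 (0 : E), ∀ t ∈ (univ : Set I),
      ‖partialSnd f (t, γ t + v) - partialSnd f (t, γ t)‖ < ε := by
    refine isCompact_univ.eventually_forall_of_forall_eventually fun t _ => ?_
    have hc : Continuous fun z : E × I =>
        ‖partialSnd f (z.2, γ z.2 + z.1) - partialSnd f (z.2, γ z.2)‖ := by fun_prop
    exact hc.continuousAt.eventually_lt continuousAt_const (by simpa using hε)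
  obtain ⟨δ, hδ, hball⟩ := Metric.eventually_nhds_iff_ball.1 key
  filter_upwards [Metric.ball_mem_nhds (0 : C(I, E)) hδ] with h hh
  rw [ContinuousMap.norm_le _ (by positivity)]
  intro t
  have hht : ‖h t‖ ≤ ‖h‖ := h.norm_coe_le_norm t
  have hmem : ∀ v ∈ Metric.ball (0 : E) δ,
      ‖partialSnd f (t, γ t + v) - partialSnd f (t, γ t)‖ ≤ ε :=
    fun v hv => (hball v hv t (mem_univ _)).le
  have hd : ∀ v ∈ Metric.ball (0 : E) δ,
      HasFDerivWithinAt (fun v => f (t, γ t + v) - partialSnd f (t, γ t) v)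
        (partialSnd f (t, γ t + v) - partialSnd f (t, γ t)) (Metric.ball (0 : E) δ) v := by
    intro v _
    refine HasFDerivAt.hasFDerivWithinAt ?_
    have h1 := (hasFDerivAt_partialSnd hf t (γ t + v)).comp v
      ((hasFDerivAt_id v).const_add (γ t))
    exact h1.sub (partialSnd f (t, γ t)).hasFDerivAt
  have h0 : (0 : E) ∈ Metric.ball (0 : E) δ := Metric.mem_ball_self hδ
  have hv : h t ∈ Metric.ball (0 : E) δ := by
    rw [mem_ball_zero_iff] at hh ⊢
    exact hht.trans_lt hh
  have := (convex_ball (0 : E) δ).norm_image_sub_le_of_norm_hasFDerivWithin_le hd hmem h0 hv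
  simp only [add_zero, map_zero, sub_zero] at this
  calc ‖(compOp f hf.continuous (γ + h) - compOp f hf.continuous γ -
        curveApply (compOp (partialSnd f) hc' γ) h) t‖
      = ‖f (t, γ t + h t) - partialSnd f (t, γ t) (h t) - f (t, γ t)‖ := by
        simp [sub_right_comm]
    _ ≤ ε * ‖h t‖ := this
    _ ≤ ε * ‖h‖ := by gcongr

/-- The derivative is the composition operator of `partialSnd f` followed by the bounded linear map
`curveApply`, so regularity climbs one order at a time. The target space varies in the induction,
which is why both spaces live in one universe. -/
theorem contDiff_compOp_nat (n : ℕ) : ∀ {F : Type u} [NormedAddCommGroup F] [NormedSpace ℝ F]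
    {f : ℝ × E → F} (hf : ContDiff ℝ ∞ f), ContDiff ℝ n (compOp f hf.continuous) := by
  induction n with
  | zero =>
    intro F _ _ f hf
    rw [Nat.cast_zero, contDiff_zero, continuous_iff_continuousAt]
    exact fun γ => (hasFDerivAt_compOp hf γ).continuousAt
  | succ n ih =>
    intro F _ _ f hf
    rw [Nat.cast_succ, contDiff_succ_iff_hasFDerivAt]
    exact ⟨fun γ => curveApply (compOp (partialSnd f) (contDiff_partialSnd hf).continuous γ),
      contDiff_curveApply.comp (ih (contDiff_partialSnd hf)),
      fun γ => hasFDerivAt_compOp hf γ⟩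

theorem contDiff_compOp {f : ℝ × E → F} (hf : ContDiff ℝ ∞ f) :
    ContDiff ℝ ∞ (compOp f hf.continuous) :=
  contDiff_infty.2 fun n => contDiff_compOp_nat n hf

end Nemytskii

/-! ### Integral operators on spaces of continuous curves -/

section Volterra

open unitInterval MeasureTheory intervalIntegral

variable {E : Type*} [NormedAddCommGroup E] [NormedSpace ℝ E]

/-- The extension of a curve on the unit interval to the real line by constants. -/
def extend (γ : C(I, E)) : ℝ → E := IccExtend zero_le_one γ

theorem continuous_extend (γ : C(I, E)) : Continuous (extend γ) := γ.continuous.Icc_extend'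

theorem extend_of_mem (γ : C(I, E)) {t : ℝ} (ht : t ∈ Icc (0 : ℝ) 1) : extend γ t = γ ⟨t, ht⟩ :=
  IccExtend_of_mem _ _ ht

theorem norm_extend_le (γ : C(I, E)) (t : ℝ) : ‖extend γ t‖ ≤ ‖γ‖ := γ.norm_coe_le_norm _

/-- The operator `γ ↦ (t ↦ ∫₀ᵗ γ)`. -/
def integralOp : C(I, E) →L[ℝ] C(I, E) :=
  LinearMap.mkContinuous
    { toFun := fun γ => ⟨fun t => ∫ s in (0 : ℝ)..t, extend γ s, by
        have : Continuous fun t : ℝ => ∫ s in (0 : ℝ)..t, extend γ s :=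
          continuous_primitive (fun a b => (continuous_extend γ).intervalIntegrable a b) 0
        exact this.comp continuous_subtype_val⟩
      map_add' := fun γ δ => by
        ext t
        exact integral_add ((continuous_extend γ).intervalIntegrable _ _)
          ((continuous_extend δ).intervalIntegrable _ _)
      map_smul' := fun c γ => by
        ext t
        exact integral_smul c _ }
    1 (by
      intro γ
      rw [ContinuousMap.norm_le _ (by positivity)]
      intro t
      calc ‖∫ s in (0 : ℝ)..t, extend γ s‖ ≤ ‖γ‖ * |(t : ℝ) - 0| :=
            norm_integral_le_of_norm_le_const fun s _ => norm_extend_le γ s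
        _ ≤ ‖γ‖ * 1 := by
            gcongr
            rw [sub_zero, abs_of_nonneg t.2.1]
            exact t.2.2
        _ = 1 * ‖γ‖ := by ring)

/-- Multiplication by the weight `exp (k t)`. -/
def weight (k : ℝ) : C(I, E) →L[ℝ] C(I, E) :=
  LinearMap.mkContinuous
    { toFun := fun γ => ⟨fun t => Real.exp (k * t) • γ t, by fun_prop⟩
      map_add' := fun γ δ => by ext t; simp
      map_smul' := fun c γ => by ext t; exact smul_comm (Real.exp (k * t)) c (γ t) }
    (Real.exp |k|) (by
      intro γ
      rw [ContinuousMap.norm_le _ (by positivity)]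
      intro t
      change ‖Real.exp (k * t) • γ t‖ ≤ _
      rw [norm_smul, Real.norm_eq_abs, Real.abs_exp]
      gcongr
      · calc k * t ≤ |k * t| := le_abs_self _
          _ = |k| * t := by rw [abs_mul, abs_of_nonneg t.2.1]
          _ ≤ |k| * 1 := by gcongr; exact t.2.2
          _ = |k| := mul_one _
      · exact γ.norm_coe_le_norm t)

theorem weight_apply (k : ℝ) (γ : C(I, E)) (t : I) : weight k γ t = Real.exp (k * t) • γ t := rfl

theorem weight_mul_weight_neg (k : ℝ) : (weight k : C(I, E) →L[ℝ] C(I, E)) * weight (-k) = 1 := by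
  ext γ t
  simp [weight_apply, smul_smul, ← Real.exp_add]

/-- The weight gains a factor `1 / k`; a Volterra operator becomes a contraction once `k` exceeds
the norm of its kernel. -/
theorem integral_exp_neg_le {k : ℝ} (hk : 0 < k) (t : ℝ) :
    ∫ s in (0 : ℝ)..t, Real.exp (k * (s - t)) ≤ 1 / k := by
  have hd : ∀ s ∈ uIcc 0 t, HasDerivAt (fun s => Real.exp (k * (s - t)) / k)
      (Real.exp (k * (s - t))) s := by
    intro s _
    have := ((((hasDerivAt_id s).sub_const t).const_mul k).exp).div_const k
    convert! this using 1
    field_simp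
    simp
  rw [integral_eq_sub_of_hasDerivAt hd
    (Continuous.intervalIntegrable (by fun_prop) _ _)]
  have : 0 ≤ Real.exp (k * (0 - t)) / k := by positivity
  simp
  simpa using this

/-- Volterra operators are small perturbations of the identity for a weighted norm. -/
theorem isUnit_one_sub_volterra [CompleteSpace E] (a : C(I, E →L[ℝ] E)) :
    IsUnit (1 - integralOp ∘L curveApply a) := by
  set V : C(I, E) →L[ℝ] C(I, E) := integralOp ∘L curveApply a
  -- Conjugation with the weight leaves an operator of norm at most `‖a‖ / k`. Adding one makes this
  -- ratio less than one and keeps `k` positive when `a = 0`.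
  let k : ℝ := ‖a‖ + 1
  have hk : 0 < k := by positivity
  let w : (C(I, E) →L[ℝ] C(I, E))ˣ :=
    ⟨weight (-k), weight k, by simpa using weight_mul_weight_neg (E := E) (-k),
      weight_mul_weight_neg k⟩
  have hnorm : ‖(w : C(I, E) →L[ℝ] C(I, E)) * V * (↑w⁻¹ : C(I, E) →L[ℝ] C(I, E))‖ < 1 := by
    have hlt : ‖a‖ / k < 1 := by rw [div_lt_one hk]; simp [k]
    refine lt_of_le_of_lt (ContinuousLinearMap.opNorm_le_bound _ (by positivity) fun γ => ?_) hlt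
    rw [ContinuousMap.norm_le _ (by positivity)]
    intro t
    have hbd : ∀ s ∈ Ioc (0 : ℝ) t,
        ‖Real.exp (-k * t) • extend (curveApply a (weight k γ)) s‖
          ≤ ‖a‖ * ‖γ‖ * Real.exp (k * (s - t)) := by
      intro s hs
      have hs' : s ∈ Icc (0 : ℝ) 1 := ⟨hs.1.le, hs.2.trans t.2.2⟩
      rw [extend_of_mem _ hs', curveApply_apply, weight_apply, map_smul, smul_smul, norm_smul,
        ← Real.exp_add, Real.norm_eq_abs, Real.abs_exp]
      have h1 : ‖a ⟨s, hs'⟩ (γ ⟨s, hs'⟩)‖ ≤ ‖a‖ * ‖γ‖ :=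
        ((a _).le_opNorm _).trans (by
          gcongr
          · exact a.norm_coe_le_norm _
          · exact γ.norm_coe_le_norm _)
      calc _ ≤ Real.exp (-k * t + k * s) * (‖a‖ * ‖γ‖) := by gcongr
        _ = _ := by rw [mul_comm]; congr 2; ring
    change ‖Real.exp (-k * t) • ∫ s in (0 : ℝ)..t, extend (curveApply a (weight k γ)) s‖ ≤ _
    rw [← intervalIntegral.integral_smul]
    calc _ ≤ ∫ s in (0 : ℝ)..t, ‖a‖ * ‖γ‖ * Real.exp (k * (s - t)) :=
          norm_integral_le_of_norm_le t.2.1 (ae_of_all _ hbd)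
            (Continuous.intervalIntegrable (by fun_prop) _ _)
      _ = ‖a‖ * ‖γ‖ * ∫ s in (0 : ℝ)..t, Real.exp (k * (s - t)) := integral_const_mul _ _
      _ ≤ ‖a‖ * ‖γ‖ * (1 / k) := by
          gcongr
          exact integral_exp_neg_le hk _
      _ = ‖a‖ / k * ‖γ‖ := by ring
  have h1 := isUnit_one_sub_of_norm_lt_one (R := C(I, E) →L[ℝ] C(I, E)) hnorm
  have h2 : (1 - V) = (↑w⁻¹ : C(I, E) →L[ℝ] C(I, E)) * (1 - w * V * ↑w⁻¹) * w := by
    have e1 : (↑w⁻¹ : C(I, E) →L[ℝ] C(I, E)) * w = 1 := w.inv_mul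
    calc 1 - V = 1 - (↑w⁻¹ * w) * V * (↑w⁻¹ * w) := by rw [e1, one_mul, mul_one]
      _ = ↑w⁻¹ * w - (↑w⁻¹ * w) * V * (↑w⁻¹ * w) := by rw [e1]
      _ = _ := by simp only [mul_sub, sub_mul, mul_one, mul_assoc]
  rw [h2]
  exact ((w⁻¹).isUnit.mul h1).mul w.isUnit

end Volterra

/-! ### Smooth local flows of time-dependent vector fields near a rest point -/

section Flow

universe u

open unitInterval MeasureTheory intervalIntegral

variable {E : Type u} [NormedAddCommGroup E] [NormedSpace ℝ E]

/-- Constant curves. -/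
def constCurve : E →L[ℝ] C(I, E) :=
  LinearMap.mkContinuous
    { toFun := fun u => ContinuousMap.const I u
      map_add' := fun _ _ => rfl
      map_smul' := fun _ _ => rfl } 1 (by
      intro u
      rw [ContinuousMap.norm_le _ (by positivity)]
      intro t
      rw [one_mul]
      exact le_rfl)

theorem hasDerivWithinAt_extend_of_eq_integral [CompleteSpace E] {γ δ : C(I, E)} {u : E}
    (h : γ = constCurve u + integralOp δ) {t : ℝ} (ht : t ∈ Icc (0 : ℝ) 1) :
    HasDerivWithinAt (extend γ) (extend δ t) (Icc 0 1) t := by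
  have h1 : HasDerivAt (fun t => u + ∫ s in (0 : ℝ)..t, extend δ s) (extend δ t) t :=
    ((continuous_extend δ).integral_hasStrictDerivAt 0 t).hasDerivAt.const_add u
  refine h1.hasDerivWithinAt.congr_of_mem (fun s hs => ?_) ht
  rw [extend_of_mem γ hs, h]
  rfl

/-- The flow of a smooth time-dependent vector field near a rest point exists up to time one, depends
smoothly on the initial value, and its derivative solves the linearized equation. -/
theorem exists_smooth_flow [CompleteSpace E] {f : ℝ × E → E} (hf : ContDiff ℝ ∞ f) {u₀ : E}
    (h₀ : ∀ t ∈ Icc (0 : ℝ) 1, f (t, u₀) = 0) :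
    ∃ (A : Set E) (Γ : E → C(I, E)), IsOpen A ∧ u₀ ∈ A ∧ ContDiffOn ℝ ∞ Γ A ∧
      Γ u₀ = constCurve u₀ ∧
      ∀ u ∈ A, Γ u 0 = u ∧
        (∀ t ∈ Icc (0 : ℝ) 1,
          HasDerivWithinAt (extend (Γ u)) (f (t, extend (Γ u) t)) (Icc 0 1) t) ∧
        ∀ v : E, fderiv ℝ Γ u v 0 = v ∧ ∀ t ∈ Icc (0 : ℝ) 1,
          HasDerivWithinAt (extend (fderiv ℝ Γ u v))
            (partialSnd f (t, extend (Γ u) t) (extend (fderiv ℝ Γ u v) t)) (Icc 0 1) t := by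
  let J : C(I, E) →L[ℝ] C(I, E) := integralOp
  let K : E →L[ℝ] C(I, E) := constCurve
  let N : C(I, E) → C(I, E) := compOp f hf.continuous
  let N' : C(I, E) → C(I, E) →L[ℝ] C(I, E) := fun γ =>
    curveApply (compOp (partialSnd f) (contDiff_partialSnd hf).continuous γ)
  have hN : ContDiff ℝ ∞ N := contDiff_compOp hf
  have hN' : ∀ γ, HasFDerivAt N (N' γ) γ := hasFDerivAt_compOp hf
  -- The zeros are the solutions of the integral equation with initial value `z.1`. The derivative
  -- in the curve variable is the identity minus a Volterra operator, which is invertible without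
  -- any smallness of the time interval.
  let F : E × C(I, E) → C(I, E) := fun z => z.2 - K z.1 - J (N z.2)
  have hF : ContDiff ℝ ∞ F := by
    have h1 : ContDiff ℝ ∞ fun z : E × C(I, E) => N z.2 := hN.comp contDiff_snd
    have h2 : ContDiff ℝ ∞ fun z : E × C(I, E) => J (N z.2) := by fun_prop
    have h3 : ContDiff ℝ ∞ fun z : E × C(I, E) => K z.1 := by fun_prop
    exact (contDiff_snd.sub h3).sub h2
  have hF' : ∀ z : E × C(I, E), HasFDerivAt F
      (.snd ℝ E C(I, E) - K ∘L .fst ℝ E C(I, E) - J ∘L (N' z.2 ∘L .snd ℝ E C(I, E))) z := by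
    intro z
    have h1 : HasFDerivAt (fun z : E × C(I, E) => N z.2) (N' z.2 ∘L .snd ℝ E C(I, E)) z :=
      (hN' z.2).comp z hasFDerivAt_snd
    have h2 : HasFDerivAt (fun z : E × C(I, E) => J (N z.2)) (J ∘L (N' z.2 ∘L .snd ℝ E C(I, E))) z :=
      J.hasFDerivAt.comp z h1
    have h3 : HasFDerivAt (fun z : E × C(I, E) => K z.1) (K ∘L .fst ℝ E C(I, E)) z :=
      K.hasFDerivAt.comp z hasFDerivAt_fst
    exact (hasFDerivAt_snd.sub h3).sub h2
  have hF₀ : F (u₀, K u₀) = 0 := by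
    have : N (K u₀) = 0 := by
      ext t
      exact h₀ t t.2
    simp [F, this]
  have hinv : (fderiv ℝ F (u₀, K u₀) ∘L .inr ℝ E C(I, E)).IsInvertible := by
    rw [(hF' _).fderiv]
    have e : ((.snd ℝ E C(I, E) - K ∘L .fst ℝ E C(I, E) -
        J ∘L (N' (K u₀) ∘L .snd ℝ E C(I, E)) : E × C(I, E) →L[ℝ] C(I, E)) ∘L .inr ℝ E C(I, E))
        = 1 - J ∘L N' (K u₀) := by
      ext h : 1
      simp
    rw [e]
    obtain ⟨w, hw⟩ := isUnit_one_sub_volterra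
      (compOp (partialSnd f) (contDiff_partialSnd hf).continuous (K u₀))
    exact ⟨ContinuousLinearEquiv.ofUnit w, hw⟩
  obtain ⟨A, B, Γ, hA, hB, hu, hγ, -, hΓ, hΓB, hiff⟩ :=
    exists_contDiffOn_implicit isOpen_univ hF.contDiffOn (mem_univ _) hF₀ hinv
  have hsol : ∀ u ∈ A, Γ u = K u + J (N (Γ u)) := by
    intro u hu
    have := (hiff u hu (Γ u) (hΓB hu)).2 rfl
    have h2 : Γ u - K u - J (N (Γ u)) = 0 := this
    rw [sub_sub, sub_eq_zero] at h2
    exact h2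
  have hzero : ∀ γ : C(I, E), J γ 0 = 0 := by
    intro γ
    change ∫ s in (0 : ℝ)..((0 : I) : ℝ), extend γ s = 0
    simp
  refine ⟨A, Γ, hA, hu, hΓ, ((hiff u₀ hu _ hγ).1 hF₀).symm, fun u hu => ⟨?_, ?_, fun v => ?_⟩⟩
  · rw [hsol u hu, ContinuousMap.add_apply, hzero, add_zero]
    rfl
  · intro t ht
    have := hasDerivWithinAt_extend_of_eq_integral (hsol u hu) ht
    rw [extend_of_mem (N (Γ u)) ht] at this
    rw [extend_of_mem (Γ u) ht]
    exact this
  · have hd : HasFDerivAt Γ (fderiv ℝ Γ u) u :=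
      ((hΓ.contDiffAt (hA.mem_nhds hu)).differentiableAt (by simp)).hasFDerivAt
    -- Differentiating the integral equation in the initial value gives the integral form of the
    -- linearized equation.
    have h1 : HasFDerivAt (fun u => K u + J (N (Γ u)))
        (K + J ∘L (N' (Γ u) ∘L fderiv ℝ Γ u)) u :=
      K.hasFDerivAt.add (J.hasFDerivAt.comp u ((hN' (Γ u)).comp u hd))
    have h2 : fderiv ℝ Γ u = K + J ∘L (N' (Γ u) ∘L fderiv ℝ Γ u) := by
      refine hd.unique (h1.congr_of_eventuallyEq ?_)
      filter_upwards [hA.mem_nhds hu] with z hz using hsol z hz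
    have h3 : fderiv ℝ Γ u v = K v + J (N' (Γ u) (fderiv ℝ Γ u v)) := congrArg (fun T => T v) h2
    constructor
    · rw [h3, ContinuousMap.add_apply, hzero, add_zero]
      rfl
    · intro t ht
      have := hasDerivWithinAt_extend_of_eq_integral h3 ht
      rw [extend_of_mem (N' (Γ u) (fderiv ℝ Γ u v)) ht] at this
      rw [extend_of_mem (Γ u) ht, extend_of_mem (fderiv ℝ Γ u v) ht]
      exact this

end Flow

/-! ### Uniqueness for ordinary differential equations on the unit interval -/

section Unique

variable {E : Type*} [NormedAddCommGroup E] [NormedSpace ℝ E]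

theorem eqOn_of_hasDerivWithinAt {v : ℝ → E → E} {K : NNReal} {s : ℝ → Set E} {γ δ : ℝ → E}
    (hv : ∀ t ∈ Icc (0 : ℝ) 1, LipschitzOnWith K (v t) (s t))
    (hγ : ∀ t ∈ Icc (0 : ℝ) 1, HasDerivWithinAt γ (v t (γ t)) (Icc 0 1) t)
    (hγs : ∀ t ∈ Icc (0 : ℝ) 1, γ t ∈ s t)
    (hδ : ∀ t ∈ Icc (0 : ℝ) 1, HasDerivWithinAt δ (v t (δ t)) (Icc 0 1) t)
    (hδs : ∀ t ∈ Icc (0 : ℝ) 1, δ t ∈ s t) (h : γ 0 = δ 0) : EqOn γ δ (Icc 0 1) := by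
  have hd : ∀ {γ : ℝ → E}, (∀ t ∈ Icc (0 : ℝ) 1, HasDerivWithinAt γ (v t (γ t)) (Icc 0 1) t) →
      ∀ t ∈ Ico (0 : ℝ) 1, HasDerivWithinAt γ (v t (γ t)) (Ici t) t := fun hγ t ht =>
    ((hγ t ⟨ht.1, ht.2.le⟩).mono (Icc_subset_Icc_left ht.1)).mono_of_mem_nhdsWithin
      (Icc_mem_nhdsGE ht.2)
  exact ODE_solution_unique_of_mem_Icc_right (fun t ht => hv t ⟨ht.1, ht.2.le⟩)
    (fun t ht => (hγ t ht).continuousWithinAt) (hd hγ) (fun t ht => hγs t ⟨ht.1, ht.2.le⟩)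
    (fun t ht => (hδ t ht).continuousWithinAt) (hd hδ) (fun t ht => hδs t ⟨ht.1, ht.2.le⟩) h

theorem eqOn_of_hasDerivWithinAt_left {v : ℝ → E → E} {K : NNReal} {s : ℝ → Set E} {γ δ : ℝ → E}
    (hv : ∀ t ∈ Icc (0 : ℝ) 1, LipschitzOnWith K (v t) (s t))
    (hγ : ∀ t ∈ Icc (0 : ℝ) 1, HasDerivWithinAt γ (v t (γ t)) (Icc 0 1) t)
    (hγs : ∀ t ∈ Icc (0 : ℝ) 1, γ t ∈ s t)
    (hδ : ∀ t ∈ Icc (0 : ℝ) 1, HasDerivWithinAt δ (v t (δ t)) (Icc 0 1) t)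
    (hδs : ∀ t ∈ Icc (0 : ℝ) 1, δ t ∈ s t) (h : γ 1 = δ 1) : EqOn γ δ (Icc 0 1) := by
  have hd : ∀ {γ : ℝ → E}, (∀ t ∈ Icc (0 : ℝ) 1, HasDerivWithinAt γ (v t (γ t)) (Icc 0 1) t) →
      ∀ t ∈ Ioc (0 : ℝ) 1, HasDerivWithinAt γ (v t (γ t)) (Iic t) t := fun hγ t ht =>
    ((hγ t ⟨ht.1.le, ht.2⟩).mono (Icc_subset_Icc_right ht.2)).mono_of_mem_nhdsWithin
      (Icc_mem_nhdsLE ht.1)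
  exact ODE_solution_unique_of_mem_Icc_left (fun t ht => hv t ⟨ht.1.le, ht.2⟩)
    (fun t ht => (hγ t ht).continuousWithinAt) (hd hγ) (fun t ht => hγs t ⟨ht.1.le, ht.2⟩)
    (fun t ht => (hδ t ht).continuousWithinAt) (hd hδ) (fun t ht => hδs t ⟨ht.1.le, ht.2⟩) h

/-- Uniqueness of integral curves of a smooth time-dependent vector field. -/
theorem eqOn_of_contDiff [ProperSpace E] {f : ℝ × E → E} (hf : ContDiff ℝ ∞ f) {γ δ : ℝ → E}
    (hγ : ∀ t ∈ Icc (0 : ℝ) 1, HasDerivWithinAt γ (f (t, γ t)) (Icc 0 1) t)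
    (hδ : ∀ t ∈ Icc (0 : ℝ) 1, HasDerivWithinAt δ (f (t, δ t)) (Icc 0 1) t)
    (h : γ 0 = δ 0) : EqOn γ δ (Icc 0 1) := by
  have hcγ : ContinuousOn γ (Icc 0 1) := fun t ht => (hγ t ht).continuousWithinAt
  have hcδ : ContinuousOn δ (Icc 0 1) := fun t ht => (hδ t ht).continuousWithinAt
  obtain ⟨R₁, hR₁⟩ := (isCompact_Icc.image_of_continuousOn hcγ).isBounded.exists_norm_le
  obtain ⟨R₂, hR₂⟩ := (isCompact_Icc.image_of_continuousOn hcδ).isBounded.exists_norm_le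
  -- A smooth field is only locally Lipschitz. Both solutions are bounded on `[0, 1]`, so a closed
  -- ball containing them suffices, and it is convex.
  set R := max R₁ R₂
  have hc := (contDiff_partialSnd hf).continuous
  obtain ⟨K, hK⟩ := (((isCompact_Icc (a := (0 : ℝ)) (b := 1)).prod
    (isCompact_closedBall (0 : E) R)).image hc).isBounded.exists_norm_le
  refine eqOn_of_hasDerivWithinAt (v := fun t x => f (t, x)) (K := K.toNNReal)
    (s := fun _ => Metric.closedBall 0 R) (fun t ht => ?_) hγ (fun t ht => ?_) hδ
    (fun t ht => ?_) h
  · refine (convex_closedBall (0 : E) R).lipschitzOnWith_of_nnnorm_hasFDerivWithin_le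
      (fun x _ => (hasFDerivAt_partialSnd hf t x).hasFDerivWithinAt) fun x hx => ?_
    rw [← norm_toNNReal]
    exact Real.toNNReal_le_toNNReal (hK _ (mem_image_of_mem _ ⟨ht, hx⟩))
  · rw [mem_closedBall_zero_iff]
    exact (hR₁ _ (mem_image_of_mem _ ht)).trans (le_max_left _ _)
  · rw [mem_closedBall_zero_iff]
    exact (hR₂ _ (mem_image_of_mem _ ht)).trans (le_max_right _ _)

/-- A solution of a linear equation that vanishes at the final time vanishes. -/
theorem eq_zero_of_linear {a : ℝ → E →L[ℝ] E} (ha : ContinuousOn a (Icc 0 1)) {γ : ℝ → E}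
    (hγ : ∀ t ∈ Icc (0 : ℝ) 1, HasDerivWithinAt γ (a t (γ t)) (Icc 0 1) t)
    (h : γ 1 = 0) : γ 0 = 0 := by
  obtain ⟨K, hK⟩ := (isCompact_Icc.image_of_continuousOn ha).isBounded.exists_norm_le
  have h0 : EqOn γ (fun _ => 0) (Icc 0 1) := by
    refine eqOn_of_hasDerivWithinAt_left (v := fun t x => a t x) (K := K.toNNReal)
      (s := fun _ => univ) (fun t ht => ?_) hγ (fun _ _ => mem_univ _) (fun t ht => ?_)
      (fun _ _ => mem_univ _) h
    · refine (LipschitzWith.weaken (a t).lipschitz ?_).lipschitzOnWith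
      rw [← norm_toNNReal]
      exact Real.toNNReal_le_toNNReal (hK _ (mem_image_of_mem _ ht))
    · simpa using hasDerivWithinAt_const t (Icc (0 : ℝ) 1) (0 : E)
  exact h0 (by simp)

end Unique

/-! ### Gluing of locally unique solutions -/

section Glue

variable {C X Y : Type*} [PseudoMetricSpace X] [PseudoMetricSpace Y]

/-- Solutions of a relation, given near the points of a set and locally unique there, glue to a
solution on a neighborhood of the set. -/
theorem exists_glued [Nonempty X] {i : C → X} {i' : C → Y}
    (hi : ∀ c, ∀ ε > 0, ∃ δ > 0, ∀ c', dist (i' c') (i' c) < δ → dist (i c') (i c) < ε)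
    {R : Y → X → Prop} {A : C → Set Y} {B : C → Set X} {r : C → Y → X}
    (hA : ∀ c, IsOpen (A c)) (hiA : ∀ c, i' c ∈ A c) (hB : ∀ c, B c ∈ 𝓝 (i c))
    (hr : ∀ c, ContinuousOn (r c) (A c)) (hri : ∀ c, r c (i' c) = i c)
    (hR : ∀ c, ∀ y ∈ A c, R y (r c y))
    (huniq : ∀ c, ∀ y ∈ A c, ∀ x ∈ B c, R y x → x = r c y) :
    ∃ (O : C → Set Y) (g : Y → X), ∀ c, IsOpen (O c) ∧ i' c ∈ O c ∧ O c ⊆ A c ∧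
      ∀ y ∈ O c, g y = r c y := by
  classical
  choose b hb hbB using fun c => Metric.mem_nhds_iff.1 (hB c)
  choose δ' hδ' hδ'i using fun c => hi c (b c / 2) (half_pos (hb c))
  -- The halves leave room for two triangle inequalities: one bounds the distance of two base points
  -- whose sets overlap, the other puts the competing solution into `B c`. The comparison is made at
  -- the base point with the larger radius.
  let δ : C → ℝ := fun c => min (δ' c / 2) (b c / 2)
  have hδ : ∀ c, 0 < δ c := fun c => lt_min (half_pos (hδ' c)) (half_pos (hb c))
  let O : C → Set Y := fun c =>
    (A c ∩ r c ⁻¹' Metric.ball (i c) (δ c)) ∩ Metric.ball (i' c) (δ c)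
  have key : ∀ c c' y, y ∈ O c → y ∈ O c' → δ c' ≤ δ c → r c' y = r c y := by
    intro c c' y hy hy' hle
    refine huniq c y hy.1.1 _ (hbB c ?_) (hR c' y hy'.1.1)
    have h1 : dist (i' c') (i' c) < δ' c := by
      calc dist (i' c') (i' c) ≤ dist y (i' c') + dist y (i' c) := dist_triangle_left _ _ _
        _ < δ c' + δ c := add_lt_add hy'.2 hy.2
        _ ≤ δ c + δ c := by gcongr
        _ ≤ δ' c / 2 + δ' c / 2 := add_le_add (min_le_left _ _) (min_le_left _ _)
        _ = δ' c := add_halves _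
    rw [Metric.mem_ball]
    calc dist (r c' y) (i c) ≤ dist (r c' y) (i c') + dist (i c') (i c) := dist_triangle _ _ _
      _ < δ c' + b c / 2 := add_lt_add hy'.1.2 (hδ'i c c' h1)
      _ ≤ b c / 2 + b c / 2 := by
        gcongr
        exact hle.trans (min_le_right _ _)
      _ = b c := add_halves _
  have key' : ∀ c c' y, y ∈ O c → y ∈ O c' → r c' y = r c y := fun c c' y hy hy' =>
    (le_total (δ c') (δ c)).elim (key c c' y hy hy') fun h => (key c' c y hy' hy h).symm
  let g : Y → X := fun y => if h : ∃ c, y ∈ O c then r h.choose y else Classical.arbitrary X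
  refine ⟨O, g, fun c => ⟨((hr c).isOpen_inter_preimage (hA c) Metric.isOpen_ball).inter
    Metric.isOpen_ball, ⟨⟨hiA c, ?_⟩, Metric.mem_ball_self (hδ c)⟩, fun y hy => hy.1.1, ?_⟩⟩
  · rw [mem_preimage, hri]
    exact Metric.mem_ball_self (hδ c)
  · intro y hy
    have h : ∃ c, y ∈ O c := ⟨c, hy⟩
    simp only [g, dif_pos h]
    exact key' c _ y hy h.choose_spec

end Glue

/-! ### Smooth left inverses of immersions -/

section LeftInverse

variable {ES HS S : Type*} [NormedAddCommGroup ES] [NormedSpace ℝ ES]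
  [TopologicalSpace HS] {I : ModelWithCorners ℝ ES HS} [TopologicalSpace S] [ChartedSpace HS S]
  [IsManifold I ∞ S]

theorem mfderiv_eq_fderiv_comp_extChartAt {F : Type*} [NormedAddCommGroup F] [NormedSpace ℝ F]
    [I.Boundaryless] {e : S → F} {x₀ x : S} (hx : x ∈ (extChartAt I x₀).source)
    (he : ContMDiffAt I 𝓘(ℝ, F) ∞ e x) (v : TangentSpace I x) :
    mfderiv I 𝓘(ℝ, F) e x v = fderiv ℝ (e ∘ (extChartAt I x₀).symm) (extChartAt I x₀ x)
      (mfderiv I 𝓘(ℝ, ES) (extChartAt I x₀) x v) := by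
  have hx' : x ∈ (chartAt HS x₀).source := by rwa [extChartAt_source] at hx
  have hu : extChartAt I x₀ x ∈ (extChartAt I x₀).target := (extChartAt I x₀).map_source hx
  have hl : (extChartAt I x₀).symm (extChartAt I x₀ x) = x := (extChartAt I x₀).left_inv hx
  have hs : ContMDiffAt 𝓘(ℝ, ES) I ∞ (extChartAt I x₀).symm (extChartAt I x₀ x) :=
    (contMDiffOn_extChartAt_symm x₀).contMDiffAt ((isOpen_extChartAt_target x₀).mem_nhds hu)
  have hd : ContMDiffAt 𝓘(ℝ, ES) 𝓘(ℝ, F) ∞ (e ∘ (extChartAt I x₀).symm) (extChartAt I x₀ x) :=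
    ContMDiffAt.comp _ (by rwa [hl]) hs
  have heq : e =ᶠ[𝓝 x] (e ∘ (extChartAt I x₀).symm) ∘ extChartAt I x₀ := by
    filter_upwards [(isOpen_extChartAt_source x₀).mem_nhds hx] with y hy
    rw [Function.comp_apply, Function.comp_apply, (extChartAt I x₀).left_inv hy]
  rw [heq.mfderiv_eq, mfderiv_comp x (hd.mdifferentiableAt (by simp))
    (mdifferentiableAt_extChartAt hx'), mfderiv_eq_fderiv]
  rfl

theorem contDiffOn_comp_extChartAt_symm {F : Type*} [NormedAddCommGroup F] [NormedSpace ℝ F]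
    {e : S → F} {W : Set S} (he : ContMDiffOn I 𝓘(ℝ, F) ∞ e W) (x₀ : S) :
    ContDiffOn ℝ ∞ (e ∘ (extChartAt I x₀).symm)
      ((extChartAt I x₀).target ∩ (extChartAt I x₀).symm ⁻¹' W) :=
  (he.comp ((contMDiffOn_extChartAt_symm x₀).mono inter_subset_left)
    fun _ h => h.2).contDiffOn

variable [FiniteDimensional ℝ ES] [I.Boundaryless]
  {H : Type*} [NormedAddCommGroup H] [InnerProductSpace ℝ H] [CompleteSpace H]

/-- Near a point at which `e` is an immersion, there is a unique foot point of the perpendicular to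
the image of `e`, and it depends smoothly on the given point. -/
theorem exists_local_footpoint {e : S → H} {W₀ : Set S} (hW₀ : IsOpen W₀)
    (he : ContMDiffOn I 𝓘(ℝ, H) ∞ e W₀) {x₀ : S} (hx₀ : x₀ ∈ W₀)
    (hinj : Function.Injective (mfderiv I 𝓘(ℝ, H) e x₀)) :
    ∃ (A : Set H) (B : Set S) (r : H → S), IsOpen A ∧ IsOpen B ∧ e x₀ ∈ A ∧ x₀ ∈ B ∧ B ⊆ W₀ ∧
      ContMDiffOn 𝓘(ℝ, H) I ∞ r A ∧ MapsTo r A B ∧ ∀ y ∈ A, ∀ x ∈ B,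
        (∀ v : TangentSpace I x, inner ℝ (y - e x) (mfderiv I 𝓘(ℝ, H) e x v : H) = 0) ↔ x = r y := by
  set φ := extChartAt I x₀
  set ê : ES → H := e ∘ φ.symm
  set D : Set ES := φ.target ∩ φ.symm ⁻¹' W₀
  have hφs : ContinuousOn φ.symm φ.target := continuousOn_extChartAt_symm x₀
  have hD : IsOpen D := hφs.isOpen_inter_preimage (isOpen_extChartAt_target x₀) hW₀
  have hê : ContDiffOn ℝ ∞ ê D := contDiffOn_comp_extChartAt_symm he x₀
  have hx₀s : x₀ ∈ φ.source := mem_extChartAt_source x₀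
  set u₀ := φ x₀
  have hu₀ : φ.symm u₀ = x₀ := φ.left_inv hx₀s
  have hu₀D : u₀ ∈ D := ⟨φ.map_source hx₀s, by simpa [hu₀] using hx₀⟩
  have hder : ∀ x ∈ φ.source, x ∈ W₀ → ∀ v : TangentSpace I x, mfderiv I 𝓘(ℝ, H) e x v =
      fderiv ℝ ê (φ x) (mfderiv I 𝓘(ℝ, ES) φ x v) := fun x hx hxW v =>
    mfderiv_eq_fderiv_comp_extChartAt hx (he.contMDiffAt (hW₀.mem_nhds hxW)) v
  have hbij : ∀ x ∈ φ.source, Function.Bijective (mfderiv I 𝓘(ℝ, ES) φ x) := fun x hx =>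
    (isInvertible_mfderiv_extChartAt hx).bijective
  let T := fderiv ℝ ê u₀
  have hT : Function.Injective T := by
    rw [injective_iff_map_eq_zero]
    intro w hw
    obtain ⟨v, hv⟩ := (hbij x₀ hx₀s).2 w
    have h1 : mfderiv I 𝓘(ℝ, H) e x₀ v = 0 := by rw [hder x₀ hx₀s hx₀ v, hv]; exact hw
    have h2 : v = 0 := (injective_iff_map_eq_zero _).1 hinj v h1
    rw [← hv, h2, map_zero]
    rfl
  -- A foot point is a zero of this equation. Its derivative in `u` at the base point is minus the
  -- Gram form of `T`, since the vanishing displacement kills the term with second derivatives. This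
  -- form is definite because `T` is injective, and an injective map to the dual is invertible by
  -- dimension.
  let F : H × ES → (ES →L[ℝ] ℝ) := fun z => (innerSL ℝ (z.1 - ê z.2)) ∘L fderiv ℝ ê z.2
  have hΩ : IsOpen ((univ : Set H) ×ˢ D) := isOpen_univ.prod hD
  have hê2 : ContDiffOn ℝ ∞ (fun z : H × ES => ê z.2) (univ ×ˢ D) :=
    hê.comp contDiffOn_snd fun z hz => hz.2
  have hF : ContDiffOn ℝ ∞ F (univ ×ˢ D) := by
    have h2 : ContDiffOn ℝ ∞ (fun z : H × ES => fderiv ℝ ê z.2) (univ ×ˢ D) :=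
      (hê.fderiv_of_isOpen hD (by simp)).comp contDiffOn_snd fun z hz => hz.2
    have h3 : ContDiffOn ℝ ∞ (fun z : H × ES => innerSL ℝ (z.1 - ê z.2)) (univ ×ˢ D) :=
      (innerSL ℝ (E := H)).contDiff.comp_contDiffOn (contDiffOn_fst.sub hê2)
    exact h3.clm_comp h2
  have hF₀ : F (ê u₀, u₀) = 0 := by simp [F]
  have hdF : ∀ w, (fderiv ℝ F (ê u₀, u₀) ∘L .inr ℝ H ES) w = -((innerSL ℝ (T w)) ∘L T) := by
    intro w
    have hFd : HasFDerivAt F (fderiv ℝ F (ê u₀, u₀)) (ê u₀, u₀) :=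
      ((hF.contDiffAt (hΩ.mem_nhds ⟨mem_univ _, hu₀D⟩)).differentiableAt (by simp)).hasFDerivAt
    have h1 : HasFDerivAt (fun u => F (ê u₀, u)) (fderiv ℝ F (ê u₀, u₀) ∘L .inr ℝ H ES) u₀ :=
      hFd.comp u₀ (hasFDerivAt_prodMk_right (ê u₀) u₀)
    have hêd : HasFDerivAt ê T u₀ :=
      ((hê.contDiffAt (hD.mem_nhds hu₀D)).differentiableAt (by simp)).hasFDerivAt
    have hTd : HasFDerivAt (fderiv ℝ ê) (fderiv ℝ (fderiv ℝ ê) u₀) u₀ :=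
      (((hê.contDiffAt (hD.mem_nhds hu₀D)).fderiv_right (m := ∞)
        (by simp)).differentiableAt (by simp)).hasFDerivAt
    have h2 : HasFDerivAt (fun u => innerSL ℝ (ê u₀ - ê u)) ((innerSL ℝ (E := H)) ∘L (-T)) u₀ :=
      (innerSL ℝ (E := H)).hasFDerivAt.comp u₀ (hêd.const_sub (ê u₀))
    have h3 := h2.clm_comp hTd
    have h4 := h1.unique h3
    rw [h4]
    ext z
    simp [T]
    rfl
  have hinv : (fderiv ℝ F (ê u₀, u₀) ∘L .inr ℝ H ES).IsInvertible := by
    set L := fderiv ℝ F (ê u₀, u₀) ∘L .inr ℝ H ES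
    have hLi : Function.Injective L := by
      rw [injective_iff_map_eq_zero]
      intro w hw
      have h1 : (-((innerSL ℝ (T w)) ∘L T)) w = 0 := by rw [← hdF w]; simp [hw]
      have h2 : inner ℝ (T w) (T w) = 0 := by simpa using h1
      exact hT (by rw [inner_self_eq_zero.1 h2, map_zero])
    have hfin : Module.finrank ℝ ES = Module.finrank ℝ (ES →L[ℝ] ℝ) := by
      rw [← (LinearMap.toContinuousLinearMap : (ES →ₗ[ℝ] ℝ) ≃ₗ[ℝ] (ES →L[ℝ] ℝ)).finrank_eq]
      exact Subspace.dual_finrank_eq.symm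
    exact ⟨(LinearEquiv.ofInjectiveOfFinrankEq (L : ES →ₗ[ℝ] (ES →L[ℝ] ℝ)) hLi
      hfin).toContinuousLinearEquiv, by ext; rfl⟩
  obtain ⟨A, B, g, hA, hB, hyA, huB, hAB, hg, hgB, hiff⟩ :=
    exists_contDiffOn_implicit hΩ hF ⟨mem_univ _, hu₀D⟩ hF₀ hinv
  have heu : ê u₀ = e x₀ := by simp [ê, hu₀]
  have hBD : B ⊆ D := fun u hu => (hAB (mk_mem_prod hyA hu)).2
  refine ⟨A, φ.source ∩ φ ⁻¹' B, φ.symm ∘ g, hA, ?_, heu ▸ hyA, ⟨hx₀s, huB⟩, ?_, ?_, ?_, ?_⟩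
  · exact (continuousOn_extChartAt x₀).isOpen_inter_preimage (isOpen_extChartAt_source x₀) hB
  · rintro x ⟨hx, hxB⟩
    have := (hBD hxB).2
    rwa [mem_preimage, φ.left_inv hx] at this
  · exact (contMDiffOn_extChartAt_symm x₀).comp hg.contMDiffOn fun y hy => (hBD (hgB hy)).1
  · intro y hy
    have ht := (hBD (hgB hy)).1
    refine ⟨φ.map_target ht, ?_⟩
    rw [mem_preimage, Function.comp_apply, φ.right_inv ht]
    exact hgB hy
  · rintro y hy x ⟨hx, hxB⟩
    have hxW : x ∈ W₀ := by
      have := (hBD hxB).2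
      rwa [mem_preimage, φ.left_inv hx] at this
    have h1 : (∀ v : TangentSpace I x, inner ℝ (y - e x) (mfderiv I 𝓘(ℝ, H) e x v : H) = 0) ↔
        F (y, φ x) = 0 := by
      have hex : ê (φ x) = e x := by simp [ê, φ.left_inv hx]
      constructor
      · intro h
        ext w
        obtain ⟨v, rfl⟩ := (hbij x hx).2 w
        have := h v
        rw [hder x hx hxW v] at this
        change inner ℝ (y - ê (φ x)) (fderiv ℝ ê (φ x) _) = 0
        rwa [hex]
      · intro h v
        rw [hder x hx hxW v, ← hex]
        exact congrArg (fun L : ES →L[ℝ] ℝ => L (mfderiv I 𝓘(ℝ, ES) φ x v)) h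
    rw [h1, hiff y hy _ hxB]
    constructor
    · intro h
      rw [Function.comp_apply, ← h, φ.left_inv hx]
    · intro h
      rw [h, Function.comp_apply, φ.right_inv (hBD (hgB hy)).1]

/-- A map to a Hilbert space that is an immersion along a subset and embeds this subset has a smooth
left inverse near the subset. -/
theorem exists_leftInverse [TopologicalSpace.MetrizableSpace S] [Nonempty S]
    {C : Type*} [TopologicalSpace C] {i : C → S} (hi : Continuous i)
    {e : S → H} {W₀ : Set S} (hW₀ : IsOpen W₀) (hiW : ∀ c, i c ∈ W₀)
    (he : ContMDiffOn I 𝓘(ℝ, H) ∞ e W₀)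
    (hinj : ∀ c, Function.Injective (mfderiv I 𝓘(ℝ, H) e (i c)))
    (hei : Topology.IsInducing (e ∘ i)) :
    ∃ (O : Set H) (W : Set S) (r : H → S), IsOpen O ∧ IsOpen W ∧ W ⊆ W₀ ∧ (∀ c, i c ∈ W) ∧
      MapsTo e W O ∧ ContMDiffOn 𝓘(ℝ, H) I ∞ r O ∧ ∀ x ∈ W, r (e x) = x := by
  let _ : MetricSpace S := TopologicalSpace.metrizableSpaceMetric S
  choose A B r hA hB hiA hiB hBW hr hrB hiff using fun c =>
    exists_local_footpoint (I := I) hW₀ he (hiW c) (hinj c)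
  have hri : ∀ c, ∀ x ∈ B c, e x ∈ A c → r c (e x) = x := fun c x hx hex =>
    ((hiff c (e x) hex x hx).1 fun v => by rw [sub_self]; exact inner_zero_left _).symm
  -- That `e ∘ i` is inducing enters here: proximity of the images in `H` forces proximity in `S`,
  -- as required for gluing.
  have hclose : ∀ c, ∀ ε > 0, ∃ δ > 0, ∀ c', dist (e (i c')) (e (i c)) < δ →
      dist (i c') (i c) < ε := by
    intro c ε hε
    have h1 : i ⁻¹' Metric.ball (i c) ε ∈ 𝓝 c :=
      hi.continuousAt.preimage_mem_nhds (Metric.ball_mem_nhds _ hε)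
    rw [hei.nhds_eq_comap, mem_comap] at h1
    obtain ⟨t, ht, hts⟩ := h1
    obtain ⟨δ, hδ, hδt⟩ := Metric.mem_nhds_iff.1 ht
    exact ⟨δ, hδ, fun c' hc' => hts (hδt hc')⟩
  -- Orthogonality to the image is a condition without reference to charts, so all local foot point
  -- maps solve one and the same relation.
  obtain ⟨O, g, hOg⟩ := exists_glued (i := i) (i' := fun c => e (i c)) hclose
    (R := fun y x => ∀ v : TangentSpace I x, inner ℝ (y - e x) (mfderiv I 𝓘(ℝ, H) e x v : H) = 0)
    hA hiA (fun c => (hB c).mem_nhds (hiB c)) (fun c => (hr c).continuousOn)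
    (fun c => hri c _ (hiB c) (hiA c))
    (fun c y hy => (hiff c y hy (r c y) (hrB c hy)).2 rfl)
    (fun c y hy x hx h => (hiff c y hy x hx).1 h)
  have hec : ∀ c, ContinuousOn e (B c) := fun c => he.continuousOn.mono (hBW c)
  refine ⟨⋃ c, O c, ⋃ c, B c ∩ e ⁻¹' O c, g, isOpen_iUnion fun c => (hOg c).1,
    isOpen_iUnion fun c => (hec c).isOpen_inter_preimage (hB c) (hOg c).1, ?_, ?_, ?_, ?_, ?_⟩
  · exact iUnion_subset fun c x hx => hBW c hx.1
  · exact fun c => mem_iUnion.2 ⟨c, hiB c, (hOg c).2.1⟩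
  · intro x hx
    obtain ⟨c, hc⟩ := mem_iUnion.1 hx
    exact mem_iUnion.2 ⟨c, hc.2⟩
  · intro y hy
    obtain ⟨c, hc⟩ := mem_iUnion.1 hy
    have h1 : ContMDiffAt 𝓘(ℝ, H) I ∞ (r c) y :=
      (hr c).contMDiffAt ((hA c).mem_nhds ((hOg c).2.2.1 hc))
    refine (h1.congr_of_eventuallyEq ?_).contMDiffWithinAt
    filter_upwards [(hOg c).1.mem_nhds hc] with z hz using (hOg c).2.2.2 z hz
  · intro x hx
    obtain ⟨c, hc⟩ := mem_iUnion.1 hx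
    rw [(hOg c).2.2.2 _ hc.2]
    exact hri c x hc.1 ((hOg c).2.2.1 hc.2)

end LeftInverse

/-! ### Partial diffeomorphisms from left inverses -/

section PartialDiffeo

variable {EM HM M : Type*} [NormedAddCommGroup EM] [NormedSpace ℝ EM] [FiniteDimensional ℝ EM]
  [TopologicalSpace HM] {I : ModelWithCorners ℝ EM HM} [I.Boundaryless]
  [TopologicalSpace M] [ChartedSpace HM M] [IsManifold I ∞ M]
  {EN HN N : Type*} [NormedAddCommGroup EN] [NormedSpace ℝ EN] [FiniteDimensional ℝ EN]
  [TopologicalSpace HN] {J : ModelWithCorners ℝ EN HN} [J.Boundaryless]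
  [TopologicalSpace N] [ChartedSpace HN N] [IsManifold J ∞ N]

/-- A smooth map with bijective differential is locally injective. -/
theorem exists_injOn_of_bijective_mfderiv {f : M → N} {x : M} (hf : ContMDiffAt I J ∞ f x)
    (hb : Function.Bijective (mfderiv I J f x)) : ∃ U ∈ 𝓝 x, InjOn f U := by
  have hn : (∞ : WithTop ℕ∞) ≠ 0 := by simp
  set g := extChartAt J (f x) ∘ f ∘ (extChartAt I x).symm
  have hg : ContDiffAt ℝ ∞ g (extChartAt I x x) := by
    have := (contMDiffAt_iff.1 hf).2
    rwa [I.range_eq_univ, contDiffWithinAt_univ] at this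
  have hder : ∀ v, mfderiv I J f x v = fderiv ℝ g (extChartAt I x x) v := by
    intro v
    have h1 := (hf.mdifferentiableAt hn).mfderiv
    rw [h1, I.range_eq_univ, fderivWithin_univ]
    rfl
  have hb' : Function.Bijective (fderiv ℝ g (extChartAt I x x)) := by
    constructor
    · intro v w hvw
      exact hb.1 ((hder v).trans (hvw.trans (hder w).symm))
    · intro w
      obtain ⟨v, hv⟩ := hb.2 w
      exact ⟨v, (hder v).symm.trans hv⟩
  let L : EM ≃L[ℝ] EN := (LinearEquiv.ofBijective (fderiv ℝ g (extChartAt I x x) : EM →ₗ[ℝ] EN)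
    hb').toContinuousLinearEquiv
  have hs : HasStrictFDerivAt g (L : EM →L[ℝ] EN) (extChartAt I x x) := hg.hasStrictFDerivAt hn
  have hev := (continuousAt_extChartAt (I := I) x).eventually hs.eventually_left_inverse
  refine ⟨_, hev.and ((isOpen_extChartAt_source (I := I) x).mem_nhds (mem_extChartAt_source x)), ?_⟩
  rintro y ⟨hy, hys⟩ z ⟨hz, hzs⟩ hyz
  have hgy : ∀ y ∈ (extChartAt I x).source, g (extChartAt I x y) = extChartAt J (f x) (f y) := by
    intro y hy
    simp only [g, Function.comp_apply, (extChartAt I x).left_inv hy]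
  apply (extChartAt I x).injOn hys hzs
  rw [← hy, ← hz, hgy y hys, hgy z hzs, hyz]

/-- A smooth map between manifolds of the same dimension that has a smooth left inverse is a
diffeomorphism onto an open set. -/
theorem exists_partialDiffeomorph (hdim : Module.finrank ℝ EM = Module.finrank ℝ EN)
    {f : M → N} {ρ : N → M} {W : Set M} {W' : Set N} (hW : IsOpen W) (hW' : IsOpen W')
    (hf : ContMDiffOn I J ∞ f W) (hρ : ContMDiffOn J I ∞ ρ W') (hfW : MapsTo f W W')
    (hinv : ∀ x ∈ W, ρ (f x) = x) :
    ∃ Φ : PartialDiffeomorph I J M N ∞, Φ.source = W ∧ (∀ x, Φ x = f x) := by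
  have hn : (∞ : WithTop ℕ∞) ≠ 0 := by simp
  have hfAt : ∀ x ∈ W, ContMDiffAt I J ∞ f x := fun x hx => hf.contMDiffAt (hW.mem_nhds hx)
  have hρAt : ∀ x ∈ W, ContMDiffAt J I ∞ ρ (f x) := fun x hx =>
    hρ.contMDiffAt (hW'.mem_nhds (hfW hx))
  -- The differential of `ρ` at `f x` is surjective, hence bijective by dimension, so `ρ` is
  -- injective near `f x`. As `ρ (f (ρ y)) = ρ y`, this forces `f (ρ y) = y` for `y` near `f x`: the
  -- image of `f` is open and `ρ` is a two-sided inverse.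
  have key : ∀ x ∈ W, ∀ᶠ y in 𝓝 (f x), y ∈ W' ∧ ρ y ∈ W ∧ f (ρ y) = y := by
    intro x hx
    have hcomp : ∀ v, mfderiv J I ρ (f x) (mfderiv I J f x v) = v := by
      intro v
      have h1 := mfderiv_comp_apply x ((hρAt x hx).mdifferentiableAt hn)
        ((hfAt x hx).mdifferentiableAt hn) v
      have h2 : ρ ∘ f =ᶠ[𝓝 x] id := by
        filter_upwards [hW.mem_nhds hx] with z hz using hinv z hz
      rw [← h1, h2.mfderiv_eq, mfderiv_id]
      rfl
    let D : EN →ₗ[ℝ] EM := (mfderiv J I ρ (f x)).toLinearMap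
    have hsurj : Function.Surjective D := fun v => ⟨_, hcomp v⟩
    have hbij : Function.Bijective (mfderiv J I ρ (f x)) :=
      ⟨(LinearMap.injective_iff_surjective_of_finrank_eq_finrank (f := D) hdim.symm).2 hsurj, hsurj⟩
    obtain ⟨U, hU, hUinj⟩ := exists_injOn_of_bijective_mfderiv (hρAt x hx) hbij
    have hρc : ContinuousAt ρ (f x) := (hρAt x hx).continuousAt
    have hρx : ρ (f x) = x := hinv x hx
    have hW1 : ∀ᶠ y in 𝓝 (f x), ρ y ∈ W := hρc.eventually_mem (by rw [hρx]; exact hW.mem_nhds hx)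
    have hc2 : ContinuousAt (f ∘ ρ) (f x) := by
      refine ContinuousAt.comp ?_ hρc
      rw [hρx]
      exact (hfAt x hx).continuousAt
    have hW2 : ∀ᶠ y in 𝓝 (f x), f (ρ y) ∈ U :=
      hc2.eventually_mem (by rw [Function.comp_apply, hρx]; exact hU)
    filter_upwards [hW1, hW2, hU, hW'.mem_nhds (hfW hx)] with y h1 h2 h3 h4
    exact ⟨h4, h1, hUinj h2 h3 (hinv _ h1)⟩
  let e : PartialEquiv M N :=
    { toFun := f
      invFun := ρ
      source := W
      target := f '' W
      map_source' := fun x hx => mem_image_of_mem f hx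
      map_target' := by
        rintro _ ⟨x, hx, rfl⟩
        rwa [hinv x hx]
      left_inv' := hinv
      right_inv' := by
        rintro _ ⟨x, hx, rfl⟩
        rw [hinv x hx] }
  refine ⟨⟨e, hW, ?_, hf, ?_⟩, rfl, fun _ => rfl⟩
  · rw [isOpen_iff_mem_nhds]
    rintro _ ⟨x, hx, rfl⟩
    filter_upwards [key x hx] with y hy using ⟨ρ y, hy.2.1, hy.2.2⟩
  · rintro _ ⟨x, hx, rfl⟩
    exact (hρAt x hx).contMDiffWithinAt

/-- The restriction of a partial diffeomorphism to an open subset of its source. -/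
theorem exists_restr (Φ : PartialDiffeomorph I J M N ∞) {U : Set M} (hU : IsOpen U)
    (hUs : U ⊆ Φ.source) :
    ∃ Ψ : PartialDiffeomorph I J M N ∞, Ψ.source = U ∧ Ψ.target = Φ '' U ∧ ∀ x, Ψ x = Φ x := by
  let e : PartialEquiv M N :=
    { toFun := Φ.toFun
      invFun := Φ.invFun
      source := U
      target := Φ.toFun '' U
      map_source' := fun x hx => mem_image_of_mem _ hx
      map_target' := by
        rintro _ ⟨x, hx, rfl⟩
        rwa [Φ.left_inv' (hUs hx)]
      left_inv' := fun x hx => Φ.left_inv' (hUs hx)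
      right_inv' := by
        rintro _ ⟨x, hx, rfl⟩
        rw [Φ.left_inv' (hUs hx)] }
  have htgt : Φ.toFun '' U ⊆ Φ.target := by
    rintro _ ⟨x, hx, rfl⟩
    exact Φ.map_source' (hUs hx)
  refine ⟨⟨e, hU, ?_, Φ.contMDiffOn_toFun.mono hUs, Φ.contMDiffOn_invFun.mono htgt⟩, rfl, rfl,
    fun _ => rfl⟩
  exact Φ.toOpenPartialHomeomorph.isOpen_image_of_subset_source hU hUs

end PartialDiffeo

/-! ### Embeddings of manifolds into Hilbert spaces -/

section Whitney

universe uM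

variable {E : Type*} [NormedAddCommGroup E] [NormedSpace ℝ E] [FiniteDimensional ℝ E]
  (M : Type uM) [TopologicalSpace M] [ChartedSpace E M] [IsManifold 𝓘(ℝ, E) ∞ M]

/-- Every second countable Hausdorff manifold embeds into a Hilbert space. -/
theorem exists_embedding_hilbert [T2Space M] [SecondCountableTopology M] :
    ∃ (H : Type uM) (_ : NormedAddCommGroup H) (_ : InnerProductSpace ℝ H) (_ : CompleteSpace H)
      (e : M → H), ContMDiff 𝓘(ℝ, E) 𝓘(ℝ, H) ∞ e ∧ Topology.IsEmbedding e ∧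
        ∀ x, Function.Injective (mfderiv 𝓘(ℝ, E) 𝓘(ℝ, H) e x) := by
  classical
  have : LocallyCompactSpace M := Manifold.locallyCompact_of_finiteDimensional 𝓘(ℝ, E)
  obtain ⟨ι, fs, -⟩ := SmoothBumpCovering.exists_isSubordinate 𝓘(ℝ, E) (s := (univ : Set M))
    (U := fun _ => univ) isClosed_univ (fun _ _ => univ_mem)
  -- `E × ℝ` carries no inner product. Its Euclidean copy makes the `ℓ²` sum over the possibly
  -- infinite index set a Hilbert space.
  let F := EuclideanSpace ℝ (Fin (Module.finrank ℝ (E × ℝ)))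
  let T : (E × ℝ) ≃L[ℝ] F := toEuclidean
  let φ : ι → M → E := fun k => extChartAt 𝓘(ℝ, E) (fs.c k)
  let g : ι → M → F := fun k x => T (fs k x • φ k x, fs k x)
  have hg : ∀ k, ContMDiff 𝓘(ℝ, E) 𝓘(ℝ, F) ∞ (g k) := fun k =>
    T.contDiff.contMDiff.comp
      (((fs k).contMDiff_smul contMDiffOn_extChartAt).prodMk_space (fs k).contMDiff)
  have hg0 : ∀ k x, fs k x = 0 → g k x = 0 := by
    intro k x h
    simp only [g, h, zero_smul]
    exact map_zero T
  let single : ∀ k : ι, F →L[ℝ] lp (fun _ : ι => F) 2 := fun k =>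
    (lp.lsingle (𝕜 := ℝ) (E := fun _ : ι => F) 2 k).mkContinuous 1
      (fun v => by
        rw [one_mul]
        exact (lp.norm_single (E := fun _ : ι => F) (p := 2) (by simp) k v).le)
  have hfin : LocallyFinite fun k => Function.support fun x => single k (g k x) := by
    refine fs.locallyFinite.subset fun k x hx => ?_
    rw [Function.mem_support] at hx ⊢
    intro h
    exact hx (by rw [hg0 k x h, map_zero])
  let e : M → lp (fun _ : ι => F) 2 := fun x => ∑ᶠ k, single k (g k x)
  have he : ContMDiff 𝓘(ℝ, E) 𝓘(ℝ, lp (fun _ : ι => F) 2) ∞ e :=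
    contMDiff_finsum (fun k => (single k).contDiff.contMDiff.comp (hg k)) hfin
  let coord : ∀ k : ι, lp (fun _ : ι => F) 2 →L[ℝ] F := fun k =>
    LinearMap.mkContinuous
      { toFun := fun v => v k
        map_add' := fun _ _ => rfl
        map_smul' := fun _ _ => rfl } 1
      (fun v => by
        rw [one_mul]
        exact lp.norm_apply_le_norm (by simp) v k)
  have hcoord : ∀ k x, coord k (e x) = g k x := by
    intro k x
    have h1 : coord k (e x) = ∑ᶠ l, coord k (single l (g l x)) :=
      (coord k).toLinearMap.toAddMonoidHom.map_finsum (hfin.point_finite x)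
    rw [h1, finsum_eq_single _ k]
    · exact lp.single_apply_self (E := fun _ : ι => F) 2 k _
    · intro l hl
      exact lp.single_apply_ne (E := fun _ : ι => F) 2 l _ hl.symm
  have hcoord' : ∀ k x, T.symm (coord k (e x)) = (fs k x • φ k x, fs k x) := by
    intro k x
    rw [hcoord]
    exact T.symm_apply_apply _
  let k₀ : M → ι := fun x => fs.ind x (mem_univ x)
  have hk₀ : ∀ x, fs (k₀ x) x = 1 := fun x => fs.apply_ind x (mem_univ x)
  have hsrc : ∀ k x, fs k x ≠ 0 → x ∈ (extChartAt 𝓘(ℝ, E) (fs.c k)).source := by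
    intro k x h
    rw [extChartAt_source]
    exact (fs k).support_subset_source h
  have hind : Topology.IsInducing e := by
    rw [Topology.isInducing_iff_nhds]
    intro x
    refine le_antisymm (tendsto_iff_comap.1 he.continuous.continuousAt) ?_
    set k := k₀ x
    -- Where the bump function is nonzero, dividing by it recovers the chart, so the point depends
    -- continuously on its image.
    let ψ : lp (fun _ : ι => F) 2 → E := fun v => (T.symm (coord k v)).2⁻¹ • (T.symm (coord k v)).1
    have hpos : ∀ᶠ v in 𝓝 (e x), (T.symm (coord k v)).2 ≠ 0 := by
      have hc : Continuous fun v : lp (fun _ : ι => F) 2 => (T.symm (coord k v)).2 := by fun_prop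
      refine hc.continuousAt.eventually_ne ?_
      rw [hcoord']
      simp [k, hk₀]
    have hψ : ContinuousAt ψ (e x) := by
      have h2 := hpos.self_of_nhds
      have hc1 : Continuous fun v : lp (fun _ : ι => F) 2 => (T.symm (coord k v)).1 := by fun_prop
      have hc2 : Continuous fun v : lp (fun _ : ι => F) 2 => (T.symm (coord k v)).2 := by fun_prop
      exact (hc2.continuousAt.inv₀ h2).smul hc1.continuousAt
    have hψe : ∀ y, fs k y ≠ 0 → ψ (e y) = φ k y := by
      intro y hy
      simp only [ψ, hcoord']
      rw [smul_smul, inv_mul_cancel₀ hy, one_smul]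
    have hx1 : fs k x ≠ 0 := by rw [hk₀]; exact one_ne_zero
    have hxs := hsrc k x hx1
    have hsymm : ContinuousAt (fun v => (extChartAt 𝓘(ℝ, E) (fs.c k)).symm (ψ v)) (e x) := by
      refine ContinuousAt.comp ?_ hψ
      rw [hψe x hx1]
      exact continuousAt_extChartAt_symm' hxs
    have hx2 : (extChartAt 𝓘(ℝ, E) (fs.c k)).symm (ψ (e x)) = x := by
      rw [hψe x hx1]
      exact (extChartAt 𝓘(ℝ, E) (fs.c k)).left_inv hxs
    intro s hs
    have hev := hsymm.eventually_mem (by rw [hx2]; exact hs)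
    filter_upwards [preimage_mem_comap (hev.and hpos)] with y hy
    have hy0 : fs k y ≠ 0 := by
      have := hy.2
      rwa [hcoord'] at this
    have := hy.1
    rw [hψe y hy0] at this
    have h3 : (extChartAt 𝓘(ℝ, E) (fs.c k)).symm (φ k y) = y :=
      (extChartAt 𝓘(ℝ, E) (fs.c k)).left_inv (hsrc k y hy0)
    rwa [h3] at this
  refine ⟨lp (fun _ : ι => F) 2, inferInstance, inferInstance, inferInstance, e, he,
    ⟨hind, hind.injective⟩, fun x => ?_⟩
  set k := k₀ x
  -- Near `x` the bump function with index `k` equals one, so this bounded linear map turns `e` into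
  -- a chart, whose differential is injective.
  let L : lp (fun _ : ι => F) 2 →L[ℝ] E := .fst ℝ E ℝ ∘L (T.symm : F →L[ℝ] E × ℝ) ∘L coord k
  have hL : L ∘ e =ᶠ[𝓝 x] φ k := by
    filter_upwards [fs.eventuallyEq_one x (mem_univ x)] with y hy
    have hy' : fs k y = 1 := hy
    change (T.symm (coord k (e y))).1 = φ k y
    rw [hcoord', hy', one_smul]
  have hxs : x ∈ (extChartAt 𝓘(ℝ, E) (fs.c k)).source :=
    hsrc k x (by rw [hk₀]; exact one_ne_zero)
  rw [injective_iff_map_eq_zero]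
  intro v hv
  have h1 := mfderiv_comp_apply x (L.contMDiff.contMDiffAt.mdifferentiableAt (n := ∞) (by simp))
    ((he x).mdifferentiableAt (by simp)) v
  rw [hL.mfderiv_eq, hv, map_zero] at h1
  exact (injective_iff_map_eq_zero _).1 (isInvertible_mfderiv_extChartAt hxs).injective v h1

end Whitney

/-! ### The image bundle of a smooth family of projections -/

section ImageBundle

open Bundle

variable {EC C : Type*} [NormedAddCommGroup EC] [NormedSpace ℝ EC]
  [TopologicalSpace C] [ChartedSpace EC C]
  {H : Type*} [NormedAddCommGroup H] [NormedSpace ℝ H]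

/-- A smooth family of projections of rank `k`, parametrized by the manifold `C`. -/
structure IsProjFamily (k : ℕ) (q : C → H →L[ℝ] H) : Prop where
  contMDiff : ContMDiff 𝓘(ℝ, EC) 𝓘(ℝ, H →L[ℝ] H) ∞ q
  idem : ∀ c h, q c (q c h) = q c h
  finite : ∀ c, FiniteDimensional ℝ (q c).range
  finrank : ∀ c, Module.finrank ℝ (q c).range = k

namespace IsProjFamily

variable {k : ℕ} {q : C → H →L[ℝ] H} (hq : IsProjFamily (EC := EC) k q)

theorem exists_frame (hq : IsProjFamily (EC := EC) k q) (a : C) :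
    ∃ (s : EuclideanSpace ℝ (Fin k) →L[ℝ] H) (l : H →L[ℝ] EuclideanSpace ℝ (Fin k)),
      ∀ w, l (q a (s w)) = w := by
  have := hq.finite a
  let b : EuclideanSpace ℝ (Fin k) ≃L[ℝ] (q a).range :=
    ContinuousLinearEquiv.ofFinrankEq (by rw [hq.finrank a, finrank_euclideanSpace_fin])
  refine ⟨(q a).range.subtypeL ∘L b,
    b.symm ∘L (q a).codRestrict (q a).range (fun h => ⟨h, rfl⟩), fun w => ?_⟩
  change b.symm ⟨q a (q a (b w : H)), _⟩ = w
  rw [ContinuousLinearEquiv.symm_apply_eq]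
  apply Subtype.ext
  change q a (q a (b w : H)) = b w
  obtain ⟨h, hh⟩ := (b w).2
  have hh' : q a h = b w := hh
  rw [← hh', hq.idem, hq.idem]

/-- A frame of the image at `a`. -/
def frame (a : C) : EuclideanSpace ℝ (Fin k) →L[ℝ] H := (hq.exists_frame a).choose

/-- Coordinates with respect to the frame at `a`. -/
def coframe (a : C) : H →L[ℝ] EuclideanSpace ℝ (Fin k) := (hq.exists_frame a).choose_spec.choose

theorem coframe_frame (a : C) (w : EuclideanSpace ℝ (Fin k)) :
    hq.coframe a (q a (hq.frame a w)) = w := (hq.exists_frame a).choose_spec.choose_spec w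

/-- The frame at `a`, transported to the image at `c`. -/
def emb (a c : C) : EuclideanSpace ℝ (Fin k) →L[ℝ] H := q c ∘L hq.frame a

/-- The matrix of the transported frame in the coordinates at `a`. -/
def gram (a c : C) : EuclideanSpace ℝ (Fin k) →L[ℝ] EuclideanSpace ℝ (Fin k) :=
  hq.coframe a ∘L hq.emb a c

/-- The coordinates at `c` with respect to the transported frame. -/
def coord (a c : C) : H →L[ℝ] EuclideanSpace ℝ (Fin k) :=
  Ring.inverse (hq.gram a c) ∘L hq.coframe a

/-- The set on which the transported frame is a frame. -/
def base (a : C) : Set C := {c | IsUnit (hq.gram a c)}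

theorem contMDiff_emb (a : C) :
    ContMDiff 𝓘(ℝ, EC) 𝓘(ℝ, EuclideanSpace ℝ (Fin k) →L[ℝ] H) ∞ (hq.emb a) :=
  hq.contMDiff.clm_comp contMDiff_const

theorem contMDiff_gram (a : C) : ContMDiff 𝓘(ℝ, EC)
    𝓘(ℝ, EuclideanSpace ℝ (Fin k) →L[ℝ] EuclideanSpace ℝ (Fin k)) ∞ (hq.gram a) :=
  contMDiff_const.clm_comp (hq.contMDiff_emb a)

theorem isOpen_base (a : C) : IsOpen (hq.base a) :=
  Units.isOpen.preimage (hq.contMDiff_gram a).continuous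

theorem mem_base (a : C) : a ∈ hq.base a := by
  have : hq.gram a a = 1 := by
    ext1 w
    exact hq.coframe_frame a w
  change IsUnit (hq.gram a a)
  rw [this]
  exact isUnit_one

theorem contMDiffOn_coord (a : C) : ContMDiffOn 𝓘(ℝ, EC)
    𝓘(ℝ, H →L[ℝ] EuclideanSpace ℝ (Fin k)) ∞ (hq.coord a) (hq.base a) := by
  have h1 : ContMDiffOn 𝓘(ℝ, EC)
      𝓘(ℝ, EuclideanSpace ℝ (Fin k) →L[ℝ] EuclideanSpace ℝ (Fin k)) ∞
      (fun c => Ring.inverse (hq.gram a c)) (hq.base a) := by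
    intro c hc
    obtain ⟨u, hu⟩ := hc
    have h2 : ContDiffAt ℝ ∞
        (Ring.inverse : (EuclideanSpace ℝ (Fin k) →L[ℝ] EuclideanSpace ℝ (Fin k)) → _)
        (hq.gram a c) := by
      rw [← hu]
      exact contDiffAt_ringInverse ℝ u
    exact (h2.contMDiffAt.comp c (hq.contMDiff_gram a c)).contMDiffWithinAt
  exact h1.clm_comp contMDiffOn_const

theorem coord_emb {a c : C} (hc : c ∈ hq.base a) (w : EuclideanSpace ℝ (Fin k)) :
    hq.coord a c (hq.emb a c w) = w := by
  have h1 : Ring.inverse (hq.gram a c) * hq.gram a c = 1 := Ring.inverse_mul_cancel _ hc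
  exact congrArg (fun T : EuclideanSpace ℝ (Fin k) →L[ℝ] EuclideanSpace ℝ (Fin k) => T w) h1

/-- The transported frame is injective by `coord_emb` and takes values in the image of `q c`, which
also has dimension `k`. So it is a basis of this image, and the left inverse `coord` is a right
inverse there. -/
theorem emb_coord {a c : C} (hc : c ∈ hq.base a) (h : H) :
    hq.emb a c (hq.coord a c (q c h)) = q c h := by
  have := hq.finite c
  let L : EuclideanSpace ℝ (Fin k) →ₗ[ℝ] (q c).range :=
    (hq.emb a c).toLinearMap.codRestrict (q c).range (fun w => ⟨hq.frame a w, rfl⟩)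
  have hL : Function.Injective L := by
    intro v w hvw
    have h1 : hq.emb a c v = hq.emb a c w := congrArg Subtype.val hvw
    rw [← hq.coord_emb hc v, h1, hq.coord_emb hc]
  have hs : Function.Surjective L :=
    (LinearMap.injective_iff_surjective_of_finrank_eq_finrank
      (by rw [hq.finrank c, finrank_euclideanSpace_fin])).1 hL
  obtain ⟨w, hw⟩ := hs ⟨q c h, ⟨h, rfl⟩⟩
  have hw' : hq.emb a c w = q c h := congrArg Subtype.val hw
  rw [← hw', hq.coord_emb hc]

theorem apply_emb (a c : C) (w : EuclideanSpace ℝ (Fin k)) :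
    q c (hq.emb a c w) = hq.emb a c w := hq.idem c _

/-- The image bundle. -/
def core : VectorBundleCore ℝ C (EuclideanSpace ℝ (Fin k)) C where
  baseSet := hq.base
  isOpen_baseSet := hq.isOpen_base
  indexAt := id
  mem_baseSet_at := hq.mem_base
  coordChange := fun a b c => hq.coord b c ∘L hq.emb a c
  coordChange_self := fun a c hc v => hq.coord_emb hc v
  continuousOn_coordChange := fun a b =>
    ((hq.contMDiffOn_coord b).continuousOn.mono inter_subset_right).clm_comp
      (hq.contMDiff_emb a).continuous.continuousOn
  coordChange_comp := by
    rintro a b d c ⟨⟨-, hb⟩, -⟩ v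
    change hq.coord d c (hq.emb b c (hq.coord b c (hq.emb a c v))) = hq.coord d c (hq.emb a c v)
    -- The vector `emb a c v` lies in the image of `q c`, on which passing to the coordinates of the
    -- frame at `b` and back is the identity.
    rw [← hq.apply_emb a c v, hq.emb_coord hb]

instance isContMDiff_core : hq.core.IsContMDiff 𝓘(ℝ, EC) ∞ where
  contMDiffOn_coordChange := fun a b =>
    ((hq.contMDiffOn_coord b).mono inter_subset_right).clm_comp
      (hq.contMDiff_emb a).contMDiffOn

/-- The total space of the image bundle. -/
abbrev Total : Type _ := TotalSpace (EuclideanSpace ℝ (Fin k)) hq.core.Fiber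

/-- The fiberwise linear map of the total space of the image bundle to the ambient space. -/
def toAmbient (z : hq.Total) : H := hq.emb z.1 z.1 z.2

/-- The point of the image bundle over `c` that corresponds to `q c h`. -/
def mkTotal (c : C) (h : H) : hq.Total := ⟨c, hq.coord c c (q c h)⟩

theorem toAmbient_mkTotal (c : C) (h : H) : hq.toAmbient (hq.mkTotal c h) = q c h :=
  hq.emb_coord (hq.mem_base c) h

theorem mkTotal_zero (c : C) : hq.mkTotal c 0 = ⟨c, 0⟩ := by
  simp [mkTotal]
  rfl

/-- The definition of `toAmbient` uses a different frame over each base point. In a fixed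
trivialization it becomes the smooth matrix `emb a` applied to the fiber coordinate, which yields
its smoothness. -/
theorem toAmbient_eq {a : C} (z : hq.Total) (hz : z.1 ∈ hq.base a) :
    hq.toAmbient z = hq.emb a z.1 (hq.core.localTriv a z).2 := by
  change hq.emb z.1 z.1 z.2 = hq.emb a z.1 (hq.coord a z.1 (hq.emb z.1 z.1 z.2))
  rw [← hq.apply_emb z.1 z.1 z.2, hq.emb_coord hz]

theorem contMDiff_toAmbient :
    ContMDiff (𝓘(ℝ, EC).prod 𝓘(ℝ, EuclideanSpace ℝ (Fin k))) 𝓘(ℝ, H) ∞ hq.toAmbient := by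
  intro z
  have hz : z ∈ (hq.core.localTriv z.1).source :=
    (hq.core.mem_localTriv_source z.1 z).2 (hq.mem_base z.1)
  have : MemTrivializationAtlas (hq.core.localTriv z.1) := ⟨⟨z.1, rfl⟩⟩
  have h1 := ((hq.core.localTriv z.1).contMDiffOn (IB := 𝓘(ℝ, EC)) (n := ∞)).contMDiffAt
    ((hq.core.localTriv z.1).open_source.mem_nhds hz)
  have h2 : ContMDiffAt (𝓘(ℝ, EC).prod 𝓘(ℝ, EuclideanSpace ℝ (Fin k)))
      𝓘(ℝ, EuclideanSpace ℝ (Fin k)) ∞ (fun y => (hq.core.localTriv z.1 y).2) z :=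
    contMDiffAt_snd.comp z h1
  have h3 : ContMDiffAt (𝓘(ℝ, EC).prod 𝓘(ℝ, EuclideanSpace ℝ (Fin k)))
      𝓘(ℝ, EuclideanSpace ℝ (Fin k) →L[ℝ] H) ∞
      (fun y : hq.Total => hq.emb z.1 y.1) z :=
    (hq.contMDiff_emb z.1 z.1).comp z (contMDiffAt_proj hq.core.Fiber)
  refine (h3.clm_apply h2).congr_of_eventuallyEq ?_
  filter_upwards [(hq.core.localTriv z.1).open_source.mem_nhds hz] with y hy
  exact hq.toAmbient_eq y ((hq.core.mem_localTriv_source z.1 y).1 hy)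

theorem contMDiffOn_mkTotal {EM HM M : Type*} [NormedAddCommGroup EM] [NormedSpace ℝ EM]
    [TopologicalSpace HM] {J : ModelWithCorners ℝ EM HM} [TopologicalSpace M] [ChartedSpace HM M]
    {W : Set M} {p : M → C} {h : M → H} (hp : ContMDiffOn J 𝓘(ℝ, EC) ∞ p W)
    (hh : ContMDiffOn J 𝓘(ℝ, H) ∞ h W) :
    ContMDiffOn J (𝓘(ℝ, EC).prod 𝓘(ℝ, EuclideanSpace ℝ (Fin k))) ∞
      (fun x => hq.mkTotal (p x) (h x)) W := by
  intro x hx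
  rw [contMDiffWithinAt_totalSpace]
  refine ⟨hp x hx, ?_⟩
  have hb : hq.base (p x) ∈ 𝓝 (p x) := (hq.isOpen_base (p x)).mem_nhds (hq.mem_base (p x))
  have h1 : ContMDiffWithinAt J 𝓘(ℝ, H →L[ℝ] EuclideanSpace ℝ (Fin k)) ∞
      (fun y => hq.coord (p x) (p y)) W x :=
    ((hq.contMDiffOn_coord (p x)).contMDiffAt hb).comp_contMDiffWithinAt x (hp x hx)
  have h2 : ContMDiffWithinAt J 𝓘(ℝ, H) ∞ (fun y => q (p y) (h y)) W x :=
    ((hq.contMDiff (p x)).comp_contMDiffWithinAt x (hp x hx)).clm_apply (hh x hx)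
  -- The frame over the moving point `p y` drops out of the fiber coordinate in the trivialization
  -- at `p x`.
  have key : ∀ y, p y ∈ hq.base (p x) →
      (trivializationAt (EuclideanSpace ℝ (Fin k)) hq.core.Fiber (hq.mkTotal (p x) (h x)).proj
        (hq.mkTotal (p y) (h y))).2 = hq.coord (p x) (p y) (q (p y) (h y)) := by
    intro y hy
    change hq.coord (p x) (p y) (hq.emb (p y) (p y) (hq.coord (p y) (p y) (q (p y) (h y)))) = _
    rw [hq.emb_coord (hq.mem_base (p y))]
  refine (h1.clm_apply h2).congr_of_eventuallyEq ?_ (key x (hq.mem_base _))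
  filter_upwards [(hp x hx).continuousWithinAt.eventually_mem hb] with y hy using key y hy

end IsProjFamily

/-- Scalar multiplication is continuous on the total space of a vector bundle. -/
theorem continuous_smul_totalSpace {B F : Type*} [TopologicalSpace B] [NormedAddCommGroup F]
    [NormedSpace ℝ F] {N : B → Type*} [∀ c, AddCommGroup (N c)] [∀ c, Module ℝ (N c)]
    [TopologicalSpace (TotalSpace F N)] [∀ c, TopologicalSpace (N c)] [FiberBundle F N]
    [VectorBundle ℝ F N] :
    Continuous fun z : ℝ × TotalSpace F N => (⟨z.2.1, z.1 • z.2.2⟩ : TotalSpace F N) := by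
  rw [continuous_iff_continuousAt]
  rintro ⟨s, z⟩
  rw [FiberBundle.continuousAt_totalSpace]
  have hpc : Continuous fun y : ℝ × TotalSpace F N => y.2.proj :=
    (FiberBundle.continuous_proj F N).comp continuous_snd
  refine ⟨hpc.continuousAt, ?_⟩
  set t := trivializationAt F N z.proj
  have hz : z ∈ t.source := FiberBundle.mem_trivializationAt_proj_source
  have h1 : ContinuousAt (fun y : ℝ × TotalSpace F N => y.1 • (t y.2).2) (s, z) := by
    have : ContinuousAt (fun y : ℝ × TotalSpace F N => (t y.2).2) (s, z) :=
      (ContinuousAt.comp (f := fun y : ℝ × TotalSpace F N => y.2)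
        (t.continuousOn_toFun.continuousAt (t.open_source.mem_nhds hz)) continuousAt_snd).snd
    exact continuousAt_fst.smul this
  refine h1.congr_of_eventuallyEq ?_
  filter_upwards [hpc.continuousAt.eventually_mem (t.open_baseSet.mem_nhds
    (FiberBundle.mem_baseSet_trivializationAt' z.proj))] with y hy
  exact (t.linear ℝ hy).map_smul y.1 y.2.2

/-- Every open neighborhood of the zero section contains a fiberwise star-shaped one. -/
theorem exists_starShaped {B F : Type*} [TopologicalSpace B] [NormedAddCommGroup F]
    [NormedSpace ℝ F] {N : B → Type*} [∀ c, AddCommGroup (N c)] [∀ c, Module ℝ (N c)]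
    [TopologicalSpace (TotalSpace F N)] [∀ c, TopologicalSpace (N c)] [FiberBundle F N]
    [VectorBundle ℝ F N] {O : Set (TotalSpace F N)} (hO : IsOpen O)
    (h0 : ∀ c, (⟨c, 0⟩ : TotalSpace F N) ∈ O) :
    ∃ V ⊆ O, IsOpen V ∧ (∀ c, (⟨c, 0⟩ : TotalSpace F N) ∈ V) ∧
      ∀ (c : B) (v : N c), (⟨c, v⟩ : TotalSpace F N) ∈ V →
        ∀ s ∈ Icc (0 : ℝ) 1, (⟨c, s • v⟩ : TotalSpace F N) ∈ V := by
  -- The set of points whose whole segment to the zero section stays in `O`; it is open because the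
  -- segment is compact.
  refine ⟨{z | ∀ s ∈ Icc (0 : ℝ) 1, (⟨z.1, s • z.2⟩ : TotalSpace F N) ∈ O}, ?_, ?_, ?_, ?_⟩
  · intro z hz
    have := hz 1 (by simp)
    rwa [one_smul] at this
  · rw [isOpen_iff_eventually]
    intro z hz
    refine isCompact_Icc.eventually_forall_of_forall_eventually fun s hs => ?_
    have hc : Continuous fun y : TotalSpace F N × ℝ => (⟨y.1.1, y.2 • y.1.2⟩ : TotalSpace F N) :=
      continuous_smul_totalSpace.comp continuous_swap
    exact hc.continuousAt.eventually_mem (hO.mem_nhds (hz s hs))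
  · intro c s _
    rw [smul_zero]
    exact h0 c
  · intro c v hv s hs t ht
    rw [smul_smul]
    exact hv (t * s) ⟨mul_nonneg ht.1 hs.1, mul_le_one₀ ht.2 hs.1 hs.2⟩

end ImageBundle

/-! ### Differentials of maps to normed spaces -/

section Differentials

variable {ES HS S : Type*} [NormedAddCommGroup ES] [NormedSpace ℝ ES]
  [TopologicalSpace HS] {I : ModelWithCorners ℝ ES HS} [TopologicalSpace S] [ChartedSpace HS S]
  [IsManifold I ∞ S]
  {F G : Type*} [NormedAddCommGroup F] [NormedSpace ℝ F] [NormedAddCommGroup G] [NormedSpace ℝ G]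

theorem mfderiv_clm_comp (L : F →L[ℝ] G) {f : S → F} {x : S}
    (hf : MDifferentiableAt I 𝓘(ℝ, F) f x) (v : TangentSpace I x) :
    mfderiv I 𝓘(ℝ, G) (fun y => L (f y)) x v = L (mfderiv I 𝓘(ℝ, F) f x v) := by
  have h1 : HasMFDerivAt 𝓘(ℝ, F) 𝓘(ℝ, G) L (f x) L := L.hasFDerivAt.hasMFDerivAt
  have h2 := (h1.comp x hf.hasMFDerivAt).mfderiv
  exact congrArg (fun T : ES →L[ℝ] G => T v) h2

theorem mfderiv_comp_space {x : S} {f : S → F} {g : F → G}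
    (hg : DifferentiableAt ℝ g (f x)) (hf : MDifferentiableAt I 𝓘(ℝ, F) f x)
    (v : TangentSpace I x) :
    mfderiv I 𝓘(ℝ, G) (fun y => g (f y)) x v = fderiv ℝ g (f x) (mfderiv I 𝓘(ℝ, F) f x v) := by
  have h1 : HasMFDerivAt 𝓘(ℝ, F) 𝓘(ℝ, G) g (f x) (fderiv ℝ g (f x)) :=
    hg.hasFDerivAt.hasMFDerivAt
  have h2 := (h1.comp x hf.hasMFDerivAt).mfderiv
  exact congrArg (fun T : ES →L[ℝ] G => T v) h2

/-- In the product rule the term with the derivative of `A` is applied to `b x = 0`. It serves at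
points where a displacement vanishes, so that the derivative of the coefficient never has to be
known. -/
theorem mfderiv_clm_apply_of_eq_zero [I.Boundaryless] {A : S → F →L[ℝ] G} {b : S → F} {x : S}
    (hA : ContMDiffAt I 𝓘(ℝ, F →L[ℝ] G) ∞ A x) (hb : ContMDiffAt I 𝓘(ℝ, F) ∞ b x) (h0 : b x = 0)
    (v : TangentSpace I x) :
    mfderiv I 𝓘(ℝ, G) (fun y => A y (b y)) x v = A x (mfderiv I 𝓘(ℝ, F) b x v) := by
  have hn : (∞ : WithTop ℕ∞) ≠ 0 := by simp
  have h1 : HasFDerivAt (fun z : (F →L[ℝ] G) × F => z.1 z.2) _ (A x, b x) :=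
    (hasFDerivAt_fst (𝕜 := ℝ) (p := (A x, b x))).clm_apply hasFDerivAt_snd
  have h2 : MDifferentiableAt I 𝓘(ℝ, (F →L[ℝ] G) × F) (fun y => (A y, b y)) x :=
    (hA.prodMk_space hb).mdifferentiableAt hn
  have h3 := mfderiv_comp_space (I := I) (x := x) (f := fun y => (A y, b y))
    h1.differentiableAt h2 v
  refine h3.trans ?_
  rw [h1.fderiv]
  have h4 := mfderiv_clm_comp (I := I) (ContinuousLinearMap.snd ℝ (F →L[ℝ] G) F) h2 v
  change mfderiv I 𝓘(ℝ, F) b x v = _ at h4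
  rw [h4]
  simp only [h0, map_zero, add_zero]
  rfl

end Differentials

/-! ### Left inverses of maps to a product of Hilbert spaces -/

section LeftInverseProd

variable {ES HS S : Type*} [NormedAddCommGroup ES] [NormedSpace ℝ ES]
  [TopologicalSpace HS] {I : ModelWithCorners ℝ ES HS} [TopologicalSpace S] [ChartedSpace HS S]
  [IsManifold I ∞ S] [FiniteDimensional ℝ ES] [I.Boundaryless]
  {H₁ : Type*} [NormedAddCommGroup H₁] [InnerProductSpace ℝ H₁] [CompleteSpace H₁]
  {H₂ : Type*} [NormedAddCommGroup H₂] [InnerProductSpace ℝ H₂] [CompleteSpace H₂]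

/-- A map to a product of two Hilbert spaces that is an immersion along a subset and embeds this
subset has a smooth left inverse near the subset. -/
theorem exists_leftInverse_prod [TopologicalSpace.MetrizableSpace S] [Nonempty S]
    {C : Type*} [TopologicalSpace C] {i : C → S} (hi : Continuous i)
    {a : S → H₁} {b : S → H₂} {W₀ : Set S} (hW₀ : IsOpen W₀) (hiW : ∀ c, i c ∈ W₀)
    (ha : ContMDiffOn I 𝓘(ℝ, H₁) ∞ a W₀) (hb : ContMDiffOn I 𝓘(ℝ, H₂) ∞ b W₀)
    (hinj : ∀ c, ∀ v : TangentSpace I (i c), mfderiv I 𝓘(ℝ, H₁) a (i c) v = 0 →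
      mfderiv I 𝓘(ℝ, H₂) b (i c) v = 0 → v = 0)
    (hei : Topology.IsInducing fun c => (a (i c), b (i c))) :
    ∃ (O : Set (H₁ × H₂)) (W : Set S) (r : H₁ × H₂ → S), IsOpen O ∧ IsOpen W ∧ W ⊆ W₀ ∧
      (∀ c, i c ∈ W) ∧ (∀ x ∈ W, (a x, b x) ∈ O) ∧ ContMDiffOn 𝓘(ℝ, H₁ × H₂) I ∞ r O ∧
      ∀ x ∈ W, r (a x, b x) = x := by
  have hn : (∞ : WithTop ℕ∞) ≠ 0 := by simp
  -- The product carries the sup norm; the `ℓ²` product is the isomorphic Hilbert space.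
  let T : WithLp 2 (H₁ × H₂) ≃L[ℝ] H₁ × H₂ := WithLp.prodContinuousLinearEquiv 2 ℝ H₁ H₂
  have hab : ContMDiffOn I 𝓘(ℝ, H₁ × H₂) ∞ (fun x => (a x, b x)) W₀ := ha.prodMk_space hb
  have he : ContMDiffOn I 𝓘(ℝ, WithLp 2 (H₁ × H₂)) ∞ (fun x => T.symm (a x, b x)) W₀ :=
    T.symm.contDiff.contMDiff.comp_contMDiffOn hab
  obtain ⟨O, W, r, hO, hW, hWW, hiW', hm, hr, hri⟩ := exists_leftInverse hi hW₀ hiW he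
    (fun c => by
      rw [injective_iff_map_eq_zero]
      intro v hv
      have hd := ((he.contMDiffAt (hW₀.mem_nhds (hiW c))).mdifferentiableAt hn)
      refine hinj c v ?_ ?_
      · have := mfderiv_clm_comp (I := I)
          (ContinuousLinearMap.fst ℝ H₁ H₂ ∘L (T : WithLp 2 (H₁ × H₂) →L[ℝ] H₁ × H₂)) hd v
        refine Eq.trans ?_ (this.trans ?_)
        · rfl
        · exact (congrArg _ hv).trans (map_zero _)
      · have := mfderiv_clm_comp (I := I)
          (ContinuousLinearMap.snd ℝ H₁ H₂ ∘L (T : WithLp 2 (H₁ × H₂) →L[ℝ] H₁ × H₂)) hd v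
        refine Eq.trans ?_ (this.trans ?_)
        · rfl
        · exact (congrArg _ hv).trans (map_zero _))
    (T.symm.toHomeomorph.isInducing.comp hei)
  refine ⟨T.symm ⁻¹' O, W, r ∘ T.symm, hO.preimage T.symm.continuous, hW, hWW, hiW', hm,
    hr.comp T.symm.contDiff.contMDiff.contMDiffOn (fun _ h => h), hri⟩

end LeftInverseProd

/-! ### Smooth retractions -/

section Retraction

variable {E M : Type*} [NormedAddCommGroup E] [NormedSpace ℝ E] [FiniteDimensional ℝ E]
  [TopologicalSpace M] [ChartedSpace E M] [IsManifold 𝓘(ℝ, E) ∞ M]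
  {H : Type*} [NormedAddCommGroup H] [InnerProductSpace ℝ H] [CompleteSpace H]

/-- A smooth embedding `e` in a Hilbert space, with a smooth left inverse `r` that is defined on the
open set `O`. -/
structure IsRetraction (e : M → H) (O : Set H) (r : H → M) : Prop where
  contMDiff : ContMDiff 𝓘(ℝ, E) 𝓘(ℝ, H) ∞ e
  isEmbedding : Topology.IsEmbedding e
  isOpen : IsOpen O
  mem : ∀ x, e x ∈ O
  contMDiffOn : ContMDiffOn 𝓘(ℝ, H) 𝓘(ℝ, E) ∞ r O
  left_inv : ∀ x, r (e x) = x

theorem exists_isRetraction [Nonempty M] {e : M → H} (he : ContMDiff 𝓘(ℝ, E) 𝓘(ℝ, H) ∞ e)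
    (hemb : Topology.IsEmbedding e)
    (hinj : ∀ x, Function.Injective (mfderiv 𝓘(ℝ, E) 𝓘(ℝ, H) e x)) :
    ∃ O r, IsRetraction (E := E) e O r := by
  have : TopologicalSpace.MetrizableSpace M := hemb.metrizableSpace
  obtain ⟨O, W, r, hO, hW, -, hiW, hm, hr, hri⟩ := exists_leftInverse (I := 𝓘(ℝ, E)) (i := id)
    continuous_id isOpen_univ (fun _ => mem_univ _) he.contMDiffOn hinj hemb.isInducing
  exact ⟨O, r, he, hemb, hO, fun x => hm (hiW x), hr, fun x => hri x (hiW x)⟩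

namespace IsRetraction

variable {e : M → H} {O : Set H} {r : H → M} (h : IsRetraction (E := E) e O r)

/-- The differential of the left inverse at the point `e x`. -/
def dr (_ : IsRetraction (E := E) e O r) (x : M) : H →L[ℝ] E :=
  mfderiv 𝓘(ℝ, H) 𝓘(ℝ, E) r (e x)

/-- The differential of the embedding. -/
def de (_ : IsRetraction (E := E) e O r) (x : M) : E →L[ℝ] H :=
  mfderiv 𝓘(ℝ, E) 𝓘(ℝ, H) e x

/-- The differential of the projection `e ∘ r` at the point `e x`. -/
def proj (_ : IsRetraction (E := E) e O r) (x : M) : H →L[ℝ] H :=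
  fderiv ℝ (e ∘ r) (e x)

theorem contMDiffAt_r (h : IsRetraction (E := E) e O r) (x : M) :
    ContMDiffAt 𝓘(ℝ, H) 𝓘(ℝ, E) ∞ r (e x) :=
  h.contMDiffOn.contMDiffAt (h.isOpen.mem_nhds (h.mem x))

theorem dr_de (x : M) (v : E) : h.dr x (h.de x v) = v := by
  have hn : (∞ : WithTop ℕ∞) ≠ 0 := by simp
  have h1 := mfderiv_comp (I := 𝓘(ℝ, E)) (I' := 𝓘(ℝ, H)) (I'' := 𝓘(ℝ, E)) x
    ((h.contMDiffAt_r x).mdifferentiableAt hn) ((h.contMDiff x).mdifferentiableAt hn)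
  have h2 : r ∘ e = id := funext h.left_inv
  rw [h2, mfderiv_id] at h1
  exact congrArg (fun T : E →L[ℝ] E => T v) h1.symm

theorem proj_eq (x : M) (y : H) : h.proj x y = h.de x (h.dr x y) := by
  have hn : (∞ : WithTop ℕ∞) ≠ 0 := by simp
  have h0 := h.left_inv x
  have h3 := mfderiv_comp (I := 𝓘(ℝ, H)) (I' := 𝓘(ℝ, E)) (I'' := 𝓘(ℝ, H)) (g := e) (f := r) (e x)
    ((h.contMDiff _).mdifferentiableAt hn) ((h.contMDiffAt_r x).mdifferentiableAt hn)
  have h1 : h.proj x y = mfderiv 𝓘(ℝ, E) 𝓘(ℝ, H) e (r (e x)) (h.dr x y) := by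
    rw [proj, ← mfderiv_eq_fderiv]
    exact congrArg (fun T : H →L[ℝ] H => T y) h3
  have h2 : ∀ z, z = x → ∀ w : E, (mfderiv 𝓘(ℝ, E) 𝓘(ℝ, H) e z : E →L[ℝ] H) w = h.de x w := by
    rintro z rfl w
    rfl
  exact h1.trans (h2 _ h0 _)

theorem proj_de (x : M) (v : E) : h.proj x (h.de x v) = h.de x v := by
  rw [h.proj_eq, h.dr_de]

theorem proj_proj (x : M) (y : H) : h.proj x (h.proj x y) = h.proj x y := by
  rw [h.proj_eq x y, h.proj_de]

theorem de_injective (x : M) : Function.Injective (h.de x) :=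
  Function.LeftInverse.injective (h.dr_de x)

/-- Every tangent space is the model space, identified by the preferred chart at its point, so `de`
and `dr` separately need not vary continuously. In the composite these choices cancel, and as the
derivative of `e ∘ r` on an open set of `H` it is smooth. -/
theorem contMDiff_proj : ContMDiff 𝓘(ℝ, E) 𝓘(ℝ, H →L[ℝ] H) ∞ h.proj := by
  have h1 : ContDiffOn ℝ ∞ (e ∘ r) O :=
    (h.contMDiff.comp_contMDiffOn h.contMDiffOn).contDiffOn
  have h2 : ContDiffOn ℝ ∞ (fderiv ℝ (e ∘ r)) O := h1.fderiv_of_isOpen h.isOpen (by simp)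
  intro x
  exact ((h2.contDiffAt (h.isOpen.mem_nhds (h.mem x))).contMDiffAt).comp x (h.contMDiff x)

end IsRetraction

end Retraction

/-! ### Tubular neighborhoods -/

section Tubular

open Bundle

variable {E M : Type*} [NormedAddCommGroup E] [NormedSpace ℝ E] [FiniteDimensional ℝ E]
  [TopologicalSpace M] [ChartedSpace E M] [IsManifold 𝓘(ℝ, E) ∞ M]
  {EC C : Type*} [NormedAddCommGroup EC] [NormedSpace ℝ EC] [FiniteDimensional ℝ EC]
  [TopologicalSpace C] [ChartedSpace EC C] [IsManifold 𝓘(ℝ, EC) ∞ C]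
  {H : Type*} [NormedAddCommGroup H] [InnerProductSpace ℝ H] [CompleteSpace H]

/-- The projections to a normal bundle of a submanifold. -/
theorem isProjFamily_normal {i : C → M} (hi : ContMDiff 𝓘(ℝ, EC) 𝓘(ℝ, E) ∞ i)
    {e : M → H} {O : Set H} {r : H → M} (h : IsRetraction (E := E) e O r)
    {OC : Set H} {rC : H → C} (hC : IsRetraction (E := EC) (e ∘ i) OC rC) :
    IsProjFamily (EC := EC) (Module.finrank ℝ E - Module.finrank ℝ EC)
      (fun c => (1 - hC.proj c) ∘L h.proj (i c)) ∧
    ∀ c v, hC.proj c (h.de (i c) v) = h.de (i c) v →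
      ∃ w : EC, v = mfderiv 𝓘(ℝ, EC) 𝓘(ℝ, E) i c w := by
  have hn : (∞ : WithTop ℕ∞) ≠ 0 := by simp
  have hde : ∀ c (w : EC), hC.de c w = h.de (i c) (mfderiv 𝓘(ℝ, EC) 𝓘(ℝ, E) i c w) := fun c w =>
    mfderiv_comp_apply c ((h.contMDiff _).mdifferentiableAt hn) ((hi c).mdifferentiableAt hn) w
  have hker : ∀ c v, hC.proj c (h.de (i c) v) = h.de (i c) v →
      ∃ w : EC, v = mfderiv 𝓘(ℝ, EC) 𝓘(ℝ, E) i c w := by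
    intro c v hv
    rw [hC.proj_eq, hde] at hv
    exact ⟨_, (h.de_injective (i c) hv).symm⟩
  -- The tangent space of `C` lies in that of `M`, so the projection to the latter fixes it; this
  -- makes the composite family idempotent.
  have hQQ : ∀ c y, h.proj (i c) (hC.proj c y) = hC.proj c y := by
    intro c y
    rw [hC.proj_eq, hde]
    exact h.proj_de _ _
  have hrange : ∀ c, LinearMap.range ((1 - hC.proj c) ∘L h.proj (i c) : H →L[ℝ] H).toLinearMap =
      LinearMap.range ((1 - hC.proj c) ∘L h.de (i c) : E →L[ℝ] H).toLinearMap := by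
    intro c
    apply le_antisymm
    · rintro _ ⟨y, rfl⟩
      refine ⟨h.dr (i c) y, ?_⟩
      change (1 - hC.proj c) (h.de (i c) (h.dr (i c) y)) = (1 - hC.proj c) (h.proj (i c) y)
      rw [h.proj_eq]
    · rintro _ ⟨v, rfl⟩
      refine ⟨h.de (i c) v, ?_⟩
      change (1 - hC.proj c) (h.proj (i c) (h.de (i c) v)) = (1 - hC.proj c) (h.de (i c) v)
      rw [h.proj_de]
  refine ⟨⟨?_, ?_, ?_, ?_⟩, hker⟩
  · exact (contMDiff_const.sub hC.contMDiff_proj).clm_comp (h.contMDiff_proj.comp hi)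
  · intro c y
    simp only [ContinuousLinearMap.comp_apply, sub_apply,
      one_apply_eq_self, map_sub, hQQ, h.proj_proj, hC.proj_proj]
    abel
  · intro c
    have := hrange c
    change FiniteDimensional ℝ (LinearMap.range ((1 - hC.proj c) ∘L h.proj (i c)).toLinearMap)
    rw [this]
    infer_instance
  · intro c
    rw [hrange c]
    let L := ((1 - hC.proj c) ∘L h.de (i c) : E →L[ℝ] H).toLinearMap
    let D : EC →ₗ[ℝ] E := (mfderiv 𝓘(ℝ, EC) 𝓘(ℝ, E) i c).toLinearMap
    have hD : Function.Injective D := by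
      intro v w hvw
      apply hC.de_injective c
      rw [hde, hde]
      exact congrArg _ hvw
    -- On the tangent space of `M` the kernel is the tangent space of `C`, so the rank is the
    -- codimension.
    have hk : LinearMap.ker L = LinearMap.range D := by
      apply le_antisymm
      · intro v hv
        have hv' : h.de (i c) v - hC.proj c (h.de (i c) v) = 0 := hv
        obtain ⟨w, hw⟩ := hker c v (sub_eq_zero.1 hv').symm
        exact ⟨w, hw.symm⟩
      · rintro _ ⟨w, rfl⟩
        change h.de (i c) (D w) - hC.proj c (h.de (i c) (D w)) = 0
        have : h.de (i c) (D w) = hC.de c w := (hde c w).symm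
        rw [this, hC.proj_de, sub_self]
    have h1 := L.finrank_range_add_finrank_ker
    rw [hk, LinearMap.finrank_range_of_inj hD] at h1
    change Module.finrank ℝ (LinearMap.range L) = _
    omega

/-- Every neighborhood of an embedded submanifold contains a tubular neighborhood. -/
theorem exists_isTubularNeighborhood [T2Space M] [SecondCountableTopology M] [Nonempty C]
    {i : C → M} (hi : ContMDiff 𝓘(ℝ, EC) 𝓘(ℝ, E) ∞ i) (hemb : Topology.IsEmbedding i)
    (hinj : ∀ c, Function.Injective (mfderiv 𝓘(ℝ, EC) 𝓘(ℝ, E) i c))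
    {W : Set M} (hW : IsOpen W) (hiW : ∀ c, i c ∈ W) :
    ∃ V ⊆ W, IsTubularNeighborhood (E := EC) (E' := E) i V := by
  have hn : (∞ : WithTop ℕ∞) ≠ 0 := by simp
  have hM : Nonempty M := Nonempty.map i ‹_›
  obtain ⟨H, _, _, _, e, he, hee, hei⟩ := exists_embedding_hilbert (E := E) (M := M)
  obtain ⟨O, r, h⟩ := exists_isRetraction he hee hei
  have hde : ∀ c (w : EC), mfderiv 𝓘(ℝ, EC) 𝓘(ℝ, H) (e ∘ i) c w =
      h.de (i c) (mfderiv 𝓘(ℝ, EC) 𝓘(ℝ, E) i c w) := fun c w =>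
    mfderiv_comp_apply c ((h.contMDiff _).mdifferentiableAt hn) ((hi c).mdifferentiableAt hn) w
  obtain ⟨OC, rC, hC⟩ := exists_isRetraction (E := EC) (he.comp hi) (hee.comp hemb) (fun c => by
    intro v w hvw
    have h1 := (hde c v).symm.trans (hvw.trans (hde c w))
    exact hinj c (h.de_injective _ h1))
  obtain ⟨hq, hker⟩ := isProjFamily_normal hi h hC
  set k := Module.finrank ℝ E - Module.finrank ℝ EC
  set q : C → H →L[ℝ] H := fun c => (1 - hC.proj c) ∘L h.proj (i c) with hqdef
  let p : M → C := fun x => rC (e x)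
  let W₁ : Set M := W ∩ e ⁻¹' OC
  have hW₁ : IsOpen W₁ := hW.inter (hC.isOpen.preimage he.continuous)
  have hiW₁ : ∀ c, i c ∈ W₁ := fun c => ⟨hiW c, hC.mem c⟩
  have hp : ContMDiffOn 𝓘(ℝ, E) 𝓘(ℝ, EC) ∞ p W₁ :=
    hC.contMDiffOn.comp he.contMDiffOn (fun x hx => hx.2)
  have hpi : ∀ c, p (i c) = c := hC.left_inv
  -- A point near `C` is described by the point `p x` of `C` and by the normal component of the
  -- displacement `e x - a x`. The pair `(a, b)` is this description inside `H × H`, where a left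
  -- inverse is available.
  let a : M → H := fun x => e (i (p x))
  have ha : ContMDiffOn 𝓘(ℝ, E) 𝓘(ℝ, H) ∞ a W₁ := hC.contMDiff.comp_contMDiffOn hp
  let d : M → H := fun x => e x - a x
  have hd : ContMDiffOn 𝓘(ℝ, E) 𝓘(ℝ, H) ∞ d W₁ := he.contMDiffOn.sub ha
  let b : M → H := fun x => q (p x) (d x)
  have hqp : ContMDiffOn 𝓘(ℝ, E) 𝓘(ℝ, H →L[ℝ] H) ∞ (fun x => q (p x)) W₁ :=
    hq.contMDiff.comp_contMDiffOn hp
  have hb : ContMDiffOn 𝓘(ℝ, E) 𝓘(ℝ, H) ∞ b W₁ := hqp.clm_apply hd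
  have hdi : ∀ c, d (i c) = 0 := fun c => by
    change e (i c) - e (i (p (i c))) = 0
    rw [hpi, sub_self]
  have hbi : ∀ c, b (i c) = 0 := fun c => by
    change q _ (d (i c)) = 0
    rw [hdi, map_zero]
  have : TopologicalSpace.MetrizableSpace M := hee.metrizableSpace
  obtain ⟨Ô, W₂, R, hÔ, hW₂, hWW, hiW₂, hm, hR, hRi⟩ := exists_leftInverse_prod (I := 𝓘(ℝ, E))
    hemb.continuous hW₁ hiW₁ ha hb (by
      -- Among the tangent vectors of `M`, the projection `q` kills only those tangent to `C`. On
      -- `C` the map `a` agrees with `e`, so a vector tangent to `C` that is killed by `a` vanishes.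
      intro c v hav hbv
      have hnh := hW₁.mem_nhds (hiW₁ c)
      have h1 := mfderiv_clm_apply_of_eq_zero (I := 𝓘(ℝ, E)) (hqp.contMDiffAt hnh)
        (hd.contMDiffAt hnh) (hdi c) v
      have h2 : mfderiv 𝓘(ℝ, E) 𝓘(ℝ, H) d (i c) v = h.de (i c) v := by
        have h3 := mfderiv_sub ((he (i c)).mdifferentiableAt hn)
          ((ha.contMDiffAt hnh).mdifferentiableAt hn)
        let Da : E →L[ℝ] H := mfderiv 𝓘(ℝ, E) 𝓘(ℝ, H) a (i c)
        have h4 : mfderiv 𝓘(ℝ, E) 𝓘(ℝ, H) d (i c) v =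
          h.de (i c) v - Da v :=
          congrArg (fun T : E →L[ℝ] H => T v) h3
        have h4' : Da v = 0 := hav
        rw [h4, h4', sub_zero]
      rw [h2] at h1
      have h5 : q c (h.de (i c) v) = 0 := by
        have h6 := h1.symm.trans hbv
        change q (p (i c)) (h.de (i c) v) = 0 at h6
        rwa [hpi] at h6
      have h7 : h.de (i c) v - hC.proj c (h.de (i c) v) = 0 := by
        have h8 : (1 - hC.proj c) (h.proj (i c) (h.de (i c) v)) = 0 := h5
        exact (congrArg (fun y => (1 - hC.proj c) y) (h.proj_de (i c) v)).symm.trans h8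
      obtain ⟨w, hw⟩ := hker c v (sub_eq_zero.1 h7).symm
      have h9 : a ∘ i = e ∘ i := by
        funext c'
        exact congrArg (fun z => e (i z)) (hpi c')
      have h10 : mfderiv 𝓘(ℝ, EC) 𝓘(ℝ, H) (a ∘ i) c w = 0 := by
        rw [mfderiv_comp_apply c ((ha.contMDiffAt hnh).mdifferentiableAt hn)
          ((hi c).mdifferentiableAt hn) w, ← hw]
        exact hav
      rw [h9] at h10
      have h11 : w = 0 := hC.de_injective c (h10.trans (map_zero (hC.de c)).symm)
      rw [hw, h11]
      exact map_zero _)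
    (by
      have : (fun c => (a (i c), b (i c))) = fun c => ((e ∘ i) c, (0 : H)) := by
        funext c
        exact Prod.ext (congrArg (fun z => e (i z)) (hpi c)) (hbi c)
      rw [this]
      exact (isInducing_prodMkLeft (0 : H)).comp (hee.comp hemb).isInducing)
  let χ : M → hq.Total := fun x => hq.mkTotal (p x) (d x)
  have hχ := (hq.contMDiffOn_mkTotal hp hd).mono hWW
  let ζ : hq.Total → H × H := fun z => (e (i z.1), hq.toAmbient z)
  have hζ : ContMDiff (𝓘(ℝ, EC).prod 𝓘(ℝ, EuclideanSpace ℝ (Fin k))) 𝓘(ℝ, H × H) ∞ ζ :=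
    (hC.contMDiff.comp (contMDiff_proj hq.core.Fiber)).prodMk_space hq.contMDiff_toAmbient
  have hζχ : ∀ x, ζ (χ x) = (a x, b x) := fun x =>
    Prod.ext rfl (hq.toAmbient_mkTotal (p x) (d x))
  have hkE : Module.finrank ℝ EC ≤ Module.finrank ℝ E := by
    obtain ⟨c⟩ := ‹Nonempty C›
    let D : EC →ₗ[ℝ] E := (mfderiv 𝓘(ℝ, EC) 𝓘(ℝ, E) i c).toLinearMap
    exact LinearMap.finrank_le_finrank_of_injective (f := D) (hinj c)
  -- As `ζ ∘ χ` is the pair `(a, b)`, the composite `R ∘ ζ` is a left inverse of `χ`. The rank of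
  -- the bundle was chosen so that the dimensions agree.
  obtain ⟨Φ, hΦs, hΦ⟩ := exists_partialDiffeomorph (I := 𝓘(ℝ, E))
    (J := 𝓘(ℝ, EC).prod 𝓘(ℝ, EuclideanSpace ℝ (Fin k)))
    (by rw [Module.finrank_prod, finrank_euclideanSpace_fin]; omega)
    (f := χ) (ρ := R ∘ ζ) hW₂ (hÔ.preimage hζ.continuous) hχ
    (hR.comp hζ.contMDiffOn (fun _ h => h))
    (fun x hx => by
      change ζ (χ x) ∈ Ô
      rw [hζχ]
      exact hm x hx)
    (fun x hx => by
      change R (ζ (χ x)) = x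
      rw [hζχ]
      exact hRi x hx)
  have hχi : ∀ c, χ (i c) = ⟨c, 0⟩ := fun c => by
    change hq.mkTotal (p (i c)) (d (i c)) = _
    rw [hpi, hdi, hq.mkTotal_zero]
  have hzero : ∀ c, (⟨c, 0⟩ : hq.Total) ∈ Φ.target := fun c => by
    rw [← hχi, ← hΦ]
    exact Φ.map_source' (hΦs ▸ hiW₂ c)
  obtain ⟨V, hVΦ, hV, hV0, hVs⟩ := exists_starShaped Φ.open_target hzero
  obtain ⟨ψ, hψs, hψt, hψ⟩ := exists_restr Φ.symm hV hVΦ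
  have hinvΦ : ∀ c, Φ.symm ⟨c, 0⟩ = i c := fun c => by
    rw [← hχi, ← hΦ]
    exact Φ.left_inv' (hΦs ▸ hiW₂ c)
  refine ⟨ψ.target, ?_, k, hq.core.Fiber, inferInstance, inferInstance, inferInstance, inferInstance,
    inferInstance, inferInstance, inferInstance, ψ, rfl, ?_, ?_⟩
  · rw [hψt]
    rintro _ ⟨z, hz, rfl⟩
    have h1 : Φ.symm z ∈ Φ.source := Φ.map_target' (hVΦ hz)
    rw [hΦs] at h1
    exact (hWW h1).1
  · intro c
    refine ⟨hψs ▸ hV0 c, ?_⟩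
    rw [hψ, hinvΦ]
  · intro c v hv s hs
    rw [hψs] at hv ⊢
    exact hVs c v hv s hs

end Tubular

/-! ### Local flows of vector fields on open subsets -/

section LocalFlow

open unitInterval

variable {E : Type*} [NormedAddCommGroup E] [NormedSpace ℝ E] [FiniteDimensional ℝ E]

/-- A smooth map on an open set can be extended from a neighborhood of a compact subset. -/
theorem exists_contDiff_extension {F G : Type*} [NormedAddCommGroup F] [NormedSpace ℝ F]
    [FiniteDimensional ℝ F] [NormedAddCommGroup G] [NormedSpace ℝ G]
    {v : F → G} {𝒲 K : Set F} (h𝒲 : IsOpen 𝒲) (hv : ContDiffOn ℝ ∞ v 𝒲)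
    (hK : IsCompact K) (hKW : K ⊆ 𝒲) :
    ∃ f : F → G, ContDiff ℝ ∞ f ∧ ∀ x ∈ K, f =ᶠ[𝓝 x] v := by
  obtain ⟨K', hK', hKK', hK'W⟩ := exists_compact_between hK h𝒲 hKW
  obtain ⟨χ, hχ1, hχ0, -⟩ := exists_contMDiffMap_one_nhds_of_subset_interior (n := (⊤ : ℕ∞)) 𝓘(ℝ, F)
    hK.isClosed hKK'
  have hχ : ContDiff ℝ ∞ χ := χ.contMDiff.contDiff
  refine ⟨fun x => χ x • v x, ?_, ?_⟩
  · rw [contDiff_iff_contDiffAt]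
    intro x
    by_cases hx : x ∈ 𝒲
    · exact hχ.contDiffAt.smul (hv.contDiffAt (h𝒲.mem_nhds hx))
    · have hx' : K'ᶜ ∈ 𝓝 x := hK'.isClosed.isOpen_compl.mem_nhds fun h => hx (hK'W h)
      refine (contDiffAt_const (c := (0 : G))).congr_of_eventuallyEq ?_
      filter_upwards [hx'] with y hy
      rw [hχ0 y hy, zero_smul]
  · intro x hx
    filter_upwards [(eventually_nhdsSet_iff_forall.1 hχ1) x hx] with y hy
    rw [hy, one_smul]

/-- The flow of a smooth time-dependent vector field near a rest point exists up to time one, is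
unique, depends smoothly on the initial value, and its derivative solves the linearized
equation. -/
theorem exists_local_flow {v : ℝ × E → E} {𝒲 : Set (ℝ × E)} (h𝒲 : IsOpen 𝒲)
    (hv : ContDiffOn ℝ ∞ v 𝒲) {u₀ : E} (hmem : ∀ t ∈ Icc (0 : ℝ) 1, (t, u₀) ∈ 𝒲)
    (h₀ : ∀ t ∈ Icc (0 : ℝ) 1, v (t, u₀) = 0) {N : Set E} (hN : N ∈ 𝓝 u₀) :
    ∃ (A B : Set E) (Γ : E → C(I, E)), IsOpen A ∧ u₀ ∈ A ∧ IsOpen B ∧ u₀ ∈ B ∧ B ⊆ N ∧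
      (∀ t ∈ Icc (0 : ℝ) 1, ∀ y ∈ B, (t, y) ∈ 𝒲) ∧ ContDiffOn ℝ ∞ Γ A ∧
      Γ u₀ = constCurve u₀ ∧
      (∀ u ∈ A, Γ u 0 = u ∧ (∀ t, Γ u t ∈ B) ∧
        (∀ t ∈ Icc (0 : ℝ) 1,
          HasDerivWithinAt (extend (Γ u)) (v (t, extend (Γ u) t)) (Icc 0 1) t) ∧
        (∀ w : E, fderiv ℝ Γ u w 0 = w ∧ ∀ t ∈ Icc (0 : ℝ) 1,
          HasDerivWithinAt (extend (fderiv ℝ Γ u w))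
            (partialSnd v (t, extend (Γ u) t) (extend (fderiv ℝ Γ u w) t)) (Icc 0 1) t) ∧
        ∀ w : E, fderiv ℝ Γ u w 1 = 0 → w = 0) ∧
      ∀ γ : ℝ → E, (∀ t ∈ Icc (0 : ℝ) 1, γ t ∈ B ∧
        HasDerivWithinAt γ (v (t, γ t)) (Icc 0 1) t) → γ 0 ∈ A →
        ∀ t ∈ Icc (0 : ℝ) 1, γ t = extend (Γ (γ 0)) t := by
  -- The field is given only on `𝒲`. It is extended by a cutoff from a compact tube around the rest
  -- point, and initial values are restricted to those whose curves stay in a ball on which the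
  -- field is unchanged.
  have htube : ∀ᶠ y in 𝓝 u₀, ∀ t ∈ Icc (0 : ℝ) 1, (t, y) ∈ 𝒲 :=
    isCompact_Icc.eventually_forall_of_forall_eventually fun t ht =>
      continuous_swap.continuousAt.eventually_mem (h𝒲.mem_nhds (hmem t ht))
  obtain ⟨ρ, hρ, hρs⟩ := Metric.nhds_basis_closedBall.mem_iff.1 (htube.and hN)
  obtain ⟨f, hf, hfv⟩ := exists_contDiff_extension h𝒲 hv
    (isCompact_Icc.prod (isCompact_closedBall u₀ ρ)) (fun z hz => (hρs hz.2).1 z.1 hz.1)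
  have hfv' : ∀ t ∈ Icc (0 : ℝ) 1, ∀ y ∈ Metric.ball u₀ ρ, f =ᶠ[𝓝 (t, y)] v := fun t ht y hy =>
    hfv (t, y) ⟨ht, Metric.ball_subset_closedBall hy⟩
  have hu₀ : u₀ ∈ Metric.ball u₀ ρ := Metric.mem_ball_self hρ
  obtain ⟨A', Γ, hA', hu₀A', hΓ, hΓ₀, hΓA⟩ := exists_smooth_flow hf (u₀ := u₀)
    (fun t ht => ((hfv' t ht u₀ hu₀).eq_of_nhds).trans (h₀ t ht))
  have hopen : IsOpen (A' ∩ Γ ⁻¹' Metric.ball (constCurve u₀) ρ) :=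
    hΓ.continuousOn.isOpen_inter_preimage hA' Metric.isOpen_ball
  have hstay : ∀ u ∈ A' ∩ Γ ⁻¹' Metric.ball (constCurve u₀) ρ, ∀ t, Γ u t ∈ Metric.ball u₀ ρ :=
    fun u hu t => lt_of_le_of_lt (ContinuousMap.dist_apply_le_dist (g := constCurve u₀) t) hu.2
  refine ⟨A' ∩ Γ ⁻¹' Metric.ball (constCurve u₀) ρ, Metric.ball u₀ ρ, Γ, hopen, ⟨hu₀A', ?_⟩,
    Metric.isOpen_ball, hu₀, fun y hy => (hρs (Metric.ball_subset_closedBall hy)).2,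
    fun t ht y hy => (hρs (Metric.ball_subset_closedBall hy)).1 t ht, hΓ.mono inter_subset_left,
    hΓ₀, ?_, ?_⟩
  · change Γ u₀ ∈ Metric.ball (constCurve u₀) ρ
    rw [hΓ₀]
    exact Metric.mem_ball_self hρ
  · intro u hu
    obtain ⟨h1, h2, h3⟩ := hΓA u hu.1
    refine ⟨h1, hstay u hu, fun t ht => ?_, fun w => ⟨(h3 w).1, fun t ht => ?_⟩, fun w hw => ?_⟩
    · have h4 := h2 t ht
      rwa [(hfv' t ht _ (by rw [extend_of_mem _ ht]; exact hstay u hu _)).eq_of_nhds] at h4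
    · have h4 := (h3 w).2 t ht
      have h5 : partialSnd f (t, extend (Γ u) t) = partialSnd v (t, extend (Γ u) t) := by
        unfold partialSnd
        rw [(hfv' t ht _ (by rw [extend_of_mem _ ht]; exact hstay u hu _)).fderiv_eq]
      rwa [h5] at h4
    -- Backward uniqueness for the linearized equation: a variation that vanishes at time one
    -- vanishes at time zero.
    · have h6 : Continuous fun t : ℝ => partialSnd f (t, extend (Γ u) t) :=
        (contDiff_partialSnd hf).continuous.comp
          (continuous_id.prodMk (continuous_extend (Γ u)))
      have h7 := eq_zero_of_linear h6.continuousOn (h3 w).2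
        (by rw [extend_of_mem _ (by simp)]; exact hw)
      rw [extend_of_mem _ (by simp)] at h7
      exact (h3 w).1.symm.trans h7
  · intro γ hγ hγ0
    obtain ⟨h1, h2, -⟩ := hΓA (γ 0) hγ0.1
    refine eqOn_of_contDiff hf (fun t ht => ?_) h2 ?_
    · rw [(hfv' t ht _ (hγ t ht).1).eq_of_nhds]
      exact (hγ t ht).2
    · rw [extend_of_mem _ (by simp)]
      exact h1.symm

end LocalFlow

/-! ### Linear algebra of cosymplectic subspaces -/

section LinearAlgebra

variable {V W : Type*} [AddCommGroup V] [Module ℝ V] [FiniteDimensional ℝ V]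
  [AddCommGroup W] [Module ℝ W]

theorem apply_sharp (B : LinearMap.BilinForm ℝ (Module.Dual ℝ V)) (ξ η : Module.Dual ℝ V) :
    η (sharp B ξ) = B ξ η := by
  have h := (Module.evalEquiv ℝ V).apply_symm_apply (B ξ)
  exact congrArg (fun T : Module.Dual ℝ (Module.Dual ℝ V) => T η) h

theorem apply_sharp_comm {B : LinearMap.BilinForm ℝ (Module.Dual ℝ V)} (hB : ∀ ξ, B ξ ξ = 0)
    (ξ η : Module.Dual ℝ V) : η (sharp B ξ) = -ξ (sharp B η) := by
  rw [apply_sharp, apply_sharp]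
  have h := hB (ξ + η)
  simp only [map_add, LinearMap.add_apply, hB, zero_add, add_zero] at h
  linarith

theorem mem_of_forall_dual {S : Submodule ℝ V} {v : V}
    (h : ∀ ν ∈ S.dualAnnihilator, ν v = 0) : v ∈ S := by
  rw [← Subspace.dualAnnihilator_dualCoannihilator_eq (W := S), Submodule.mem_dualCoannihilator]
  exact h

/-- The coisotropic hull `S + ♯ S°` of a subspace. -/
def hull (B : LinearMap.BilinForm ℝ (Module.Dual ℝ V)) (S : Submodule ℝ V) : Submodule ℝ V :=
  S ⊔ sharpAnn B S

theorem sharpAnn_anti (B : LinearMap.BilinForm ℝ (Module.Dual ℝ V)) {S T : Submodule ℝ V}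
    (h : S ≤ T) : sharpAnn B T ≤ sharpAnn B S :=
  Submodule.map_mono (Submodule.dualAnnihilator_anti h)

/-- `T` parametrizes a subspace that contains `K` and is in general position to `K + ♯ K°`. -/
structure IsTransverse (B : LinearMap.BilinForm ℝ (Module.Dual ℝ V)) (K : Submodule ℝ V)
    (T : W →ₗ[ℝ] V) : Prop where
  injective : Function.Injective T
  le_range : K ≤ LinearMap.range T
  mem_of_mem_hull : ∀ w, T w ∈ hull B K → T w ∈ K
  sup_hull : LinearMap.range T ⊔ hull B K = ⊤

/-- A cosymplectic subspace that contains `K` coisotropically is in general position to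
`K + ♯ K°`. -/
theorem isTransverse_of_coisotropic [FiniteDimensional ℝ W]
    {B : LinearMap.BilinForm ℝ (Module.Dual ℝ V)} (hB : ∀ ξ, B ξ ξ = 0) {L : W →ₗ[ℝ] V}
    (hL : Function.Injective L)
    (h : IsCompl (LinearMap.range L) (sharpAnn B (LinearMap.range L))) {K : Submodule ℝ W}
    (hK : sharpAnn (inducedForm B L hL h) K ≤ K) : IsTransverse B (K.map L) L := by
  have hKL : K.map L ≤ LinearMap.range L := LinearMap.map_le_range
  refine ⟨hL, hKL, fun w hw => ?_, ?_⟩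
  · obtain ⟨_, ⟨k, hk, rfl⟩, _, ⟨η, hη, rfl⟩, hsum⟩ := Submodule.mem_sup.1 hw
    let pr : V →ₗ[ℝ] W := LinearMap.linearProjOfIsCompl (sharpAnn B (LinearMap.range L)) L hL h
    have hprL : ∀ w, pr (L w) = w := LinearMap.linearProjOfIsCompl_apply_left _ L hL h
    have hpr0 : ∀ v ∈ sharpAnn B (LinearMap.range L), pr v = 0 := fun v hv =>
      LinearMap.linearProjOfIsCompl_apply_right _ L hL h ⟨v, hv⟩
    let ηW : Module.Dual ℝ W := η ∘ₗ L
    have hηW : ηW ∈ K.dualAnnihilator := by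
      rw [SetLike.mem_coe, Submodule.mem_dualAnnihilator] at hη
      rw [Submodule.mem_dualAnnihilator]
      exact fun w hw => hη _ (Submodule.mem_map_of_mem hw)
    have hind := hK (Submodule.mem_map_of_mem (f := sharp (inducedForm B L hL h)) hηW)
    -- `η'` agrees with `η` on the cosymplectic subspace and vanishes on its complement. Then `♯ η'`
    -- lies in the subspace, as does `♯ η = L w - L k`, so `♯ (η - η')` lies in both summands and is
    -- zero. What remains is the induced bivector contracted with `ηW`, to which coisotropy applies.
    let η' : Module.Dual ℝ V := ηW ∘ₗ pr
    have hη'V : sharp B η' ∈ LinearMap.range L := by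
      refine mem_of_forall_dual fun ν hν => ?_
      rw [apply_sharp_comm hB]
      change -(ηW (pr (sharp B ν))) = 0
      rw [hpr0 _ (Submodule.mem_map_of_mem hν), map_zero, neg_zero]
    have hη'' : sharp B (η - η') ∈ sharpAnn B (LinearMap.range L) := by
      refine Submodule.mem_map_of_mem ?_
      rw [Submodule.mem_dualAnnihilator]
      rintro _ ⟨w, rfl⟩
      change η (L w) - η (L (pr (L w))) = 0
      rw [hprL, sub_self]
    have hηV : sharp B η ∈ LinearMap.range L := by
      have : sharp B η = L w - L k := by rw [← hsum]; abel
      rw [this, ← map_sub]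
      exact ⟨_, rfl⟩
    have h0 : sharp B (η - η') = 0 := by
      refine Submodule.disjoint_def.1 h.disjoint _ ?_ hη''
      rw [map_sub]
      exact sub_mem hηV hη'V
    have heq : sharp B η = sharp B η' := by
      rw [map_sub, sub_eq_zero] at h0
      exact h0
    have hprs : pr (sharp B η') = sharp (inducedForm B L hL h) ηW := by
      refine (Module.forall_dual_apply_eq_zero_iff ℝ _).1 (fun ζ => ?_) |> sub_eq_zero.1
      rw [map_sub, apply_sharp]
      change (ζ ∘ₗ pr) (sharp B η') - B η' (ζ ∘ₗ pr) = 0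
      rw [apply_sharp, sub_self]
    obtain ⟨w', hw'⟩ := hη'V
    have hw'K : w' ∈ K := by
      rw [← hprL w', hw', hprs]
      exact hind
    rw [← hsum, heq, ← hw']
    exact add_mem (Submodule.mem_map_of_mem hk) (Submodule.mem_map_of_mem hw'K)
  · rw [eq_top_iff, ← h.sup_eq_top]
    exact sup_le_sup_left ((sharpAnn_anti B hKL).trans le_sup_right) _

/-- Deforming a subspace in general position in the direction of `K + ♯ K°` keeps it in general
position. -/
theorem IsTransverse.deform {B : LinearMap.BilinForm ℝ (Module.Dual ℝ V)} {K : Submodule ℝ V}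
    {T : W →ₗ[ℝ] V} (h : IsTransverse B K T) {T' : W →ₗ[ℝ] V}
    (hull_mem : ∀ w, T' w - T w ∈ hull B K) (hK : ∀ w, T w ∈ K → T' w = T w) : IsTransverse B K T' := by
  have key : ∀ w, T' w ∈ hull B K → T w ∈ K := by
    intro w hw
    refine h.mem_of_mem_hull w ?_
    have := sub_mem hw (hull_mem w)
    rwa [sub_sub_cancel] at this
  refine ⟨?_, ?_, ?_, ?_⟩
  · rw [injective_iff_map_eq_zero]
    intro w hw
    have h1 := key w (by rw [hw]; exact zero_mem _)
    have h2 : T w = 0 := by rw [← hK w h1, hw]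
    exact (injective_iff_map_eq_zero T).1 h.injective w h2
  · intro k hk
    obtain ⟨w, rfl⟩ := h.le_range hk
    exact ⟨w, hK w hk⟩
  · intro w hw
    have h1 := key w hw
    rwa [hK w h1]
  · rw [eq_top_iff, ← h.sup_hull]
    refine sup_le ?_ le_sup_right
    rintro _ ⟨w, rfl⟩
    have : T w = T' w - (T' w - T w) := by abel
    rw [this]
    exact sub_mem (Submodule.mem_sup_left ⟨w, rfl⟩) (Submodule.mem_sup_right (hull_mem w))

/-- A subspace in general position is cosymplectic. -/
theorem IsTransverse.eq_zero {B : LinearMap.BilinForm ℝ (Module.Dual ℝ V)}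
    (hB : ∀ ξ, B ξ ξ = 0) {K : Submodule ℝ V} {T : W →ₗ[ℝ] V} (h : IsTransverse B K T) {w : W}
    {ξ : Module.Dual ℝ V} (h1 : T w + sharp B ξ = 0) (h2 : ξ ∘ₗ T = 0) : w = 0 ∧ ξ = 0 := by
  have hξT : ∀ w, ξ (T w) = 0 := fun w => congrArg (fun f : W →ₗ[ℝ] ℝ => f w) h2
  have hξK : ξ ∈ K.dualAnnihilator := by
    rw [Submodule.mem_dualAnnihilator]
    intro k hk
    obtain ⟨w, rfl⟩ := h.le_range hk
    exact hξT w
  have hs : sharp B ξ ∈ hull B K := Submodule.mem_sup_right (Submodule.mem_map_of_mem hξK)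
  have hTw : T w = -sharp B ξ := eq_neg_of_add_eq_zero_left h1
  have hTK : T w ∈ K := h.mem_of_mem_hull w (by rw [hTw]; exact neg_mem hs)
  have hsK : sharp B ξ ∈ K := by
    rw [hTw] at hTK
    simpa using neg_mem hTK
  -- `ξ` vanishes on the range of `T` and on `K`. For `η ∈ K°` also `ξ (♯ η) = -η (♯ ξ) = 0`, since
  -- `♯ ξ ∈ K`. These subspaces span `V`.
  have hξ : ξ = 0 := by
    ext v
    have hv : v ∈ LinearMap.range T ⊔ hull B K := by rw [h.sup_hull]; trivial
    obtain ⟨_, ⟨w', rfl⟩, a, ha, rfl⟩ := Submodule.mem_sup.1 hv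
    obtain ⟨k, hk, _, ⟨η, hη, rfl⟩, rfl⟩ := Submodule.mem_sup.1 ha
    rw [map_add, map_add, hξT, (Submodule.mem_dualAnnihilator ξ).1 hξK k hk,
      apply_sharp_comm hB, (Submodule.mem_dualAnnihilator η).1 hη _ hsK]
    simp
  refine ⟨(injective_iff_map_eq_zero T).1 h.injective w ?_, hξ⟩
  rw [hTw, hξ, map_zero, neg_zero]

/-- The bivector induced on a cosymplectic subspace is natural with respect to linear
isomorphisms. -/
theorem inducedForm_natural {V' W' : Type*} [AddCommGroup V'] [Module ℝ V']
    [FiniteDimensional ℝ V'] [AddCommGroup W'] [Module ℝ W']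
    {B : LinearMap.BilinForm ℝ (Module.Dual ℝ V)} {L : W →ₗ[ℝ] V} (hL : Function.Injective L)
    (h : IsCompl (LinearMap.range L) (sharpAnn B (LinearMap.range L)))
    {B' : LinearMap.BilinForm ℝ (Module.Dual ℝ V')} {L' : W' →ₗ[ℝ] V'}
    (hL' : Function.Injective L')
    (h' : IsCompl (LinearMap.range L') (sharpAnn B' (LinearMap.range L')))
    {A : V →ₗ[ℝ] V'} (hA : Function.Bijective A) (hAB : ∀ ξ η, B' ξ η = B (ξ ∘ₗ A) (η ∘ₗ A))
    {S : W →ₗ[ℝ] W'} (hS : Function.Surjective S) (hSA : ∀ w, L' (S w) = A (L w))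
    (ξ η : Module.Dual ℝ W') :
    inducedForm B' L' hL' h' ξ η = inducedForm B L hL h (ξ ∘ₗ S) (η ∘ₗ S) := by
  let pr : V →ₗ[ℝ] W := LinearMap.linearProjOfIsCompl (sharpAnn B (LinearMap.range L)) L hL h
  let pr' : V' →ₗ[ℝ] W' :=
    LinearMap.linearProjOfIsCompl (sharpAnn B' (LinearMap.range L')) L' hL' h'
  have hprL : ∀ w, pr (L w) = w := LinearMap.linearProjOfIsCompl_apply_left _ L hL h
  have hpr0 : ∀ v ∈ sharpAnn B (LinearMap.range L), pr v = 0 := fun v hv =>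
    LinearMap.linearProjOfIsCompl_apply_right _ L hL h ⟨v, hv⟩
  have hprL' : ∀ w, pr' (L' w) = w :=
    LinearMap.linearProjOfIsCompl_apply_left _ L' hL' h'
  have hpr0' : ∀ v ∈ sharpAnn B' (LinearMap.range L'), pr' v = 0 := fun v hv =>
    LinearMap.linearProjOfIsCompl_apply_right _ L' hL' h' ⟨v, hv⟩
  -- `A` intertwines the projections because it maps each summand to the corresponding one:
  -- annihilators correspond under transport by the inverse of `A`, and `♯` is equivariant.
  have key : ∀ v, pr' (A v) = S (pr v) := by
    intro v
    have hv : v ∈ LinearMap.range L ⊔ sharpAnn B (LinearMap.range L) := by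
      rw [h.sup_eq_top]; trivial
    obtain ⟨_, ⟨w, rfl⟩, _, ⟨ν, hν, rfl⟩, rfl⟩ := Submodule.mem_sup.1 hv
    let Ae := LinearEquiv.ofBijective A hA
    let ν' : Module.Dual ℝ V' := ν ∘ₗ Ae.symm.toLinearMap
    have hν'A : ν' ∘ₗ A = ν := by
      ext v
      exact congrArg ν (Ae.symm_apply_apply v)
    have hAs : A (sharp B ν) = sharp B' ν' := by
      refine (Module.forall_dual_apply_eq_zero_iff ℝ _).1 (fun ζ => ?_) |> sub_eq_zero.1
      rw [map_sub, apply_sharp, hAB, hν'A]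
      change (ζ ∘ₗ A) (sharp B ν) - _ = 0
      rw [apply_sharp, sub_self]
    have hν' : ν' ∈ (LinearMap.range L').dualAnnihilator := by
      rw [SetLike.mem_coe, Submodule.mem_dualAnnihilator] at hν
      rw [Submodule.mem_dualAnnihilator]
      rintro _ ⟨w', rfl⟩
      obtain ⟨w, rfl⟩ := hS w'
      rw [hSA]
      have := congrArg (fun f : V →ₗ[ℝ] ℝ => f (L w)) hν'A
      exact this.trans (hν _ ⟨w, rfl⟩)
    rw [map_add, map_add, map_add, map_add, ← hSA, hprL', hprL, hAs,
      hpr0' _ (Submodule.mem_map_of_mem hν'), hpr0 _ (Submodule.mem_map_of_mem hν), map_zero]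
  change B' (ξ ∘ₗ pr') (η ∘ₗ pr') = B ((ξ ∘ₗ S) ∘ₗ pr) ((η ∘ₗ S) ∘ₗ pr)
  rw [hAB]
  congr 1
  · congr 1
    ext v
    exact congrArg ξ (key v)
  · ext v
    exact congrArg η (key v)

end LinearAlgebra

/-! ### Hamiltonian flows on open subsets of a vector space -/

section ChartPoisson

variable {E : Type*} [NormedAddCommGroup E] [NormedSpace ℝ E]
  {F : Type*} [NormedAddCommGroup F] [NormedSpace ℝ F]

theorem hasFDerivAt_partialSnd_of_differentiableAt {f : ℝ × E → F} {t : ℝ} {u : E}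
    (hf : DifferentiableAt ℝ f (t, u)) :
    HasFDerivAt (fun v => f (t, v)) (partialSnd f (t, u)) u :=
  hf.hasFDerivAt.comp u (hasFDerivAt_prodMk_right t u)

theorem contDiffOn_partialSnd {f : ℝ × E → F} {𝒲 : Set (ℝ × E)} (h𝒲 : IsOpen 𝒲)
    (hf : ContDiffOn ℝ ∞ f 𝒲) : ContDiffOn ℝ ∞ (partialSnd f) 𝒲 := by
  have : ContDiffOn ℝ ∞ (fderiv ℝ f) 𝒲 := hf.fderiv_of_isOpen h𝒲 (by simp)
  exact this.clm_comp contDiffOn_const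

/-- In finite dimensions, a linear map is determined by its values on a basis. -/
theorem clm_eq_sum [FiniteDimensional ℝ E] (T : E →L[ℝ] F) :
    T = ∑ k, ContinuousLinearMap.smulRightL ℝ E F
      ((Module.finBasis ℝ E).coord k).toContinuousLinearMap (T (Module.finBasis ℝ E k)) := by
  refine ContinuousLinearMap.ext fun w => ?_
  have hw := (Module.finBasis ℝ E).sum_repr w
  conv_lhs => rw [← hw]
  simp only [map_sum, map_smul, sum_apply]
  rfl

/-- In finite dimensions, a curve of linear maps is differentiable if it is so pointwise. -/
theorem hasDerivWithinAt_clm [FiniteDimensional ℝ E] {J : ℝ → E →L[ℝ] F} {J' : E →L[ℝ] F}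
    {s : Set ℝ} {t : ℝ} (h : ∀ w, HasDerivWithinAt (fun t => J t w) (J' w) s t) :
    HasDerivWithinAt J J' s t := by
  rw [clm_eq_sum J', show J = fun t => ∑ k, ContinuousLinearMap.smulRightL ℝ E F
      ((Module.finBasis ℝ E).coord k).toContinuousLinearMap (J t (Module.finBasis ℝ E k)) from
        funext fun t => clm_eq_sum (J t)]
  refine HasDerivWithinAt.fun_sum fun k _ => ?_
  exact (ContinuousLinearMap.smulRightL ℝ E F
    ((Module.finBasis ℝ E).coord k).toContinuousLinearMap).hasFDerivAt.comp_hasDerivWithinAt t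
      (h (Module.finBasis ℝ E k))

/-- In finite dimensions, a family of linear maps is smooth if it is so pointwise. -/
theorem contDiffAt_clm [FiniteDimensional ℝ E] {G : Type*} [NormedAddCommGroup G]
    [NormedSpace ℝ G] {J : G → E →L[ℝ] F} {y : G}
    (h : ∀ w, ContDiffAt ℝ ∞ (fun y => J y w) y) : ContDiffAt ℝ ∞ J y := by
  rw [show J = fun t => ∑ k, ContinuousLinearMap.smulRightL ℝ E F
      ((Module.finBasis ℝ E).coord k).toContinuousLinearMap (J t (Module.finBasis ℝ E k)) from
        funext fun t => clm_eq_sum (J t)]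
  exact ContDiffAt.sum fun k _ =>
    (ContinuousLinearMap.contDiff _).contDiffAt.comp y (h (Module.finBasis ℝ E k))

/-- `S` is the contraction with a Poisson bivector on the subset `Ω` of the vector space `E`. -/
structure IsPoissonOn (S : E → (E →L[ℝ] ℝ) →L[ℝ] E) (Ω : Set E) : Prop where
  contDiffOn : ContDiffOn ℝ ∞ S Ω
  anti : ∀ u ∈ Ω, ∀ l m : E →L[ℝ] ℝ, l (S u m) = -m (S u l)
  jacobi : ∀ u ∈ Ω, ∀ l m n : E →L[ℝ] ℝ, n (fderiv ℝ S u (S u l) m) +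
    l (fderiv ℝ S u (S u m) n) + m (fderiv ℝ S u (S u n) l) = 0

/-- The time-dependent Hamiltonian vector field of `h`. -/
def hamField (S : E → (E →L[ℝ] ℝ) →L[ℝ] E) (h : ℝ × E → ℝ) (z : ℝ × E) : E :=
  S z.2 (partialSnd h z)

variable {S : E → (E →L[ℝ] ℝ) →L[ℝ] E} {Ω : Set E} {h : ℝ × E → ℝ} {𝒲 : Set (ℝ × E)}

theorem contDiffOn_hamField (hS : ContDiffOn ℝ ∞ S Ω) (h𝒲 : IsOpen 𝒲) (h𝒲Ω : ∀ z ∈ 𝒲, z.2 ∈ Ω)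
    (hh : ContDiffOn ℝ ∞ h 𝒲) : ContDiffOn ℝ ∞ (hamField S h) 𝒲 :=
  (hS.comp contDiff_snd.contDiffOn h𝒲Ω).clm_apply (contDiffOn_partialSnd h𝒲 hh)

/-- The Lie derivative of a Poisson bivector along a Hamiltonian vector field vanishes. -/
theorem IsPoissonOn.fderiv_hamField (hS : IsPoissonOn S Ω) (hΩ : IsOpen Ω) (h𝒲 : IsOpen 𝒲)
    (h𝒲Ω : ∀ z ∈ 𝒲, z.2 ∈ Ω) (hh : ContDiffOn ℝ ∞ h 𝒲) {t : ℝ} {u : E} (hz : (t, u) ∈ 𝒲)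
    (m : E →L[ℝ] ℝ) :
    fderiv ℝ S u (hamField S h (t, u)) m =
      partialSnd (hamField S h) (t, u) (S u m) +
        S u (m ∘L partialSnd (hamField S h) (t, u)) := by
  have hn : (∞ : WithTop ℕ∞) ≠ 0 := by simp
  have hu : u ∈ Ω := h𝒲Ω _ hz
  set α : ℝ × E → E →L[ℝ] ℝ := partialSnd h with hα
  have hαd : ContDiffOn ℝ ∞ α 𝒲 := contDiffOn_partialSnd h𝒲 hh
  have hda : HasFDerivAt (fun y => α (t, y)) (partialSnd α (t, u)) u :=
    hasFDerivAt_partialSnd_of_differentiableAt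
      ((hαd.contDiffAt (h𝒲.mem_nhds hz)).differentiableAt hn)
  have hsymm : ∀ w w', partialSnd α (t, u) w w' = partialSnd α (t, u) w' w := by
    intro w w'
    refine second_derivative_symmetric_of_eventually (f := fun y => h (t, y)) ?_ hda w w'
    have : ∀ᶠ y in 𝓝 u, (t, y) ∈ 𝒲 :=
      (Continuous.prodMk_right t).continuousAt.eventually_mem (h𝒲.mem_nhds hz)
    filter_upwards [this] with y hy
    exact hasFDerivAt_partialSnd_of_differentiableAt
      ((hh.contDiffAt (h𝒲.mem_nhds hy)).differentiableAt hn)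
  have hSd : HasFDerivAt S (fderiv ℝ S u) u :=
    ((hS.contDiffOn.contDiffAt (hΩ.mem_nhds hu)).differentiableAt hn).hasFDerivAt
  have hX : ∀ w, partialSnd (hamField S h) (t, u) w =
      fderiv ℝ S u w (α (t, u)) + S u (partialSnd α (t, u) w) := by
    intro w
    have h1 : HasFDerivAt (fun y => hamField S h (t, y)) (partialSnd (hamField S h) (t, u)) u :=
      hasFDerivAt_partialSnd_of_differentiableAt
        (((contDiffOn_hamField hS.contDiffOn h𝒲 h𝒲Ω hh).contDiffAt
          (h𝒲.mem_nhds hz)).differentiableAt hn)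
    have h2 := hSd.clm_apply hda
    rw [h1.unique h2]
    simp [add_comm]
  have hDanti : ∀ w (l m : E →L[ℝ] ℝ), l (fderiv ℝ S u w m) = -m (fderiv ℝ S u w l) := by
    intro w l m
    have h1 : HasFDerivAt (fun y => l (S y m) + m (S y l)) _ u :=
      (l.hasFDerivAt.comp u (hSd.clm_apply (hasFDerivAt_const m u))).add
        (m.hasFDerivAt.comp u (hSd.clm_apply (hasFDerivAt_const l u)))
    have h2 : (fun y => l (S y m) + m (S y l)) =ᶠ[𝓝 u] fun _ => 0 := by
      filter_upwards [hΩ.mem_nhds hu] with y hy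
      rw [hS.anti y hy l m]
      ring
    have h3 := h1.unique ((hasFDerivAt_const (0 : ℝ) u).congr_of_eventuallyEq h2)
    have h4 := congrArg (fun T : E →L[ℝ] ℝ => T w) h3
    simp at h4
    linarith
  have hsep : ∀ x y : E, (∀ n : E →L[ℝ] ℝ, n x = n y) → x = y := fun x y hxy => by
    by_contra hne
    obtain ⟨f, hf⟩ := SeparatingDual.exists_separating_of_ne (R := ℝ) hne
    exact hf (hxy f)
  refine hsep _ _ fun n => ?_
  -- Tested against `n`, the claim is the Jacobi identity for the differential of `h`, `m` and `n`,
  -- up to two terms with the Hessian of `h` that cancel by its symmetry.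
  have hj := hS.jacobi u hu (α (t, u)) m n
  rw [map_add, hX, map_add, hS.anti u hu n (m ∘L _)]
  change n (fderiv ℝ S u (S u (α (t, u))) m) = _ + -(m (partialSnd (hamField S h) (t, u) (S u n)))
  rw [hX, map_add, hS.anti u hu n, hS.anti u hu m, hsymm (S u m) (S u n)]
  rw [hDanti (S u m) (α (t, u)) n] at hj
  linarith

variable [FiniteDimensional ℝ E]

/-- Uniqueness for the linear differential equation `y' = X y + y Y`. -/
theorem eqOn_of_comp_add_comp {G : Type*} [NormedAddCommGroup G] [NormedSpace ℝ G]
    {X : ℝ → E →L[ℝ] E} (hX : ContinuousOn X (Icc 0 1)) {Y : ℝ → G →L[ℝ] G}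
    (hY : ContinuousOn Y (Icc 0 1)) {y z : ℝ → G →L[ℝ] E}
    (hy : ∀ t ∈ Icc (0 : ℝ) 1, HasDerivWithinAt y (X t ∘L y t + y t ∘L Y t) (Icc 0 1) t)
    (hz : ∀ t ∈ Icc (0 : ℝ) 1, HasDerivWithinAt z (X t ∘L z t + z t ∘L Y t) (Icc 0 1) t)
    (h0 : y 0 = z 0) : EqOn y z (Icc 0 1) := by
  obtain ⟨K₁, hK₁⟩ := (isCompact_Icc.image_of_continuousOn hX).isBounded.exists_norm_le
  obtain ⟨K₂, hK₂⟩ := (isCompact_Icc.image_of_continuousOn hY).isBounded.exists_norm_le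
  refine eqOn_of_hasDerivWithinAt (v := fun t x => X t ∘L x + x ∘L Y t)
    (K := (K₁ + K₂).toNNReal) (s := fun _ => univ) (fun t ht => ?_) hy (fun _ _ => mem_univ _) hz
    (fun _ _ => mem_univ _) h0
  refine LipschitzWith.lipschitzOnWith (LipschitzWith.of_dist_le_mul fun x x' => ?_)
  have h1 := hK₁ _ (mem_image_of_mem _ ht)
  have h2 := hK₂ _ (mem_image_of_mem _ ht)
  rw [dist_eq_norm, dist_eq_norm]
  have h3 : X t ∘L x + x ∘L Y t - (X t ∘L x' + x' ∘L Y t) =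
      X t ∘L (x - x') + (x - x') ∘L Y t := by
    simp only [ContinuousLinearMap.comp_sub, ContinuousLinearMap.sub_comp]
    abel
  rw [h3]
  calc _ ≤ ‖X t‖ * ‖x - x'‖ + ‖x - x'‖ * ‖Y t‖ :=
        (norm_add_le _ _).trans (add_le_add (ContinuousLinearMap.opNorm_comp_le _ _)
          (ContinuousLinearMap.opNorm_comp_le _ _))
    _ ≤ K₁ * ‖x - x'‖ + ‖x - x'‖ * K₂ := by gcongr
    _ = (K₁ + K₂) * ‖x - x'‖ := by ring
    _ ≤ ((K₁ + K₂).toNNReal : ℝ) * ‖x - x'‖ := by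
        gcongr
        exact Real.le_coe_toNNReal _

/-- The transpose of a linear map. -/
def transpose (T : E →L[ℝ] E) : (E →L[ℝ] ℝ) →L[ℝ] (E →L[ℝ] ℝ) :=
  (ContinuousLinearMap.compL ℝ E E ℝ).flip T

theorem transpose_apply (T : E →L[ℝ] E) (m : E →L[ℝ] ℝ) : transpose T m = m ∘L T := rfl

theorem continuous_transpose : Continuous (transpose (E := E)) :=
  (ContinuousLinearMap.compL ℝ E E ℝ).flip.continuous

theorem hasDerivWithinAt_transpose {J : ℝ → E →L[ℝ] E} {J' : E →L[ℝ] E} {s : Set ℝ} {t : ℝ}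
    (h : HasDerivWithinAt J J' s t) :
    HasDerivWithinAt (fun t => transpose (J t)) (transpose J') s t := by
  refine hasDerivWithinAt_clm fun m => hasDerivWithinAt_clm fun w => ?_
  exact m.hasFDerivAt.comp_hasDerivWithinAt t (h.clm_apply (hasDerivWithinAt_const t s w))
    |>.congr_deriv (by simp [transpose_apply])

/-- The flow of a time-dependent Hamiltonian vector field preserves the Poisson bivector. -/
theorem IsPoissonOn.flow_invariant (hS : IsPoissonOn S Ω) (hΩ : IsOpen Ω) (h𝒲 : IsOpen 𝒲)
    (h𝒲Ω : ∀ z ∈ 𝒲, z.2 ∈ Ω) (hh : ContDiffOn ℝ ∞ h 𝒲) {γ : ℝ → E}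
    (hγ : ∀ t ∈ Icc (0 : ℝ) 1, (t, γ t) ∈ 𝒲 ∧
      HasDerivWithinAt γ (hamField S h (t, γ t)) (Icc 0 1) t)
    {J : ℝ → E →L[ℝ] E} (hJ0 : J 0 = 1)
    (hJ : ∀ w, ∀ t ∈ Icc (0 : ℝ) 1, HasDerivWithinAt (fun t => J t w)
      (partialSnd (hamField S h) (t, γ t) (J t w)) (Icc 0 1) t)
    {t : ℝ} (ht : t ∈ Icc (0 : ℝ) 1) (m : E →L[ℝ] ℝ) :
    J t (S (γ 0) (m ∘L J t)) = S (γ t) m := by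
  have hn : (∞ : WithTop ℕ∞) ≠ 0 := by simp
  let X : ℝ → E →L[ℝ] E := fun t => partialSnd (hamField S h) (t, γ t)
  have hγc : ContinuousOn γ (Icc 0 1) := fun t ht => (hγ t ht).2.continuousWithinAt
  have hXc : ContinuousOn X (Icc 0 1) :=
    (contDiffOn_partialSnd h𝒲 (contDiffOn_hamField hS.contDiffOn h𝒲 h𝒲Ω hh)).continuousOn.comp
      (continuousOn_id.prodMk hγc) (fun t ht => (hγ t ht).1)
  have hJd : ∀ t ∈ Icc (0 : ℝ) 1, HasDerivWithinAt J (X t ∘L J t) (Icc 0 1) t := fun t ht =>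
    hasDerivWithinAt_clm fun w => hJ w t ht
  -- The transported bivector and the bivector along the curve solve the same linear equation `y' =
  -- X y + y Xᵀ` with the same initial value. For the second this is the vanishing of the Lie
  -- derivative.
  have h0 : EqOn (fun t => J t ∘L S (γ 0) ∘L transpose (J t)) (fun t => S (γ t)) (Icc 0 1) := by
    refine eqOn_of_comp_add_comp hXc (Y := fun t => transpose (X t))
      (continuous_transpose.comp_continuousOn hXc) (fun t ht => ?_) (fun t ht => ?_) ?_
    · refine hasDerivWithinAt_clm fun l => ?_
      have h1 := hasDerivWithinAt_transpose (hJd t ht)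
      have h2 := (S (γ 0)).hasFDerivAt.comp_hasDerivWithinAt t
        (h1.clm_apply (hasDerivWithinAt_const t (Icc 0 1) l))
      refine ((hJd t ht).clm_apply h2).congr_deriv ?_
      simp [transpose_apply, ContinuousLinearMap.comp_assoc]
    · have hu : γ t ∈ Ω := h𝒲Ω _ (hγ t ht).1
      have hSd : HasFDerivAt S (fderiv ℝ S (γ t)) (γ t) :=
        ((hS.contDiffOn.contDiffAt (hΩ.mem_nhds hu)).differentiableAt hn).hasFDerivAt
      refine (HasFDerivAt.comp_hasDerivWithinAt (F := E) (E := (E →L[ℝ] ℝ) →L[ℝ] E) t hSd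
        (hγ t ht).2).congr_deriv ?_
      ext1 l
      exact hS.fderiv_hamField hΩ h𝒲 h𝒲Ω hh (hγ t ht).1 l
    · ext l
      change J 0 (S (γ 0) (l ∘L J 0)) = S (γ 0) l
      rw [hJ0]
      rfl
  exact congrArg (fun T : (E →L[ℝ] ℝ) →L[ℝ] E => T m) (h0 ht)

end ChartPoisson

/-! ### Differentials as maps between the model spaces -/

section Md

variable {E' H' M' : Type*} [NormedAddCommGroup E'] [NormedSpace ℝ E'] [TopologicalSpace H']
  [TopologicalSpace M'] [ChartedSpace H' M']
  {E H M : Type*} [NormedAddCommGroup E] [NormedSpace ℝ E] [TopologicalSpace H]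
  [TopologicalSpace M] [ChartedSpace H M]

/-- The differential of `f`, as a linear map between the model vector spaces. -/
def md (I : ModelWithCorners ℝ E H) (I' : ModelWithCorners ℝ E' H') (f : M → M') (x : M) :
    E →L[ℝ] E' := mfderiv I I' f x

variable {E'' H'' M'' : Type*} [NormedAddCommGroup E''] [NormedSpace ℝ E''] [TopologicalSpace H'']
  [TopologicalSpace M''] [ChartedSpace H'' M''] {I : ModelWithCorners ℝ E H}
  {I' : ModelWithCorners ℝ E' H'} {I'' : ModelWithCorners ℝ E'' H''}

theorem md_comp {g : M' → M''} {f : M → M'} {x : M} (hg : MDifferentiableAt I' I'' g (f x))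
    (hf : MDifferentiableAt I I' f x) (v : E) :
    md I I'' (g ∘ f) x v = md I' I'' g (f x) (md I I' f x v) :=
  congrArg (fun T : E →L[ℝ] E'' => T v) (mfderiv_comp x hg hf)

theorem md_congr {f g : M → M'} {x : M} (h : f =ᶠ[𝓝 x] g) : md I I' f x = md I I' g x :=
  h.mfderiv_eq

theorem md_id (x : M) (v : E) : md I I (id : M → M) x v = v :=
  congrArg (fun T : E →L[ℝ] E => T v) mfderiv_id

theorem md_eq_fderiv {f : E → E'} {x : E} : md 𝓘(ℝ, E) 𝓘(ℝ, E') f x = fderiv ℝ f x :=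
  mfderiv_eq_fderiv

theorem md_leftInverse {f : M → M'} {g : M' → M} {x : M} (hg : MDifferentiableAt I' I g (f x))
    (hf : MDifferentiableAt I I' f x) (h : ∀ᶠ y in 𝓝 x, g (f y) = y) (v : E) :
    md I' I g (f x) (md I I' f x v) = v := by
  rw [← md_comp hg hf, md_congr (f := g ∘ f) (g := id) h, md_id]

end Md

/-! ### The sharp map of a Poisson manifold in a chart -/

section ChartSharp

variable {E P : Type*} [NormedAddCommGroup E] [NormedSpace ℝ E]
  [TopologicalSpace P] [ChartedSpace E P]

/-- The differential of the chart at `z`. -/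
def chartD (z p : P) : E →L[ℝ] E := md 𝓘(ℝ, E) 𝓘(ℝ, E) (extChartAt 𝓘(ℝ, E) z) p

/-- The differential of the inverse of the chart at `z`. -/
def chartDsymm (z : P) (u : E) : E →L[ℝ] E :=
  md 𝓘(ℝ, E) 𝓘(ℝ, E) (extChartAt 𝓘(ℝ, E) z).symm u

variable [IsManifold 𝓘(ℝ, E) ∞ P]

theorem contMDiffAt_chart {z p : P} (hp : p ∈ (extChartAt 𝓘(ℝ, E) z).source) :
    ContMDiffAt 𝓘(ℝ, E) 𝓘(ℝ, E) ∞ (extChartAt 𝓘(ℝ, E) z) p :=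
  contMDiffAt_extChartAt' (by rwa [extChartAt_source] at hp)

theorem contMDiffAt_chart_symm {z : P} {u : E} (hu : u ∈ (extChartAt 𝓘(ℝ, E) z).target) :
    ContMDiffAt 𝓘(ℝ, E) 𝓘(ℝ, E) ∞ (extChartAt 𝓘(ℝ, E) z).symm u :=
  (contMDiffOn_extChartAt_symm z).contMDiffAt ((isOpen_extChartAt_target z).mem_nhds hu)

theorem chartDsymm_chartD {z p : P} (hp : p ∈ (extChartAt 𝓘(ℝ, E) z).source) (v : E) :
    chartDsymm z (extChartAt 𝓘(ℝ, E) z p) (chartD z p v) = v := by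
  have hn : (∞ : WithTop ℕ∞) ≠ 0 := by simp
  refine md_leftInverse ((contMDiffAt_chart_symm
    ((extChartAt 𝓘(ℝ, E) z).map_source hp)).mdifferentiableAt hn)
    ((contMDiffAt_chart hp).mdifferentiableAt hn) ?_ v
  filter_upwards [(isOpen_extChartAt_source (I := 𝓘(ℝ, E)) z).mem_nhds hp] with y hy
  exact (extChartAt 𝓘(ℝ, E) z).left_inv hy

theorem chartD_chartDsymm {z : P} {u : E} (hu : u ∈ (extChartAt 𝓘(ℝ, E) z).target) (v : E) :
    chartD z ((extChartAt 𝓘(ℝ, E) z).symm u) (chartDsymm z u v) = v := by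
  have hn : (∞ : WithTop ℕ∞) ≠ 0 := by simp
  refine md_leftInverse ((contMDiffAt_chart
    ((extChartAt 𝓘(ℝ, E) z).map_target hu)).mdifferentiableAt hn)
    ((contMDiffAt_chart_symm hu).mdifferentiableAt hn) ?_ v
  filter_upwards [(isOpen_extChartAt_target (I := 𝓘(ℝ, E)) z).mem_nhds hu] with y hy
  exact (extChartAt 𝓘(ℝ, E) z).right_inv hy

/-- The differential of a function in a chart. -/
theorem md_eq_fderiv_chart {F : Type*} [NormedAddCommGroup F] [NormedSpace ℝ F] {f : P → F}
    {z p : P} (hp : p ∈ (extChartAt 𝓘(ℝ, E) z).source) (hf : ContMDiffAt 𝓘(ℝ, E) 𝓘(ℝ, F) ∞ f p)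
    (v : E) : md 𝓘(ℝ, E) 𝓘(ℝ, F) f p v =
      fderiv ℝ (f ∘ (extChartAt 𝓘(ℝ, E) z).symm) (extChartAt 𝓘(ℝ, E) z p) (chartD z p v) :=
  mfderiv_eq_fderiv_comp_extChartAt hp hf v

/-- A smooth function near a point coincides near this point with a smooth function. -/
theorem exists_contMDiff_eventuallyEq [FiniteDimensional ℝ E] [T2Space P] {g : P → ℝ} {U : Set P}
    (hU : IsOpen U) (hg : ContMDiffOn 𝓘(ℝ, E) 𝓘(ℝ, ℝ) ∞ g U) {p : P} (hp : p ∈ U) :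
    ∃ f : P → ℝ, ContMDiff 𝓘(ℝ, E) 𝓘(ℝ, ℝ) ∞ f ∧ f =ᶠ[𝓝 p] g := by
  obtain ⟨χ, -, hχ⟩ := (SmoothBumpFunction.nhds_basis_tsupport (I := 𝓘(ℝ, E)) p).mem_iff.1
    (hU.mem_nhds hp)
  refine ⟨fun x => χ x * g x, fun x => ?_, ?_⟩
  · by_cases hx : x ∈ U
    · exact (χ.contMDiff x).mul (hg.contMDiffAt (hU.mem_nhds hx))
    · have hx' : (tsupport χ)ᶜ ∈ 𝓝 x :=
        (isClosed_tsupport χ).isOpen_compl.mem_nhds fun h => hx (hχ h)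
      refine (contMDiffAt_const (c := (0 : ℝ))).congr_of_eventuallyEq ?_
      filter_upwards [hx'] with y hy
      rw [image_eq_zero_of_notMem_tsupport hy, zero_mul]
  · filter_upwards [χ.eventuallyEq_one] with y hy
    rw [hy]
    exact one_mul _

variable [FiniteDimensional ℝ E]

/-- A field of bilinear forms on the cotangent spaces, as a family of bilinear forms on the dual of
the model space. -/
def bil (B : BilinField E P) (p : P) : LinearMap.BilinForm ℝ (Module.Dual ℝ E) := B p

/-- The covector at `p` with the coordinates `m` in the chart at `z`. -/
def covec (z p : P) : (E →L[ℝ] ℝ) →ₗ[ℝ] Module.Dual ℝ E where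
  toFun m := (m ∘L chartD z p).toLinearMap
  map_add' _ _ := rfl
  map_smul' _ _ := rfl

theorem covec_apply (z p : P) (m : E →L[ℝ] ℝ) (v : E) : covec z p m v = m (chartD z p v) := rfl

/-- The contraction with a bivector field, in the chart at `z`. -/
def chartSharp (B : BilinField E P) (z : P) (u : E) : (E →L[ℝ] ℝ) →L[ℝ] E :=
  LinearMap.toContinuousLinearMap
    ((chartD z ((extChartAt 𝓘(ℝ, E) z).symm u)).toLinearMap ∘ₗ
      sharp (bil B ((extChartAt 𝓘(ℝ, E) z).symm u)) ∘ₗ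
        covec z ((extChartAt 𝓘(ℝ, E) z).symm u))

theorem chartSharp_chart (B : BilinField E P) {z p : P}
    (hp : p ∈ (extChartAt 𝓘(ℝ, E) z).source) (m : E →L[ℝ] ℝ) :
    chartSharp B z (extChartAt 𝓘(ℝ, E) z p) m = chartD z p (sharp (bil B p) (covec z p m)) := by
  change chartD z ((extChartAt 𝓘(ℝ, E) z).symm (extChartAt 𝓘(ℝ, E) z p)) (sharp (bil B
    ((extChartAt 𝓘(ℝ, E) z).symm (extChartAt 𝓘(ℝ, E) z p))) (covec z
      ((extChartAt 𝓘(ℝ, E) z).symm (extChartAt 𝓘(ℝ, E) z p)) m)) = _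
  rw [(extChartAt 𝓘(ℝ, E) z).left_inv hp]

theorem apply_chartSharp (B : BilinField E P) {z p : P}
    (hp : p ∈ (extChartAt 𝓘(ℝ, E) z).source) (l m : E →L[ℝ] ℝ) :
    l (chartSharp B z (extChartAt 𝓘(ℝ, E) z p) m) = bil B p (covec z p m) (covec z p l) := by
  rw [chartSharp_chart B hp, ← apply_sharp (bil B p) (covec z p m) (covec z p l), covec_apply]

theorem covec_surjective {z p : P} (hp : p ∈ (extChartAt 𝓘(ℝ, E) z).source)
    (ξ : Module.Dual ℝ E) : ∃ m, ξ = covec z p m := by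
  let ξ' : E →L[ℝ] ℝ := LinearMap.toContinuousLinearMap ξ
  refine ⟨ξ' ∘L chartDsymm z (extChartAt 𝓘(ℝ, E) z p), ?_⟩
  refine LinearMap.ext fun v => ?_
  exact congrArg ξ' (chartDsymm_chartD hp v).symm

theorem differential_eq_covec {f : P → ℝ} {z p : P} (hp : p ∈ (extChartAt 𝓘(ℝ, E) z).source)
    (hf : ContMDiffAt 𝓘(ℝ, E) 𝓘(ℝ, ℝ) ∞ f p) :
    differential f p = covec z p
      (fderiv ℝ (f ∘ (extChartAt 𝓘(ℝ, E) z).symm) (extChartAt 𝓘(ℝ, E) z p)) :=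
  LinearMap.ext fun v => md_eq_fderiv_chart hp hf v

variable [T2Space P]

/-- The axioms of `IsPoisson` test only functions that are smooth on all of `P`; a bump function
supplies such a function with the germ of a given coordinate. -/
theorem exists_coordinate_function {z p : P} (hp : p ∈ (extChartAt 𝓘(ℝ, E) z).source)
    (l : E →L[ℝ] ℝ) : ∃ f : P → ℝ, ContMDiff 𝓘(ℝ, E) 𝓘(ℝ, ℝ) ∞ f ∧
      f =ᶠ[𝓝 p] l ∘ extChartAt 𝓘(ℝ, E) z :=
  exists_contMDiff_eventuallyEq (isOpen_extChartAt_source (I := 𝓘(ℝ, E)) z)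
    (l.contDiff.contMDiff.comp_contMDiffOn fun _ hx => (contMDiffAt_chart hx).contMDiffWithinAt) hp

theorem differential_coordinate {z p : P} (hp : p ∈ (extChartAt 𝓘(ℝ, E) z).source)
    {l : E →L[ℝ] ℝ} {f : P → ℝ} (hf : f =ᶠ[𝓝 p] l ∘ extChartAt 𝓘(ℝ, E) z) :
    differential f p = covec z p l := by
  have hn : (∞ : WithTop ℕ∞) ≠ 0 := by simp
  refine LinearMap.ext fun (v : E) => ?_
  change md 𝓘(ℝ, E) 𝓘(ℝ, ℝ) f p v = l (chartD z p v)
  rw [md_congr hf, md_comp (I' := 𝓘(ℝ, E)) l.mdifferentiableAt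
    ((contMDiffAt_chart hp).mdifferentiableAt hn), md_eq_fderiv, l.fderiv]
  rfl

theorem bracket_coordinate (B : BilinField E P) {z p : P}
    (hp : p ∈ (extChartAt 𝓘(ℝ, E) z).source) {l m : E →L[ℝ] ℝ} {f g : P → ℝ}
    (hf : f =ᶠ[𝓝 p] m ∘ extChartAt 𝓘(ℝ, E) z) (hg : g =ᶠ[𝓝 p] l ∘ extChartAt 𝓘(ℝ, E) z) :
    bracket B f g =ᶠ[𝓝 p] fun y => l (chartSharp B z (extChartAt 𝓘(ℝ, E) z y) m) := by
  filter_upwards [(isOpen_extChartAt_source (I := 𝓘(ℝ, E)) z).mem_nhds hp, hf.eventuallyEq_nhds,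
    hg.eventuallyEq_nhds] with y hy hfy hgy
  rw [apply_chartSharp B hy, ← differential_coordinate hy hfy, ← differential_coordinate hy hgy]
  rfl

/-- Brackets of coordinate functions are the matrix entries of the contraction in the chart, so
smoothness and the Jacobi identity of the bracket become those of the matrix. -/
theorem isPoissonOn_chartSharp {B : BilinField E P} (hB : IsPoisson B) (z : P) :
    IsPoissonOn (chartSharp B z) (extChartAt 𝓘(ℝ, E) z).target := by
  have hn : (∞ : WithTop ℕ∞) ≠ 0 := by simp
  set κ := extChartAt 𝓘(ℝ, E) z with hκ
  have hpu : ∀ u ∈ κ.target, κ.symm u ∈ κ.source := fun u hu => κ.map_target hu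
  have hcomp : ∀ u ∈ κ.target, ∀ l m : E →L[ℝ] ℝ, ∀ f g : P → ℝ,
      f =ᶠ[𝓝 (κ.symm u)] m ∘ κ → g =ᶠ[𝓝 (κ.symm u)] l ∘ κ →
      bracket B f g ∘ κ.symm =ᶠ[𝓝 u] fun y => l (chartSharp B z y m) := by
    intro u hu l m f g hf hg
    have h1 := (contMDiffAt_chart_symm hu).continuousAt.eventually
      (bracket_coordinate B (hpu u hu) hf hg)
    filter_upwards [h1, (isOpen_extChartAt_target (I := 𝓘(ℝ, E)) z).mem_nhds hu] with y hy hyt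
    rw [Function.comp_apply, hy, ← hκ, κ.right_inv hyt]
  have hsmooth : ContDiffOn ℝ ∞ (chartSharp B z) κ.target := by
    rw [contDiffOn_clm_apply]
    intro m
    let b := (Module.finBasis ℝ E).equivFunL
    have h1 : ContDiffOn ℝ ∞ (fun u => b (chartSharp B z u m)) κ.target := by
      rw [contDiffOn_pi]
      intro k
      let l : E →L[ℝ] ℝ := ContinuousLinearMap.proj k ∘L (b : E →L[ℝ] Fin (Module.finrank ℝ E) → ℝ)
      change ContDiffOn ℝ ∞ (fun u => l (chartSharp B z u m)) κ.target
      intro u hu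
      obtain ⟨f, hf, hfm⟩ := exists_coordinate_function (hpu u hu) m
      obtain ⟨g, hg, hgl⟩ := exists_coordinate_function (hpu u hu) l
      have h2 : ContMDiffAt 𝓘(ℝ, E) 𝓘(ℝ, ℝ) ∞ (bracket B f g ∘ κ.symm) u :=
        (hB.smooth f g hf hg _).comp u (contMDiffAt_chart_symm hu)
      exact (h2.contDiffAt.congr_of_eventuallyEq
        (hcomp u hu l m f g hfm hgl).symm).contDiffWithinAt
    have h3 := b.symm.contDiff.comp_contDiffOn h1
    refine h3.congr fun u _ => ?_
    exact (b.symm_apply_apply _).symm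
  have hanti : ∀ u ∈ κ.target, ∀ l m : E →L[ℝ] ℝ,
      l (chartSharp B z u m) = -m (chartSharp B z u l) := by
    intro u hu l m
    rw [← κ.right_inv hu, apply_chartSharp B (hpu u hu), apply_chartSharp B (hpu u hu),
      ← apply_sharp, ← apply_sharp]
    exact apply_sharp_comm (hB.alt _) _ _
  refine ⟨hsmooth, hanti, fun u hu l m n => ?_⟩
  obtain ⟨f, hf, hfl⟩ := exists_coordinate_function (hpu u hu) l
  obtain ⟨g, hg, hgm⟩ := exists_coordinate_function (hpu u hu) m
  obtain ⟨h, hh, hhn⟩ := exists_coordinate_function (hpu u hu) n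
  -- A double bracket of coordinates is the derivative of a matrix entry along a coordinate
  -- Hamiltonian field. No other terms occur, as the differentials of the coordinates are constant
  -- in the chart.
  have key : ∀ l m n : E →L[ℝ] ℝ, ∀ f g h : P → ℝ, ContMDiff 𝓘(ℝ, E) 𝓘(ℝ, ℝ) ∞ g →
      ContMDiff 𝓘(ℝ, E) 𝓘(ℝ, ℝ) ∞ h → f =ᶠ[𝓝 (κ.symm u)] l ∘ κ → g =ᶠ[𝓝 (κ.symm u)] m ∘ κ →
      h =ᶠ[𝓝 (κ.symm u)] n ∘ κ → bracket B f (bracket B g h) (κ.symm u) =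
        n (fderiv ℝ (chartSharp B z) u (chartSharp B z u l) m) := by
    intro l m n f g h hg hh hfl hgm hhn
    have h1 : differential (bracket B g h) (κ.symm u) = covec z (κ.symm u)
        (fderiv ℝ (fun y => n (chartSharp B z y m)) u) := by
      rw [differential_eq_covec (hpu u hu) (hB.smooth g h hg hh _), ← hκ, κ.right_inv hu,
        (hcomp u hu n m g h hgm hhn).fderiv_eq]
    have h0 : bracket B f (bracket B g h) (κ.symm u) = bil B (κ.symm u)
        (covec z (κ.symm u) l) (covec z (κ.symm u) (fderiv ℝ (fun y => n (chartSharp B z y m)) u)) := by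
      rw [← h1, ← differential_coordinate (hpu u hu) hfl]
      rfl
    rw [h0, ← apply_chartSharp B (hpu u hu), ← hκ, κ.right_inv hu]
    have hSd : HasFDerivAt (chartSharp B z) (fderiv ℝ (chartSharp B z) u) u :=
      ((hsmooth.contDiffAt ((isOpen_extChartAt_target z).mem_nhds hu)).differentiableAt
        hn).hasFDerivAt
    have h2 : HasFDerivAt (fun y => n (chartSharp B z y m)) _ u :=
      n.hasFDerivAt.comp u (hSd.clm_apply (hasFDerivAt_const m u))
    rw [h2.fderiv]
    simp
  have hj := hB.jacobi f g h hf hg hh (κ.symm u)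
  rwa [key l m n f g h hg hh hfl hgm hhn, key m n l g h f hh hf hgm hhn hfl,
    key n l m h f g hf hg hhn hfl hgm] at hj

end ChartSharp

/-! ### Hamiltonian flows near a rest point -/

section HamiltonianFlow

open unitInterval

variable {E P : Type*} [NormedAddCommGroup E] [NormedSpace ℝ E]
  [TopologicalSpace P] [ChartedSpace E P] [IsManifold 𝓘(ℝ, E) ∞ P]

/-- `γ` has at the time `t` the velocity `X`. -/
def HasVelocity (γ : ℝ → P) (t : ℝ) (X : E) : Prop :=
  HasMFDerivWithinAt 𝓘(ℝ, ℝ) 𝓘(ℝ, E) γ (Icc 0 1) t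
    ((1 : ℝ →L[ℝ] ℝ).smulRight (X : TangentSpace 𝓘(ℝ, E) (γ t)))

theorem HasVelocity.chart {γ : ℝ → P} {t : ℝ} {X : E} (h : HasVelocity γ t X) {z : P}
    (hz : γ t ∈ (extChartAt 𝓘(ℝ, E) z).source) :
    HasDerivWithinAt (fun s => extChartAt 𝓘(ℝ, E) z (γ s)) (chartD z (γ t) X) (Icc 0 1) t := by
  have hn : (∞ : WithTop ℕ∞) ≠ 0 := by simp
  have h1 := ((contMDiffAt_chart hz).mdifferentiableAt hn).hasMFDerivAt.comp_hasMFDerivWithinAt t h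
  have h2 : HasFDerivWithinAt (fun s => extChartAt 𝓘(ℝ, E) z (γ s))
      (chartD z (γ t) ∘L (1 : ℝ →L[ℝ] ℝ).smulRight X) (Icc 0 1) t := h1.hasFDerivWithinAt
  refine h2.hasDerivWithinAt.congr_deriv ?_
  exact congrArg (chartD z (γ t)) (one_smul ℝ X)

theorem hasVelocity_chart_symm {u : ℝ → E} {t : ℝ} {w : E}
    (h : HasDerivWithinAt u w (Icc 0 1) t) {z : P} (hz : u t ∈ (extChartAt 𝓘(ℝ, E) z).target) :
    HasVelocity (fun s => (extChartAt 𝓘(ℝ, E) z).symm (u s)) t (chartDsymm z (u t) w) := by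
  have hn : (∞ : WithTop ℕ∞) ≠ 0 := by simp
  have h1 := ((contMDiffAt_chart_symm hz).mdifferentiableAt hn).hasMFDerivAt.comp_hasMFDerivWithinAt
    t h.hasFDerivWithinAt.hasMFDerivWithinAt
  refine HasMFDerivWithinAt.congr_mfderiv h1 ?_
  ext
  exact congrArg (chartDsymm z (u t)) (one_smul ℝ w) |>.trans
    (one_smul ℝ (chartDsymm z (u t) w)).symm

theorem HasVelocity.congr {γ δ : ℝ → P} {t : ℝ} {X : E} (h : HasVelocity γ t X)
    (ht : t ∈ Icc (0 : ℝ) 1) (hδ : ∀ s ∈ Icc (0 : ℝ) 1, δ s = γ s) : HasVelocity δ t X := by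
  have h' : HasMFDerivWithinAt 𝓘(ℝ, ℝ) 𝓘(ℝ, E) γ (Icc 0 1) t
    ((1 : ℝ →L[ℝ] ℝ).smulRight (X : TangentSpace 𝓘(ℝ, E) (γ t))) := h
  exact h'.congr_mono hδ (hδ t ht) subset_rfl

theorem contDiffOn_chart_family {F : Type*} [NormedAddCommGroup F] [NormedSpace ℝ F]
    {f : ℝ × P → F} {𝒰 : Set (ℝ × P)} (h𝒰 : IsOpen 𝒰)
    (hf : ContMDiffOn (𝓘(ℝ, ℝ).prod 𝓘(ℝ, E)) 𝓘(ℝ, F) ∞ f 𝒰) (z : P) :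
    IsOpen {y : ℝ × E | y.2 ∈ (extChartAt 𝓘(ℝ, E) z).target ∧
      (y.1, (extChartAt 𝓘(ℝ, E) z).symm y.2) ∈ 𝒰} ∧
    ContDiffOn ℝ ∞ (fun y => f (y.1, (extChartAt 𝓘(ℝ, E) z).symm y.2))
      {y : ℝ × E | y.2 ∈ (extChartAt 𝓘(ℝ, E) z).target ∧
        (y.1, (extChartAt 𝓘(ℝ, E) z).symm y.2) ∈ 𝒰} := by
  have h1 : ContMDiffOn 𝓘(ℝ, ℝ × E) (𝓘(ℝ, ℝ).prod 𝓘(ℝ, E)) ∞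
      (fun y : ℝ × E => (y.1, (extChartAt 𝓘(ℝ, E) z).symm y.2))
      (Prod.snd ⁻¹' (extChartAt 𝓘(ℝ, E) z).target) :=
    contDiff_fst.contMDiff.contMDiffOn.prodMk
      ((contMDiffOn_extChartAt_symm z).comp contDiff_snd.contMDiff.contMDiffOn (fun _ h => h))
  refine ⟨h1.continuousOn.isOpen_inter_preimage
    ((isOpen_extChartAt_target z).preimage continuous_snd) h𝒰, ?_⟩
  exact (hf.comp (h1.mono fun _ h => h.1) (fun _ h => h.2)).contDiffOn

variable [FiniteDimensional ℝ E]

/-- The Hamiltonian vector field, with values in the model space. -/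
def hamVector (B : BilinField E P) (f : P → ℝ) (p : P) : E := hamiltonianVectorField B f p

theorem chartD_hamVector (B : BilinField E P) {f : ℝ × P → ℝ} {𝒰 : Set (ℝ × P)}
    (h𝒰 : IsOpen 𝒰) (hf : ContMDiffOn (𝓘(ℝ, ℝ).prod 𝓘(ℝ, E)) 𝓘(ℝ, ℝ) ∞ f 𝒰) {z p : P} {t : ℝ}
    (hp : p ∈ (extChartAt 𝓘(ℝ, E) z).source) (htp : (t, p) ∈ 𝒰) :
    chartD z p (hamVector B (fun p => f (t, p)) p) =
      hamField (chartSharp B z) (fun y => f (y.1, (extChartAt 𝓘(ℝ, E) z).symm y.2))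
        (t, extChartAt 𝓘(ℝ, E) z p) := by
  have hn : (∞ : WithTop ℕ∞) ≠ 0 := by simp
  obtain ⟨ho, hc⟩ := contDiffOn_chart_family h𝒰 hf z
  have hmem : (t, extChartAt 𝓘(ℝ, E) z p) ∈ {y : ℝ × E | y.2 ∈ (extChartAt 𝓘(ℝ, E) z).target ∧
      (y.1, (extChartAt 𝓘(ℝ, E) z).symm y.2) ∈ 𝒰} :=
    ⟨(extChartAt 𝓘(ℝ, E) z).map_source hp, by rwa [(extChartAt 𝓘(ℝ, E) z).left_inv hp]⟩
  have h1 := hasFDerivAt_partialSnd_of_differentiableAt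
    ((hc.contDiffAt (ho.mem_nhds hmem)).differentiableAt hn)
  have h2 : ContMDiffAt 𝓘(ℝ, E) 𝓘(ℝ, ℝ) ∞ (fun p => f (t, p)) p :=
    ContMDiffAt.comp p (hf.contMDiffAt (h𝒰.mem_nhds htp))
      (contMDiffAt_const.prodMk contMDiffAt_id)
  rw [hamField, chartSharp_chart B hp, ← h1.fderiv]
  have h3 := differential_eq_covec hp h2
  exact congrArg (fun ξ => chartD z p (sharp (bil B p) ξ)) h3

/-- Near a common critical point of a time-dependent Hamiltonian, the time-one map of the flow of
the Hamiltonian vector field is a Poisson map. -/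
theorem exists_hamiltonian_flow [T2Space P] {B : BilinField E P} (hB : IsPoisson B)
    {f : ℝ × P → ℝ} {𝒰 : Set (ℝ × P)} (h𝒰 : IsOpen 𝒰)
    (hf : ContMDiffOn (𝓘(ℝ, ℝ).prod 𝓘(ℝ, E)) 𝓘(ℝ, ℝ) ∞ f 𝒰) {z : P}
    (hz : ∀ t ∈ Icc (0 : ℝ) 1, (t, z) ∈ 𝒰)
    (hcrit : ∀ t ∈ Icc (0 : ℝ) 1, hamVector B (fun p => f (t, p)) z = 0) :
    ∃ (N : Set P) (Ψ : P → P), IsOpen N ∧ z ∈ N ∧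
      (∀ p ∈ N, MDifferentiableAt 𝓘(ℝ, E) 𝓘(ℝ, E) Ψ p ∧
        Function.Bijective (md 𝓘(ℝ, E) 𝓘(ℝ, E) Ψ p) ∧
        ∀ ξ η : Module.Dual ℝ E, bil B (Ψ p) ξ η =
          bil B p (ξ ∘ₗ (md 𝓘(ℝ, E) 𝓘(ℝ, E) Ψ p).toLinearMap)
            (η ∘ₗ (md 𝓘(ℝ, E) 𝓘(ℝ, E) Ψ p).toLinearMap)) ∧
      ∀ γ : ℝ → P, (∀ t ∈ Icc (0 : ℝ) 1, γ t ∈ N ∧ (t, γ t) ∈ 𝒰 ∧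
        HasVelocity γ t (hamVector B (fun p => f (t, p)) (γ t))) →
        γ 1 = Ψ (γ 0) := by
  have hn : (∞ : WithTop ℕ∞) ≠ 0 := by simp
  set κ := extChartAt 𝓘(ℝ, E) z with hκ
  obtain ⟨ho, hc⟩ := contDiffOn_chart_family h𝒰 hf z
  set 𝒲 : Set (ℝ × E) := {y : ℝ × E | y.2 ∈ κ.target ∧ (y.1, κ.symm y.2) ∈ 𝒰}
  set h : ℝ × E → ℝ := fun y => f (y.1, κ.symm y.2)
  set S := chartSharp B z
  have hS : IsPoissonOn S κ.target := isPoissonOn_chartSharp hB z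
  have hΩ : IsOpen κ.target := isOpen_extChartAt_target z
  have hzs : z ∈ κ.source := mem_extChartAt_source z
  have h𝒲Ω : ∀ y ∈ 𝒲, y.2 ∈ κ.target := fun y hy => hy.1
  obtain ⟨A, B', Γ, hA, hzA, hB', hzB', hBt, hB𝒲, hΓ, -, hΓA, huniq⟩ := exists_local_flow ho
    (contDiffOn_hamField hS.contDiffOn ho h𝒲Ω hc) (u₀ := κ z)
    (fun t ht => ⟨κ.map_source hzs, by
      change (t, κ.symm (κ z)) ∈ 𝒰
      rw [κ.left_inv hzs]
      exact hz t ht⟩)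
    (fun t ht => by
      rw [← chartD_hamVector B h𝒰 hf hzs (hz t ht), hcrit t ht]
      exact map_zero _)
    (hΩ.mem_nhds (κ.map_source hzs))
  have hκc : ContinuousOn κ κ.source := continuousOn_extChartAt z
  refine ⟨κ.source ∩ κ ⁻¹' (A ∩ B'), fun p => κ.symm (Γ (κ p) 1),
    hκc.isOpen_inter_preimage (isOpen_extChartAt_source z) (hA.inter hB'), ⟨hzs, hzA, hzB'⟩, ?_, ?_⟩
  · rintro p ⟨hp, hpA, -⟩
    obtain ⟨h1, h2, h3, h4, h5⟩ := hΓA (κ p) hpA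
    let ev : I → C(I, E) →L[ℝ] E := fun t => ContinuousMap.evalCLM ℝ t
    -- The derivative of the time-`t` map, with the time clamped to `[0, 1]`.
    let J : ℝ → E →L[ℝ] E := fun t => ev (projIcc 0 1 zero_le_one t) ∘L fderiv ℝ Γ (κ p)
    have hJ1 : ∀ w, J 1 w = fderiv ℝ Γ (κ p) w 1 := fun w => by
      change fderiv ℝ Γ (κ p) w (projIcc 0 1 zero_le_one 1) = _
      rw [projIcc_right]
      rfl
    have hΓ1 : HasFDerivAt (fun u => Γ u 1) (J 1) (κ p) := by
      have h6 : HasFDerivAt Γ (fderiv ℝ Γ (κ p)) (κ p) :=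
        ((hΓ.contDiffAt (hA.mem_nhds hpA)).differentiableAt hn).hasFDerivAt
      have h7 := (ev 1).hasFDerivAt.comp (κ p) h6
      refine h7.congr_fderiv ?_
      ext w
      exact (hJ1 w).symm
    have hu1 : Γ (κ p) 1 ∈ κ.target := hBt (h2 1)
    set u₁ := Γ (κ p) 1
    set Ψ : P → P := fun p => κ.symm (Γ (κ p) 1)
    have hΨs : Ψ p ∈ κ.source := κ.map_target hu1
    have hκΨ : κ (Ψ p) = u₁ := κ.right_inv hu1
    let L : E →L[ℝ] E := chartDsymm z u₁ ∘L J 1 ∘L chartD z p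
    have hΨ : HasMFDerivAt 𝓘(ℝ, E) 𝓘(ℝ, E) Ψ p L := by
      have h8 := hΓ1.hasMFDerivAt.comp p ((contMDiffAt_chart hp).mdifferentiableAt hn).hasMFDerivAt
      exact ((contMDiffAt_chart_symm hu1).mdifferentiableAt hn).hasMFDerivAt.comp p h8
    have hmd : md 𝓘(ℝ, E) 𝓘(ℝ, E) Ψ p = chartDsymm z u₁ ∘L J 1 ∘L chartD z p := hΨ.mfderiv
    have hchart : ∀ v, chartD z (Ψ p) (md 𝓘(ℝ, E) 𝓘(ℝ, E) Ψ p v) = J 1 (chartD z p v) := by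
      intro v
      rw [hmd]
      exact chartD_chartDsymm hu1 _
    have hinj : Function.Injective (md 𝓘(ℝ, E) 𝓘(ℝ, E) Ψ p) := by
      rw [injective_iff_map_eq_zero]
      intro v hv
      have h9 := hchart v
      rw [hv, map_zero, hJ1] at h9
      rw [← chartDsymm_chartD hp v, h5 _ h9.symm, map_zero]
    refine ⟨hΨ.mdifferentiableAt, ⟨hinj, ?_⟩, fun ξ η => ?_⟩
    · exact LinearMap.surjective_of_injective (f := (md 𝓘(ℝ, E) 𝓘(ℝ, E) Ψ p).toLinearMap) hinj
    · obtain ⟨ξ', rfl⟩ := covec_surjective hΨs ξ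
      obtain ⟨η', rfl⟩ := covec_surjective hΨs η
      -- In coordinates, pulling back by `Ψ` is composition with `J 1`, so the claim becomes the
      -- invariance of the bivector at time one.
      have hcov : ∀ m : E →L[ℝ] ℝ, covec z (Ψ p) m ∘ₗ (md 𝓘(ℝ, E) 𝓘(ℝ, E) Ψ p).toLinearMap =
          covec z p (m ∘L J 1) := fun m => LinearMap.ext fun v => congrArg m (hchart v)
      rw [hcov, hcov, ← apply_chartSharp B hp, ← apply_chartSharp B hΨs, ← hκ, hκΨ]
      have h10 := hS.flow_invariant hΩ ho h𝒲Ω hc (γ := extend (Γ (κ p))) (J := J)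
        (fun t ht => ⟨hB𝒲 t ht _ (by rw [extend_of_mem _ ht]; exact h2 _), h3 t ht⟩)
        (by
          ext w
          change fderiv ℝ Γ (κ p) w (projIcc 0 1 zero_le_one 0) = w
          rw [projIcc_left]
          exact (h4 w).1)
        (fun w t ht => (h4 w).2 t ht) (t := 1) (by simp) ξ'
      have e0 : extend (Γ (κ p)) 0 = κ p := by
        rw [extend_of_mem _ (by simp)]
        exact h1
      have e1 : extend (Γ (κ p)) 1 = u₁ := extend_of_mem _ (by simp)
      rw [e0, e1] at h10
      rw [← h10]
      rfl
  · intro γ hγ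
    -- Uniqueness identifies every trajectory that stays in `N` with the curve defining `Ψ`. Thus
    -- trajectories obtained by other means can be compared with a Poisson map.
    have h1 := huniq (fun t => κ (γ t)) (fun t ht => ⟨(hγ t ht).1.2.2, by
      have h2 := (hγ t ht).2.2.chart (hγ t ht).1.1
      rwa [chartD_hamVector B h𝒰 hf (hγ t ht).1.1 (hγ t ht).2.1] at h2⟩)
      (hγ 0 (by simp)).1.2.1 1 (by simp)
    rw [extend_of_mem _ (by simp)] at h1
    have h2 : κ.symm (κ (γ 1)) = γ 1 := κ.left_inv (hγ 1 (by simp)).1.1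
    rw [← h2]
    exact congrArg κ.symm h1

end HamiltonianFlow

/-! ### Flows near a set of rest points -/

section ManifoldFlow

variable {E M : Type*} [NormedAddCommGroup E] [NormedSpace ℝ E] [FiniteDimensional ℝ E]
  [TopologicalSpace M] [ChartedSpace E M] [IsManifold 𝓘(ℝ, E) ∞ M]

/-- The time-dependent vector field `v` in the chart at `z`. -/
def chartField (v : ℝ × M → E) (z : M) (y : ℝ × E) : E :=
  chartD z ((extChartAt 𝓘(ℝ, E) z).symm y.2) (v (y.1, (extChartAt 𝓘(ℝ, E) z).symm y.2))

/-- The part of the set `𝒲` in the chart at `z`. -/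
def chartDomain (𝒲 : Set (ℝ × M)) (z : M) : Set (ℝ × E) :=
  {y : ℝ × E | y.2 ∈ (extChartAt 𝓘(ℝ, E) z).target ∧
    (y.1, (extChartAt 𝓘(ℝ, E) z).symm y.2) ∈ 𝒲}

theorem isOpen_chartDomain {𝒲 : Set (ℝ × M)} (h𝒲 : IsOpen 𝒲) (z : M) :
    IsOpen (chartDomain (E := E) 𝒲 z) :=
  (contDiffOn_chart_family h𝒲 (contMDiffOn_const (c := (0 : ℝ))) z).1

theorem chartField_chart (v : ℝ × M → E) {z p : M} (hp : p ∈ (extChartAt 𝓘(ℝ, E) z).source)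
    (t : ℝ) : chartField v z (t, extChartAt 𝓘(ℝ, E) z p) = chartD z p (v (t, p)) := by
  simp only [chartField]
  rw [(extChartAt 𝓘(ℝ, E) z).left_inv hp]

theorem mk_mem_chartDomain {𝒲 : Set (ℝ × M)} {z p : M}
    (hp : p ∈ (extChartAt 𝓘(ℝ, E) z).source) {t : ℝ} (h : (t, p) ∈ 𝒲) :
    (t, extChartAt 𝓘(ℝ, E) z p) ∈ chartDomain (E := E) 𝒲 z :=
  ⟨(extChartAt 𝓘(ℝ, E) z).map_source hp, by rwa [(extChartAt 𝓘(ℝ, E) z).left_inv hp]⟩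

/-- Near a set of rest points, the flow of a smooth time-dependent vector field exists up to time
one. -/
theorem exists_flow [TopologicalSpace.MetrizableSpace M] {C : Type*} [Nonempty C] {i : C → M}
    {v : ℝ × M → E} {𝒲 : Set (ℝ × M)} (h𝒲 : IsOpen 𝒲)
    (hv : ∀ z, ContDiffOn ℝ ∞ (chartField v z) (chartDomain 𝒲 z))
    (hmem : ∀ c, ∀ t ∈ Icc (0 : ℝ) 1, (t, i c) ∈ 𝒲)
    (h0 : ∀ c, ∀ t ∈ Icc (0 : ℝ) 1, v (t, i c) = 0) :
    ∃ (W : Set M) (g : M → ℝ → M), IsOpen W ∧ (∀ c, i c ∈ W) ∧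
      (∀ x ∈ W, g x 0 = x ∧ ∀ t ∈ Icc (0 : ℝ) 1, (t, g x t) ∈ 𝒲 ∧
        HasVelocity (g x) t (v (t, g x t))) ∧
      ContMDiffOn 𝓘(ℝ, E) 𝓘(ℝ, E) ∞ (fun x => g x 1) W ∧
      (∀ x ∈ W, Function.Injective (md 𝓘(ℝ, E) 𝓘(ℝ, E) (fun x => g x 1) x)) ∧
      (∀ c, ∀ t ∈ Icc (0 : ℝ) 1, g (i c) t = i c) ∧
      ∀ c, ∀ N ∈ 𝓝 (i c), ∀ᶠ x in 𝓝 (i c), ∀ t ∈ Icc (0 : ℝ) 1, g x t ∈ N := by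
  classical
  have hn : (∞ : WithTop ℕ∞) ≠ 0 := by simp
  let _ : MetricSpace M := TopologicalSpace.metrizableSpaceMetric M
  let κ : C → PartialEquiv M E := fun c => extChartAt 𝓘(ℝ, E) (i c)
  have hsrc : ∀ c, i c ∈ (κ c).source := fun c => mem_extChartAt_source (i c)
  have hκc : ∀ c, ContinuousOn (κ c) (κ c).source := fun c => continuousOn_extChartAt (i c)
  have hsc : ∀ c, ContinuousOn (κ c).symm (κ c).target := fun c => continuousOn_extChartAt_symm (i c)
  choose A B Γ hA hiA hB hiB hBt hB𝒲 hΓ hΓ0 hΓA huniq using fun c =>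
    exists_local_flow (isOpen_chartDomain h𝒲 (i c)) (hv (i c)) (u₀ := κ c (i c))
      (fun t ht => mk_mem_chartDomain (hsrc c) (hmem c t ht))
      (fun t ht => by
        rw [chartField_chart v (hsrc c), h0 c t ht, map_zero])
      ((isOpen_extChartAt_target (I := 𝓘(ℝ, E)) (i c)).mem_nhds ((κ c).map_source (hsrc c)))
  let A' : C → Set M := fun c => (κ c).source ∩ κ c ⁻¹' (A c)
  have hA' : ∀ c, IsOpen (A' c) := fun c =>
    (hκc c).isOpen_inter_preimage (isOpen_extChartAt_source (i c)) (hA c)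
  let B' : C → Set M := fun c => (κ c).source ∩ κ c ⁻¹' (B c)
  have hB' : ∀ c, IsOpen (B' c) := fun c =>
    (hκc c).isOpen_inter_preimage (isOpen_extChartAt_source (i c)) (hB c)
  have hΓt : ∀ c, ∀ x ∈ A' c, ∀ t, Γ c (κ c x) t ∈ (κ c).target := fun c x hx t =>
    hBt c ((hΓA c _ hx.2).2.1 t)
  have hcurve : ∀ c, ∀ x ∈ A' c, Continuous fun t => (κ c).symm (Γ c (κ c x) t) := fun c x hx =>
    (hsc c).comp_continuous (Γ c (κ c x)).continuous (hΓt c x hx)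
  -- The constant curve is a default value; only the values on `A' c` matter.
  let r : C → M → C(unitInterval, M) := fun c x =>
    if hx : x ∈ A' c then ⟨fun t => (κ c).symm (Γ c (κ c x) t), hcurve c x hx⟩
    else ContinuousMap.const unitInterval x
  have hr : ∀ c, ∀ x ∈ A' c, ∀ t, r c x t = (κ c).symm (Γ c (κ c x) t) := fun c x hx t => by
    simp only [r, dif_pos hx]
    rfl
  have hrc : ∀ c, ContinuousOn (r c) (A' c) := by
    intro c
    rw [continuousOn_iff_continuous_domRestrict]
    refine ContinuousMap.continuous_of_continuous_uncurry _ ?_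
    have h1 : Continuous fun y : A' c × unitInterval => Γ c (κ c y.1.1) y.2 := by
      have h2 : Continuous fun x : A' c => Γ c (κ c x.1) :=
        (hΓ c).continuousOn.comp_continuous
          ((hκc c).comp_continuous continuous_subtype_val fun x => x.2.1) fun x => x.2.2
      exact continuous_eval.comp ((h2.comp continuous_fst).prodMk continuous_snd)
    have h3 : Continuous fun y : A' c × unitInterval => (κ c).symm (Γ c (κ c y.1.1) y.2) :=
      (hsc c).comp_continuous h1 fun y => hΓt c _ y.1.2 _
    refine h3.congr fun y => ?_
    exact (hr c _ y.1.2 _).symm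
  have hri : ∀ c, r c (i c) = ContinuousMap.const unitInterval (i c) := by
    intro c
    ext t
    rw [hr c _ ⟨hsrc c, hiA c⟩, hΓ0]
    exact (κ c).left_inv (hsrc c)
  let ext' : C(unitInterval, M) → ℝ → M := fun γ t => γ (projIcc 0 1 zero_le_one t)
  have hext : ∀ γ : C(unitInterval, M), ∀ t (ht : t ∈ Icc (0 : ℝ) 1), ext' γ t = γ ⟨t, ht⟩ := fun γ t ht => by
    simp only [ext', projIcc_of_mem zero_le_one ht]
  -- Solving the initial value problem is a condition on curves in `M` that mentions no chart. The
  -- flows in the various charts are locally unique solutions of it, so they glue, with the curve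
  -- space as target.
  let R : M → C(unitInterval, M) → Prop := fun x γ => ext' γ 0 = x ∧ ∀ t ∈ Icc (0 : ℝ) 1,
    (t, ext' γ t) ∈ 𝒲 ∧ HasVelocity (ext' γ) t (v (t, ext' γ t))
  have hR : ∀ c, ∀ x ∈ A' c, R x (r c x) := by
    intro c x hx
    obtain ⟨h1, h2, h3, -⟩ := hΓA c (κ c x) hx.2
    have h4 : ∀ t ∈ Icc (0 : ℝ) 1,
        ext' (r c x) t = (κ c).symm (extend (Γ c (κ c x)) t) := fun t ht => by
      rw [hext _ t ht, hr c x hx, extend_of_mem _ ht]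
    refine ⟨?_, fun t ht => ?_⟩
    · rw [hext _ 0 (by simp), hr c x hx]
      refine Eq.trans (congrArg _ h1) ((κ c).left_inv hx.1)
    · have h5 : extend (Γ c (κ c x)) t ∈ B c := by
        rw [extend_of_mem _ ht]
        exact h2 _
      have h6 := hB𝒲 c t ht _ h5
      rw [h4 t ht]
      refine ⟨h6.2, ?_⟩
      have h7 := (hasVelocity_chart_symm (z := i c) (h3 t ht) (hBt c h5)).congr ht h4
      have h8 : chartDsymm (i c) (extend (Γ c (κ c x)) t)
          (chartField v (i c) (t, extend (Γ c (κ c x)) t)) =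
          v (t, (κ c).symm (extend (Γ c (κ c x)) t)) := by
        have h9 := chartDsymm_chartD ((κ c).map_target (hBt c h5))
          (v (t, (κ c).symm (extend (Γ c (κ c x)) t)))
        have h10 : extChartAt 𝓘(ℝ, E) (i c) ((κ c).symm (extend (Γ c (κ c x)) t)) =
          extend (Γ c (κ c x)) t := (κ c).right_inv (hBt c h5)
        rwa [h10] at h9
      rwa [h8] at h7
  have : Nonempty C(unitInterval, M) :=
    ⟨ContinuousMap.const unitInterval (i (Classical.arbitrary C))⟩
  obtain ⟨O, G, hOG⟩ := exists_glued (X := C(unitInterval, M)) (Y := M)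
    (i := fun c => ContinuousMap.const unitInterval (i c))
    (i' := i) (R := R) (A := A') (B := fun c => {γ | MapsTo γ univ (B' c)}) (r := r)
    (fun c ε hε => ⟨ε, hε, fun c' h => by
      rw [ContinuousMap.dist_lt_iff hε]
      exact fun _ => h⟩)
    hA' (fun c => ⟨hsrc c, hiA c⟩)
    (fun c => (ContinuousMap.isOpen_setOfPred_mapsTo isCompact_univ (hB' c)).mem_nhds
      fun t _ => ⟨hsrc c, hiB c⟩)
    hrc hri hR
    (fun c x hx γ hγ hRγ => by
      obtain ⟨h1, h2⟩ := hRγ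
      have h3 : ∀ t, ext' γ t ∈ B' c := fun t => hγ (mem_univ _)
      have h4 := huniq c (fun t => κ c (ext' γ t)) (fun t ht => ⟨(h3 t).2, by
        have h5 := (h2 t ht).2.chart (h3 t).1
        rwa [← chartField_chart v (h3 t).1] at h5⟩) (by rw [h1]; exact hx.2)
      ext t
      have h6 := h4 t t.2
      rw [h1, extend_of_mem _ t.2] at h6
      rw [hr c x hx, ← h6, (κ c).left_inv (h3 t).1, hext γ t t.2])
  have hGr : ∀ c, ∀ x ∈ O c, G x = r c x := fun c x hx => (hOG c).2.2.2 x hx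
  have hOA : ∀ c, O c ⊆ A' c := fun c => (hOG c).2.2.1
  have hW1 : ∀ c, ∀ x ∈ O c, ext' (G x) 1 = (κ c).symm (Γ c (κ c x) 1) := fun c x hx => by
    rw [hext _ 1 (by simp), hGr c x hx, hr c x (hOA c hx)]
    rfl
  have hΓ1 : ∀ c, ∀ x ∈ O c, ContMDiffAt 𝓘(ℝ, E) 𝓘(ℝ, E) ∞ (fun x => Γ c (κ c x) 1) x := by
    intro c x hx
    let ev : C(unitInterval, E) →L[ℝ] E := ContinuousMap.evalCLM ℝ 1
    have h1 : ContDiffAt ℝ ∞ (fun u => Γ c u 1) (κ c x) :=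
      ev.contDiff.contDiffAt.comp (κ c x) ((hΓ c).contDiffAt ((hA c).mem_nhds (hOA c hx).2))
    exact h1.contMDiffAt.comp x (contMDiffAt_chart (hOA c hx).1)
  have hgsm : ∀ c, ∀ x ∈ O c, ContMDiffAt 𝓘(ℝ, E) 𝓘(ℝ, E) ∞ (fun x => ext' (G x) 1) x := by
    intro c x hx
    have h3 := (contMDiffAt_chart_symm (hΓt c x (hOA c hx) 1)).comp x (hΓ1 c x hx)
    refine h3.congr_of_eventuallyEq ?_
    filter_upwards [(hOG c).1.mem_nhds hx] with y hy using hW1 c y hy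
  refine ⟨⋃ c, O c, fun x => ext' (G x), isOpen_iUnion fun c => (hOG c).1,
    fun c => mem_iUnion.2 ⟨c, (hOG c).2.1⟩, ?_, ?_, ?_, ?_, ?_⟩
  · intro x hx
    obtain ⟨c, hc⟩ := mem_iUnion.1 hx
    have h1 := hR c x (hOA c hc)
    rw [← hGr c x hc] at h1
    exact h1
  · intro x hx
    obtain ⟨c, hc⟩ := mem_iUnion.1 hx
    exact (hgsm c x hc).contMDiffWithinAt
  · intro x hx
    obtain ⟨c, hc⟩ := mem_iUnion.1 hx
    have hxA := hOA c hc
    rw [injective_iff_map_eq_zero]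
    intro w hw
    have h1 : (fun x => ext' (G x) 1) =ᶠ[𝓝 x] (κ c).symm ∘ fun x => Γ c (κ c x) 1 := by
      filter_upwards [(hOG c).1.mem_nhds hc] with y hy using hW1 c y hy
    rw [md_congr h1, md_comp (g := (κ c).symm) (f := fun x => Γ c (κ c x) 1) (x := x)
      (I' := 𝓘(ℝ, E)) ((contMDiffAt_chart_symm (hΓt c x hxA 1)).mdifferentiableAt hn)
      ((hΓ1 c x hc).mdifferentiableAt hn)] at hw
    have h2 : md 𝓘(ℝ, E) 𝓘(ℝ, E) (fun x => Γ c (κ c x) 1) x w = 0 := by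
      have h3 := chartD_chartDsymm (hΓt c x hxA 1)
        (md 𝓘(ℝ, E) 𝓘(ℝ, E) (fun x => Γ c (κ c x) 1) x w)
      rw [← h3]
      exact (congrArg _ hw).trans (map_zero _)
    let ev : C(unitInterval, E) →L[ℝ] E := ContinuousMap.evalCLM ℝ 1
    have h4 : HasFDerivAt (fun u => Γ c u 1) (ev ∘L fderiv ℝ (Γ c) (κ c x)) (κ c x) :=
      ev.hasFDerivAt.comp (κ c x)
        (((hΓ c).contDiffAt ((hA c).mem_nhds hxA.2)).differentiableAt hn).hasFDerivAt
    have h5 := md_comp (I := 𝓘(ℝ, E)) (I' := 𝓘(ℝ, E)) (I'' := 𝓘(ℝ, E)) (f := κ c)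
      (g := fun u => Γ c u 1) (x := x) h4.differentiableAt.mdifferentiableAt
      ((contMDiffAt_chart hxA.1).mdifferentiableAt hn) w
    rw [md_eq_fderiv, h4.fderiv] at h5
    have h6 : fderiv ℝ (Γ c) (κ c x) (chartD (i c) x w) 1 = 0 := h5.symm.trans h2
    have h7 := (hΓA c (κ c x) hxA.2).2.2.2.2 _ h6
    rw [← chartDsymm_chartD hxA.1 w, h7, map_zero]
  · intro c t ht
    change ext' (G (i c)) t = i c
    rw [hGr c _ (hOG c).2.1, hri]
    rfl
  · intro c N hN
    obtain ⟨N', hN'N, hN', hcN'⟩ := mem_nhds_iff.1 hN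
    have h1 : ContinuousAt (r c) (i c) :=
      (hrc c).continuousAt ((hA' c).mem_nhds (hOA c (hOG c).2.1))
    have h2 : {γ : C(unitInterval, M) | MapsTo γ univ N'} ∈ 𝓝 (r c (i c)) := by
      rw [hri]
      exact (ContinuousMap.isOpen_setOfPred_mapsTo isCompact_univ hN').mem_nhds fun t _ => hcN'
    filter_upwards [h1.preimage_mem_nhds h2, (hOG c).1.mem_nhds (hOG c).2.1] with x hx hxO t ht
    rw [hGr c x hxO]
    exact hN'N (hx (mem_univ _))

end ManifoldFlow

/-! ### Decomposition of the velocity of a family of cosymplectic submanifolds -/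

section System

variable {E₀ E : Type*} [NormedAddCommGroup E₀] [NormedSpace ℝ E₀] [FiniteDimensional ℝ E₀]
  [NormedAddCommGroup E] [NormedSpace ℝ E] [FiniteDimensional ℝ E]

/-- The linear system `T w + S ξ = y`, `ξ ∘ T = 0` has at most one solution. -/
def IsNondeg (T : E₀ →L[ℝ] E) (S : (E →L[ℝ] ℝ) →L[ℝ] E) : Prop :=
  ∀ (w : E₀) (ξ : E →L[ℝ] ℝ), T w + S ξ = 0 → (∀ v, ξ (T v) = 0) → w = 0 ∧ ξ = 0

/-- The matrix of the linear system `T w + S ξ = y`, `ξ ∘ T = η`. -/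
def sysMat (T : E₀ →L[ℝ] E) (S : (E →L[ℝ] ℝ) →L[ℝ] E) :
    (E₀ × (E →L[ℝ] ℝ)) →L[ℝ] (E × (E₀ →L[ℝ] ℝ)) :=
  LinearMap.toContinuousLinearMap
    { toFun := fun y => (T y.1 + S y.2, y.2 ∘L T)
      map_add' := fun y y' => by
        refine Prod.ext ?_ ?_
        · simp only [Prod.fst_add, Prod.snd_add, map_add]
          abel
        · rfl
      map_smul' := fun a y => by
        refine Prod.ext ?_ ?_
        · simp only [Prod.smul_fst, Prod.smul_snd, map_smul, smul_add, RingHom.id_apply]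
        · rfl }

theorem sysMat_apply (T : E₀ →L[ℝ] E) (S : (E →L[ℝ] ℝ) →L[ℝ] E) (y : E₀ × (E →L[ℝ] ℝ)) :
    sysMat T S y = (T y.1 + S y.2, y.2 ∘L T) := rfl

/-- Both sides of the system have dimension `dim E₀ + dim E`, so injectivity is invertibility, an
open condition. -/
theorem isNondeg_iff {T : E₀ →L[ℝ] E} {S : (E →L[ℝ] ℝ) →L[ℝ] E} :
    IsNondeg T S ↔ ∃ e : (E₀ × (E →L[ℝ] ℝ)) ≃L[ℝ] (E × (E₀ →L[ℝ] ℝ)),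
      (e : (E₀ × (E →L[ℝ] ℝ)) →L[ℝ] (E × (E₀ →L[ℝ] ℝ))) = sysMat T S := by
  constructor
  · intro h
    have hinj : Function.Injective (sysMat T S).toLinearMap := by
      rw [injective_iff_map_eq_zero]
      rintro ⟨w, ξ⟩ hy
      obtain ⟨h1, h2⟩ := Prod.mk.inj hy
      obtain ⟨rfl, rfl⟩ := h w ξ h1 fun v => congrArg (fun l : E₀ →L[ℝ] ℝ => l v) h2
      rfl
    have hd : Module.finrank ℝ (E →L[ℝ] ℝ) = Module.finrank ℝ E := by
      rw [← (LinearMap.toContinuousLinearMap (𝕜 := ℝ) (E := E) (F' := ℝ)).finrank_eq]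
      exact Subspace.dual_finrank_eq
    have hd₀ : Module.finrank ℝ (E₀ →L[ℝ] ℝ) = Module.finrank ℝ E₀ := by
      rw [← (LinearMap.toContinuousLinearMap (𝕜 := ℝ) (E := E₀) (F' := ℝ)).finrank_eq]
      exact Subspace.dual_finrank_eq
    have hdim : Module.finrank ℝ (E₀ × (E →L[ℝ] ℝ)) = Module.finrank ℝ (E × (E₀ →L[ℝ] ℝ)) := by
      rw [Module.finrank_prod, Module.finrank_prod, hd, hd₀, add_comm]
    refine ⟨(LinearMap.linearEquivOfInjective _ hinj hdim).toContinuousLinearEquiv, ?_⟩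
    exact ContinuousLinearMap.ext fun y => rfl
  · rintro ⟨e, he⟩ w ξ h1 h2
    have h3 : e (w, ξ) = 0 := by
      have : e (w, ξ) = sysMat T S (w, ξ) :=
        congrArg (fun f : (E₀ × (E →L[ℝ] ℝ)) →L[ℝ] (E × (E₀ →L[ℝ] ℝ)) => f (w, ξ)) he
      rw [this, sysMat_apply]
      exact Prod.ext h1 (ContinuousLinearMap.ext h2)
    rw [map_eq_zero_iff _ e.injective] at h3
    exact Prod.mk.inj h3

theorem IsNondeg.exists_sol {T : E₀ →L[ℝ] E} {S : (E →L[ℝ] ℝ) →L[ℝ] E} (h : IsNondeg T S)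
    (y : E) : ∃ z : E₀ × (E →L[ℝ] ℝ), T z.1 + S z.2 = y ∧ ∀ v, z.2 (T v) = 0 := by
  obtain ⟨e, he⟩ := isNondeg_iff.1 h
  obtain ⟨z, hz⟩ := e.surjective (y, 0)
  have h1 : sysMat T S z = (y, 0) := by
    rw [← he]
    exact hz
  obtain ⟨h2, h3⟩ := Prod.mk.inj h1
  exact ⟨z, h2, fun v => congrArg (fun l : E₀ →L[ℝ] ℝ => l v) h3⟩

/-- Writing the unique solution with the inverse matrix exhibits its smooth dependence on the data.
-/
theorem IsNondeg.sol_eq {T : E₀ →L[ℝ] E} {S : (E →L[ℝ] ℝ) →L[ℝ] E} (h : IsNondeg T S)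
    {y : E} {z : E₀ × (E →L[ℝ] ℝ)} (h1 : T z.1 + S z.2 = y) (h2 : ∀ v, z.2 (T v) = 0) :
    z = (sysMat T S).inverse (y, 0) := by
  obtain ⟨e, he⟩ := isNondeg_iff.1 h
  rw [← he, ContinuousLinearMap.inverse_equiv]
  refine (e.symm_apply_eq.2 ?_).symm
  have h3 : e z = sysMat T S z :=
    congrArg (fun f : (E₀ × (E →L[ℝ] ℝ)) →L[ℝ] (E × (E₀ →L[ℝ] ℝ)) => f z) he
  rw [h3, sysMat_apply]
  exact Prod.ext h1.symm (ContinuousLinearMap.ext h2).symm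

/-- Nondegeneracy is independent of coordinates: `a` and `b` are the coordinate changes on the
submanifold and on the ambient space, and covectors are pulled back along `b`. -/
theorem IsNondeg.conj {T T' : E₀ →L[ℝ] E} {S S' : (E →L[ℝ] ℝ) →L[ℝ] E} {a a' : E₀ →L[ℝ] E₀}
    {b b' : E →L[ℝ] E} (ha : ∀ v, a (a' v) = v) (hb : ∀ v, b' (b v) = v) (hb' : ∀ v, b (b' v) = v)
    (hT : ∀ v, T' (a v) = b (T v)) (hS : ∀ m, S' m = b (S (m ∘L b))) (h : IsNondeg T S) :
    IsNondeg T' S' := by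
  intro w ξ h1 h2
  have h3 : b (T (a' w) + S (ξ ∘L b)) = 0 := by
    rw [map_add, ← hT, ha, ← hS, h1]
  have h4 : T (a' w) + S (ξ ∘L b) = 0 := by
    rw [← hb (T (a' w) + S (ξ ∘L b)), h3, map_zero]
  obtain ⟨h5, h6⟩ := h (a' w) (ξ ∘L b) h4 fun v => by
    change ξ (b (T v)) = 0
    rw [← hT]
    exact h2 _
  refine ⟨?_, ?_⟩
  · rw [← ha w, h5, map_zero]
  · ext v
    rw [← hb' v]
    have h7 := congrArg (fun l : E →L[ℝ] ℝ => l (b' v)) h6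
    exact h7

/-- The inverse of the matrix of a nondegenerate system depends smoothly on the system. -/
theorem contDiffAt_sysMat_inverse {F : Type*} [NormedAddCommGroup F] [NormedSpace ℝ F]
    {T : F → E₀ →L[ℝ] E} {S : F → (E →L[ℝ] ℝ) →L[ℝ] E} {y₀ : F} (hT : ContDiffAt ℝ ∞ T y₀)
    (hS : ContDiffAt ℝ ∞ S y₀) (h : IsNondeg (T y₀) (S y₀)) :
    ContDiffAt ℝ ∞ (fun y => (sysMat (T y) (S y)).inverse) y₀ ∧
      ∀ᶠ y in 𝓝 y₀, IsNondeg (T y) (S y) := by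
  have h1 : ContDiffAt ℝ ∞ (fun y => sysMat (T y) (S y)) y₀ := by
    refine contDiffAt_clm fun w => ?_
    simp only [sysMat_apply]
    exact ((hT.clm_apply contDiffAt_const).add (hS.clm_apply contDiffAt_const)).prodMk
      (contDiffAt_const.clm_comp hT)
  obtain ⟨e, he⟩ := isNondeg_iff.1 h
  refine ⟨?_, ?_⟩
  · have h2 : ContDiffAt ℝ ∞ ContinuousLinearMap.inverse (sysMat (T y₀) (S y₀)) := by
      rw [← he]
      exact contDiffAt_map_inverse e
    exact ContDiffAt.comp y₀ h2 h1
  · have h2 := h1.continuousAt.eventually_mem (show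
      range ((↑) : ((E₀ × (E →L[ℝ] ℝ)) ≃L[ℝ] (E × (E₀ →L[ℝ] ℝ))) →
        (E₀ × (E →L[ℝ] ℝ)) →L[ℝ] (E × (E₀ →L[ℝ] ℝ))) ∈ 𝓝 (sysMat (T y₀) (S y₀)) by
        rw [← he]
        exact ContinuousLinearEquiv.nhds e)
    filter_upwards [h2] with y hy
    exact isNondeg_iff.2 hy

end System

/-! ### Families of maps to a Poisson manifold -/

section Family

variable {E₀ M : Type*} [NormedAddCommGroup E₀] [NormedSpace ℝ E₀]
  [TopologicalSpace M] [ChartedSpace E₀ M] [IsManifold 𝓘(ℝ, E₀) ∞ M]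
  {E P : Type*} [NormedAddCommGroup E] [NormedSpace ℝ E]
  [TopologicalSpace P] [ChartedSpace E P] [IsManifold 𝓘(ℝ, E) ∞ P]

/-- The differential of a family of maps in the space variable. -/
def dx (φ : ℝ × M → P) (q : ℝ × M) : E₀ →L[ℝ] E :=
  md 𝓘(ℝ, E₀) 𝓘(ℝ, E) (fun x => φ (q.1, x)) q.2

/-- The velocity of a family of maps. -/
def dt (φ : ℝ × M → P) (q : ℝ × M) : E := md 𝓘(ℝ, ℝ) 𝓘(ℝ, E) (fun s => φ (s, q.2)) q.1 1

variable {φ : ℝ × M → P} {𝒲 : Set (ℝ × M)}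

/-- The family `φ` in charts. -/
def chartMap (φ : ℝ × M → P) (z₀ : M) (z : P) (y : ℝ × E₀) : E :=
  extChartAt 𝓘(ℝ, E) z (φ (y.1, (extChartAt 𝓘(ℝ, E₀) z₀).symm y.2))

/-- The domain of the family `φ` in charts. -/
def mapDomain (φ : ℝ × M → P) (𝒲 : Set (ℝ × M)) (z : P) : Set (ℝ × M) :=
  𝒲 ∩ φ ⁻¹' (extChartAt 𝓘(ℝ, E) z).source

theorem isOpen_mapDomain (h𝒲 : IsOpen 𝒲)
    (hφ : ContMDiffOn (𝓘(ℝ, ℝ).prod 𝓘(ℝ, E₀)) 𝓘(ℝ, E) ∞ φ 𝒲) (z : P) :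
    IsOpen (mapDomain (E := E) φ 𝒲 z) :=
  hφ.continuousOn.isOpen_inter_preimage h𝒲 (isOpen_extChartAt_source z)

theorem contDiffOn_chartMap (h𝒲 : IsOpen 𝒲)
    (hφ : ContMDiffOn (𝓘(ℝ, ℝ).prod 𝓘(ℝ, E₀)) 𝓘(ℝ, E) ∞ φ 𝒲) (z₀ : M) (z : P) :
    ContDiffOn ℝ ∞ (chartMap (E₀ := E₀) (E := E) φ z₀ z)
      (chartDomain (mapDomain (E := E) φ 𝒲 z) z₀) := by
  refine (contDiffOn_chart_family (isOpen_mapDomain h𝒲 hφ z) (f := fun q => extChartAt 𝓘(ℝ, E) z (φ q))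
    ?_ z₀).2
  intro q hq
  exact (contMDiffAt_chart hq.2).comp_contMDiffWithinAt q ((hφ q hq.1).mono inter_subset_left)

theorem contMDiffAt_space (h𝒲 : IsOpen 𝒲)
    (hφ : ContMDiffOn (𝓘(ℝ, ℝ).prod 𝓘(ℝ, E₀)) 𝓘(ℝ, E) ∞ φ 𝒲) {q : ℝ × M} (hq : q ∈ 𝒲) :
    ContMDiffAt 𝓘(ℝ, E₀) 𝓘(ℝ, E) ∞ (fun x => φ (q.1, x)) q.2 :=
  ContMDiffAt.comp q.2 (hφ.contMDiffAt (h𝒲.mem_nhds hq)) (contMDiffAt_const.prodMk contMDiffAt_id)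

theorem contMDiffAt_time (h𝒲 : IsOpen 𝒲)
    (hφ : ContMDiffOn (𝓘(ℝ, ℝ).prod 𝓘(ℝ, E₀)) 𝓘(ℝ, E) ∞ φ 𝒲) {q : ℝ × M} (hq : q ∈ 𝒲) :
    ContMDiffAt 𝓘(ℝ, ℝ) 𝓘(ℝ, E) ∞ (fun s => φ (s, q.2)) q.1 :=
  ContMDiffAt.comp q.1 (hφ.contMDiffAt (h𝒲.mem_nhds hq)) (contMDiffAt_id.prodMk contMDiffAt_const)

variable [FiniteDimensional ℝ E₀] [FiniteDimensional ℝ E]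

theorem partialSnd_chartMap (h𝒲 : IsOpen 𝒲)
    (hφ : ContMDiffOn (𝓘(ℝ, ℝ).prod 𝓘(ℝ, E₀)) 𝓘(ℝ, E) ∞ φ 𝒲) {q : ℝ × M} {z₀ : M} {z : P}
    (hq : q ∈ mapDomain (E := E) φ 𝒲 z) (hz₀ : q.2 ∈ (extChartAt 𝓘(ℝ, E₀) z₀).source) (v : E₀) :
    partialSnd (chartMap (E₀ := E₀) (E := E) φ z₀ z) (q.1, extChartAt 𝓘(ℝ, E₀) z₀ q.2) (chartD z₀ q.2 v) =
      chartD z (φ q) (dx (E₀ := E₀) (E := E) φ q v) := by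
  have hn : (∞ : WithTop ℕ∞) ≠ 0 := by simp
  have h1 := hasFDerivAt_partialSnd_of_differentiableAt
    (((contDiffOn_chartMap h𝒲 hφ z₀ z).contDiffAt ((isOpen_chartDomain (isOpen_mapDomain h𝒲 hφ z)
      z₀).mem_nhds (mk_mem_chartDomain hz₀ hq))).differentiableAt hn)
  have h2 : ContMDiffAt 𝓘(ℝ, E₀) 𝓘(ℝ, E) ∞
      (extChartAt 𝓘(ℝ, E) z ∘ fun x => φ (q.1, x)) q.2 :=
    (contMDiffAt_chart hq.2).comp q.2 (contMDiffAt_space h𝒲 hφ hq.1)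
  have h3 := md_eq_fderiv_chart hz₀ h2 v
  have h4 := md_comp (f := fun x => φ (q.1, x)) (x := q.2)
    ((contMDiffAt_chart hq.2).mdifferentiableAt hn) ((contMDiffAt_space h𝒲 hφ hq.1).mdifferentiableAt hn) v
  rw [← h1.fderiv]
  exact h3.symm.trans h4

theorem fderiv_chartMap_time (h𝒲 : IsOpen 𝒲)
    (hφ : ContMDiffOn (𝓘(ℝ, ℝ).prod 𝓘(ℝ, E₀)) 𝓘(ℝ, E) ∞ φ 𝒲) {q : ℝ × M} {z₀ : M} {z : P}
    (hq : q ∈ mapDomain (E := E) φ 𝒲 z) (hz₀ : q.2 ∈ (extChartAt 𝓘(ℝ, E₀) z₀).source) :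
    fderiv ℝ (chartMap (E₀ := E₀) (E := E) φ z₀ z) (q.1, extChartAt 𝓘(ℝ, E₀) z₀ q.2) (1, 0) =
      chartD z (φ q) (dt (E := E) φ q) := by
  have hn : (∞ : WithTop ℕ∞) ≠ 0 := by simp
  have h1 : HasFDerivAt (chartMap (E₀ := E₀) (E := E) φ z₀ z) _ (q.1, extChartAt 𝓘(ℝ, E₀) z₀ q.2) :=
    (((contDiffOn_chartMap h𝒲 hφ z₀ z).contDiffAt ((isOpen_chartDomain (isOpen_mapDomain h𝒲 hφ z)
      z₀).mem_nhds (mk_mem_chartDomain hz₀ hq))).differentiableAt hn).hasFDerivAt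
  have h2 := h1.comp q.1 (hasFDerivAt_prodMk_left (𝕜 := ℝ) q.1 (extChartAt 𝓘(ℝ, E₀) z₀ q.2))
  have h3 : chartMap (E₀ := E₀) (E := E) φ z₀ z ∘ (fun s => (s, extChartAt 𝓘(ℝ, E₀) z₀ q.2)) =
      extChartAt 𝓘(ℝ, E) z ∘ fun s => φ (s, q.2) := by
    funext s
    simp only [chartMap, Function.comp_apply]
    rw [(extChartAt 𝓘(ℝ, E₀) z₀).left_inv hz₀]
  have h4 := md_comp (I := 𝓘(ℝ, ℝ)) (f := fun s => φ (s, q.2)) (x := q.1) ((contMDiffAt_chart hq.2).mdifferentiableAt hn)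
    ((contMDiffAt_time h𝒲 hφ hq.1).mdifferentiableAt hn) (1 : ℝ)
  rw [h3] at h2
  rw [md_eq_fderiv, h2.fderiv] at h4
  exact h4

/-- The contraction with a bivector at a point. -/
def sharpL (B : BilinField E P) (p : P) : (E →L[ℝ] ℝ) →L[ℝ] E :=
  LinearMap.toContinuousLinearMap
    { toFun := fun m => sharp (bil B p) m.toLinearMap
      map_add' := fun m m' => map_add (sharp (bil B p)) m.toLinearMap m'.toLinearMap
      map_smul' := fun a m => map_smul (sharp (bil B p)) a m.toLinearMap }

theorem sharpL_apply (B : BilinField E P) (p : P) (m : E →L[ℝ] ℝ) :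
    sharpL B p m = sharp (bil B p) m.toLinearMap := rfl

theorem chartSharp_eq (B : BilinField E P) {z p : P} (hp : p ∈ (extChartAt 𝓘(ℝ, E) z).source)
    (m : E →L[ℝ] ℝ) : chartSharp B z (extChartAt 𝓘(ℝ, E) z p) m =
      chartD z p (sharpL B p (m ∘L chartD z p)) := chartSharp_chart B hp m

/-- The points at which the images of the family are cosymplectic. -/
def nondegSet (B : BilinField E P) (φ : ℝ × M → P) (𝒲 : Set (ℝ × M)) : Set (ℝ × M) :=
  {q | q ∈ 𝒲 ∧ IsNondeg (dx (E₀ := E₀) φ q) (sharpL B (φ q))}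

theorem chartD_symm_chart {z p : P} (hp : p ∈ (extChartAt 𝓘(ℝ, E) z).source) (v : E) :
    chartD z p (chartDsymm z (extChartAt 𝓘(ℝ, E) z p) v) = v := by
  have h := chartD_chartDsymm ((extChartAt 𝓘(ℝ, E) z).map_source hp) v
  rwa [(extChartAt 𝓘(ℝ, E) z).left_inv hp] at h

theorem isNondeg_chart_iff {B : BilinField E P} (h𝒲 : IsOpen 𝒲)
    (hφ : ContMDiffOn (𝓘(ℝ, ℝ).prod 𝓘(ℝ, E₀)) 𝓘(ℝ, E) ∞ φ 𝒲) {q : ℝ × M} {z₀ : M} {z : P}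
    (hq : q ∈ mapDomain (E := E) φ 𝒲 z) (hz₀ : q.2 ∈ (extChartAt 𝓘(ℝ, E₀) z₀).source) :
    IsNondeg (partialSnd (chartMap (E₀ := E₀) (E := E) φ z₀ z) (q.1, extChartAt 𝓘(ℝ, E₀) z₀ q.2))
      (chartSharp B z (extChartAt 𝓘(ℝ, E) z (φ q))) ↔
      IsNondeg (dx (E₀ := E₀) φ q) (sharpL B (φ q)) := by
  have hT := partialSnd_chartMap h𝒲 hφ hq hz₀
  constructor
  · intro h
    refine h.conj (a := chartDsymm z₀ (extChartAt 𝓘(ℝ, E₀) z₀ q.2)) (a' := chartD z₀ q.2)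
      (b := chartDsymm z (extChartAt 𝓘(ℝ, E) z (φ q))) (b' := chartD z (φ q))
      (chartDsymm_chartD hz₀) (chartD_symm_chart hq.2) (chartDsymm_chartD hq.2) (fun v => ?_)
      fun m => ?_
    · have h1 := hT (chartDsymm z₀ (extChartAt 𝓘(ℝ, E₀) z₀ q.2) v)
      rw [chartD_symm_chart hz₀] at h1
      rw [h1, chartDsymm_chartD hq.2]
    · rw [chartSharp_eq B hq.2, chartDsymm_chartD hq.2]
      congr 1
      ext v
      exact congrArg m (chartDsymm_chartD hq.2 v).symm
  · intro h
    exact h.conj (chartD_symm_chart hz₀) (chartDsymm_chartD hq.2) (chartD_symm_chart hq.2)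
      hT fun m => chartSharp_eq B hq.2 m

variable [T2Space P]

/-- The solution in charts of the system that decomposes the velocity. -/
def chartSol (B : BilinField E P) (φ : ℝ × M → P) (z₀ : M) (z : P) (y : ℝ × E₀) :
    E₀ × (E →L[ℝ] ℝ) :=
  (sysMat (partialSnd (chartMap (E₀ := E₀) (E := E) φ z₀ z) y) (chartSharp B z (chartMap (E₀ := E₀) (E := E) φ z₀ z y))).inverse
    (fderiv ℝ (chartMap (E₀ := E₀) (E := E) φ z₀ z) y (1, 0), 0)

theorem contDiffAt_chartSys {B : BilinField E P} (hB : IsPoisson B) (h𝒲 : IsOpen 𝒲)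
    (hφ : ContMDiffOn (𝓘(ℝ, ℝ).prod 𝓘(ℝ, E₀)) 𝓘(ℝ, E) ∞ φ 𝒲) {q : ℝ × M} {z₀ : M} {z : P}
    (hq : q ∈ mapDomain (E := E) φ 𝒲 z) (hz₀ : q.2 ∈ (extChartAt 𝓘(ℝ, E₀) z₀).source)
    (hnd : IsNondeg (dx (E₀ := E₀) φ q) (sharpL B (φ q))) :
    ContDiffAt ℝ ∞ (fun y => (sysMat (partialSnd (chartMap (E₀ := E₀) (E := E) φ z₀ z) y)
        (chartSharp B z (chartMap (E₀ := E₀) (E := E) φ z₀ z y))).inverse)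
      (q.1, extChartAt 𝓘(ℝ, E₀) z₀ q.2) ∧
      ∀ᶠ y in 𝓝 (q.1, extChartAt 𝓘(ℝ, E₀) z₀ q.2),
        IsNondeg (partialSnd (chartMap (E₀ := E₀) (E := E) φ z₀ z) y)
          (chartSharp B z (chartMap (E₀ := E₀) (E := E) φ z₀ z y)) := by
  set y₀ := (q.1, extChartAt 𝓘(ℝ, E₀) z₀ q.2)
  have ho := isOpen_chartDomain (E := E₀) (isOpen_mapDomain h𝒲 hφ z) z₀
  have hy₀ := ho.mem_nhds (mk_mem_chartDomain hz₀ hq)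
  have hc := contDiffOn_chartMap h𝒲 hφ z₀ z
  have hval : chartMap (E₀ := E₀) (E := E) φ z₀ z y₀ = extChartAt 𝓘(ℝ, E) z (φ q) := by
    simp only [chartMap, y₀]
    rw [(extChartAt 𝓘(ℝ, E₀) z₀).left_inv hz₀]
  have h1 : ContDiffAt ℝ ∞ (partialSnd (chartMap (E₀ := E₀) (E := E) φ z₀ z)) y₀ :=
    (contDiffOn_partialSnd ho hc).contDiffAt hy₀
  have h2 : ContDiffAt ℝ ∞
      (fun y => chartSharp B z (chartMap (E₀ := E₀) (E := E) φ z₀ z y)) y₀ := by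
    refine ContDiffAt.comp (g := chartSharp B z) y₀ ?_ (hc.contDiffAt hy₀)
    rw [hval]
    exact (isPoissonOn_chartSharp hB z).contDiffOn.contDiffAt
      ((isOpen_extChartAt_target z).mem_nhds ((extChartAt 𝓘(ℝ, E) z).map_source hq.2))
  have h3 := (isNondeg_chart_iff (B := B) h𝒲 hφ hq hz₀).2 hnd
  rw [← hval] at h3
  exact contDiffAt_sysMat_inverse h1 h2 h3

theorem contDiffAt_chartSol {B : BilinField E P} (hB : IsPoisson B) (h𝒲 : IsOpen 𝒲)
    (hφ : ContMDiffOn (𝓘(ℝ, ℝ).prod 𝓘(ℝ, E₀)) 𝓘(ℝ, E) ∞ φ 𝒲) {q : ℝ × M} {z₀ : M} {z : P}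
    (hq : q ∈ mapDomain (E := E) φ 𝒲 z) (hz₀ : q.2 ∈ (extChartAt 𝓘(ℝ, E₀) z₀).source)
    (hnd : IsNondeg (dx (E₀ := E₀) φ q) (sharpL B (φ q))) :
    ContDiffAt ℝ ∞ (chartSol B φ z₀ z) (q.1, extChartAt 𝓘(ℝ, E₀) z₀ q.2) := by
  have ho := isOpen_chartDomain (E := E₀) (isOpen_mapDomain h𝒲 hφ z) z₀
  have h6 : ContDiffAt ℝ ∞ (fderiv ℝ (chartMap (E₀ := E₀) (E := E) φ z₀ z))
      (q.1, extChartAt 𝓘(ℝ, E₀) z₀ q.2) :=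
    ((contDiffOn_chartMap h𝒲 hφ z₀ z).fderiv_of_isOpen ho (by simp)).contDiffAt
      (ho.mem_nhds (mk_mem_chartDomain hz₀ hq))
  exact (contDiffAt_chartSys hB h𝒲 hφ hq hz₀ hnd).1.clm_apply
    ((h6.clm_apply contDiffAt_const).prodMk contDiffAt_const)

/-- In fixed charts the condition is invertibility of a continuous matrix. The detour through charts
is needed because `dx` is expressed in preferred charts that change with the point. -/
theorem isOpen_nondegSet {B : BilinField E P} (hB : IsPoisson B) (h𝒲 : IsOpen 𝒲)
    (hφ : ContMDiffOn (𝓘(ℝ, ℝ).prod 𝓘(ℝ, E₀)) 𝓘(ℝ, E) ∞ φ 𝒲) :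
    IsOpen (nondegSet (E₀ := E₀) B φ 𝒲) := by
  rw [isOpen_iff_mem_nhds]
  rintro q ⟨hq, hnd⟩
  have hqm : q ∈ mapDomain (E := E) φ 𝒲 (φ q) := ⟨hq, mem_extChartAt_source (φ q)⟩
  have hz₀ : q.2 ∈ (extChartAt 𝓘(ℝ, E₀) q.2).source := mem_extChartAt_source q.2
  have h1 := (contDiffAt_chartSys hB h𝒲 hφ hqm hz₀ hnd).2
  have h2 : ContinuousAt (fun y : ℝ × M => (y.1, extChartAt 𝓘(ℝ, E₀) q.2 y.2)) q :=
    continuousAt_fst.prodMk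
      (ContinuousAt.comp (f := Prod.snd) (continuousAt_extChartAt q.2) continuousAt_snd)
  filter_upwards [h2.eventually h1, (isOpen_mapDomain h𝒲 hφ (φ q)).mem_nhds hqm,
    ((isOpen_extChartAt_source (I := 𝓘(ℝ, E₀)) q.2).preimage continuous_snd).mem_nhds hz₀]
    with y hy hym hys
  refine ⟨hym.1, (isNondeg_chart_iff (B := B) h𝒲 hφ hym hys).1 ?_⟩
  have hval : chartMap (E₀ := E₀) (E := E) φ q.2 (φ q) (y.1, extChartAt 𝓘(ℝ, E₀) q.2 y.2) =
      extChartAt 𝓘(ℝ, E) (φ q) (φ y) := by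
    simp only [chartMap]
    rw [(extChartAt 𝓘(ℝ, E₀) q.2).left_inv hys]
  rw [← hval]
  exact hy

/-- With `IsRetraction.fderiv_chart`, this expresses that `dr` becomes smooth in the point after
composition with the differential of one fixed chart. -/
theorem IsRetraction.contDiffAt_fderiv_chart {H : Type*} [NormedAddCommGroup H]
    [InnerProductSpace ℝ H] [CompleteSpace H] {e : P → H} {O : Set H} {r : H → P}
    (hr : IsRetraction (E := E) e O r) {z p : P} (hp : p ∈ (extChartAt 𝓘(ℝ, E) z).source) :
    ContDiffAt ℝ ∞ (fderiv ℝ fun y => extChartAt 𝓘(ℝ, E) z (r y)) (e p) := by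
  have hrO : IsOpen (O ∩ r ⁻¹' (extChartAt 𝓘(ℝ, E) z).source) :=
    hr.contMDiffOn.continuousOn.isOpen_inter_preimage hr.isOpen (isOpen_extChartAt_source z)
  have hκr : ContDiffOn ℝ ∞ (fun y => extChartAt 𝓘(ℝ, E) z (r y))
      (O ∩ r ⁻¹' (extChartAt 𝓘(ℝ, E) z).source) := by
    refine ContMDiffOn.contDiffOn fun y hy => ?_
    exact (contMDiffAt_chart hy.2).comp_contMDiffWithinAt y
      ((hr.contMDiffOn y hy.1).mono inter_subset_left)
  refine (hκr.fderiv_of_isOpen hrO (by simp)).contDiffAt (hrO.mem_nhds ⟨hr.mem p, ?_⟩)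
  rwa [mem_preimage, hr.left_inv]

theorem IsRetraction.fderiv_chart {H : Type*} [NormedAddCommGroup H]
    [InnerProductSpace ℝ H] [CompleteSpace H] {e : P → H} {O : Set H} {r : H → P}
    (hr : IsRetraction (E := E) e O r) {z p : P} (hp : p ∈ (extChartAt 𝓘(ℝ, E) z).source) (v : H) :
    fderiv ℝ (fun y => extChartAt 𝓘(ℝ, E) z (r y)) (e p) v = chartD z p (hr.dr p v) := by
  have hn : (∞ : WithTop ℕ∞) ≠ 0 := by simp
  have h8 := md_comp (I := 𝓘(ℝ, H)) (I' := 𝓘(ℝ, E)) (I'' := 𝓘(ℝ, E)) (f := r)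
    (g := extChartAt 𝓘(ℝ, E) z) (x := e p)
    ((contMDiffAt_chart (by rwa [hr.left_inv])).mdifferentiableAt hn)
    ((hr.contMDiffAt_r _).mdifferentiableAt hn) v
  rw [md_eq_fderiv, hr.left_inv] at h8
  exact h8

/-- The velocity of a family of cosymplectic submanifolds is the sum of a vector that is tangent to
the submanifold and of the contraction of a covector that annihilates its tangent space; both depend
smoothly on the point. -/
theorem exists_decomposition {B : BilinField E P} (hB : IsPoisson B) (h𝒲 : IsOpen 𝒲)
    (hφ : ContMDiffOn (𝓘(ℝ, ℝ).prod 𝓘(ℝ, E₀)) 𝓘(ℝ, E) ∞ φ 𝒲)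
    {H : Type*} [NormedAddCommGroup H] [InnerProductSpace ℝ H] [CompleteSpace H]
    {e : P → H} {O : Set H} {r : H → P} (hr : IsRetraction (E := E) e O r) :
    ∃ (w : ℝ × M → E₀) (ξ : ℝ × M → E →L[ℝ] ℝ),
      (∀ q ∈ nondegSet (E₀ := E₀) B φ 𝒲, dx φ q (w q) + sharpL B (φ q) (ξ q) = dt φ q ∧
        ∀ v : E₀, ξ q (dx φ q v) = 0) ∧
      (∀ z, ContDiffOn ℝ ∞ (chartField w z) (chartDomain (nondegSet (E₀ := E₀) B φ 𝒲) z)) ∧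
      ContMDiffOn (𝓘(ℝ, ℝ).prod 𝓘(ℝ, E₀)) 𝓘(ℝ, H →L[ℝ] ℝ) ∞ (fun q => ξ q ∘L hr.dr (φ q))
        (nondegSet (E₀ := E₀) B φ 𝒲) := by
  classical
  have hn : (∞ : WithTop ℕ∞) ≠ 0 := by simp
  -- Solutions are chosen point by point. By uniqueness they agree with `chartSol` in every chart,
  -- and their smoothness comes from there. The value `0` off the nondegenerate set is a default.
  have hex : ∀ q : ℝ × M, ∃ y : E₀ × (E →L[ℝ] ℝ), q ∈ nondegSet (E₀ := E₀) B φ 𝒲 →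
      dx φ q y.1 + sharpL B (φ q) y.2 = dt φ q ∧ ∀ v : E₀, y.2 (dx φ q v) = 0 := by
    intro q
    by_cases hq : q ∈ nondegSet (E₀ := E₀) B φ 𝒲
    · obtain ⟨y, hy⟩ := hq.2.exists_sol (dt φ q)
      exact ⟨y, fun _ => hy⟩
    · exact ⟨0, fun h => absurd h hq⟩
  choose y hy using hex
  have hopen := isOpen_nondegSet (E₀ := E₀) hB h𝒲 hφ
  have hsol : ∀ q ∈ nondegSet (E₀ := E₀) B φ 𝒲, ∀ (z₀ : M) (z : P),
      φ q ∈ (extChartAt 𝓘(ℝ, E) z).source → q.2 ∈ (extChartAt 𝓘(ℝ, E₀) z₀).source →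
      (chartD z₀ q.2 (y q).1, (y q).2 ∘L chartDsymm z (extChartAt 𝓘(ℝ, E) z (φ q))) =
        chartSol B φ z₀ z (q.1, extChartAt 𝓘(ℝ, E₀) z₀ q.2) := by
    intro q hq z₀ z hz hz₀
    have hqm : q ∈ mapDomain (E := E) φ 𝒲 z := ⟨hq.1, hz⟩
    have hval : chartMap (E₀ := E₀) (E := E) φ z₀ z (q.1, extChartAt 𝓘(ℝ, E₀) z₀ q.2) =
        extChartAt 𝓘(ℝ, E) z (φ q) := by
      simp only [chartMap]
      rw [(extChartAt 𝓘(ℝ, E₀) z₀).left_inv hz₀]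
    have h1 := (isNondeg_chart_iff (B := B) h𝒲 hφ hqm hz₀).2 hq.2
    obtain ⟨h2, h3⟩ := hy q hq
    rw [chartSol, hval]
    refine h1.sol_eq ?_ fun v => ?_
    · rw [partialSnd_chartMap h𝒲 hφ hqm hz₀, chartSharp_eq B hz, fderiv_chartMap_time h𝒲 hφ hqm hz₀,
        ← map_add, ← h2]
      congr 3
      ext v
      exact congrArg (y q).2 (chartDsymm_chartD hz v)
    · have h4 := partialSnd_chartMap h𝒲 hφ hqm hz₀
        (chartDsymm z₀ (extChartAt 𝓘(ℝ, E₀) z₀ q.2) v)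
      rw [chartD_symm_chart hz₀] at h4
      rw [h4]
      change (y q).2 (chartDsymm z (extChartAt 𝓘(ℝ, E) z (φ q)) (chartD z (φ q) (dx φ q _))) = 0
      rw [chartDsymm_chartD hz]
      exact h3 _
  refine ⟨fun q => (y q).1, fun q => (y q).2, hy, ?_, ?_⟩
  · intro z₀ u hu
    set q : ℝ × M := (u.1, (extChartAt 𝓘(ℝ, E₀) z₀).symm u.2) with hqdef
    have hq : q ∈ nondegSet (E₀ := E₀) B φ 𝒲 := hu.2
    have hz₀ : q.2 ∈ (extChartAt 𝓘(ℝ, E₀) z₀).source := (extChartAt 𝓘(ℝ, E₀) z₀).map_target hu.1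
    have hqm : q ∈ mapDomain (E := E) φ 𝒲 (φ q) := ⟨hq.1, mem_extChartAt_source (φ q)⟩
    have hqu : (q.1, extChartAt 𝓘(ℝ, E₀) z₀ q.2) = u :=
      Prod.ext rfl ((extChartAt 𝓘(ℝ, E₀) z₀).right_inv hu.1)
    have h1 := contDiffAt_chartSol hB h𝒲 hφ hqm hz₀ hq.2
    rw [hqu] at h1
    refine (h1.fst.congr_of_eventuallyEq ?_).contDiffWithinAt
    have ho : IsOpen (chartDomain (E := E₀)
        (nondegSet (E₀ := E₀) B φ 𝒲 ∩ mapDomain (E := E) φ 𝒲 (φ q)) z₀) :=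
      isOpen_chartDomain (hopen.inter (isOpen_mapDomain h𝒲 hφ (φ q))) z₀
    filter_upwards [ho.mem_nhds ⟨hu.1, hq, hqm⟩] with u' hu'
    have h2 := hsol (u'.1, (extChartAt 𝓘(ℝ, E₀) z₀).symm u'.2) hu'.2.1 z₀ (φ q) hu'.2.2.2
      ((extChartAt 𝓘(ℝ, E₀) z₀).map_target hu'.1)
    have h3 : ((u'.1, (extChartAt 𝓘(ℝ, E₀) z₀).symm u'.2) : ℝ × M).2 =
      (extChartAt 𝓘(ℝ, E₀) z₀).symm u'.2 := rfl
    rw [h3, (extChartAt 𝓘(ℝ, E₀) z₀).right_inv hu'.1] at h2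
    exact congrArg Prod.fst h2
  -- Covectors at varying points of `P` are compared by pulling them back to `H` along `dr`. The
  -- pullback is the covector in a chart composed with the derivative of the chart after `r`, and
  -- both factors are smooth.
  · intro q hq
    set z := φ q
    have hz : φ q ∈ (extChartAt 𝓘(ℝ, E) z).source := mem_extChartAt_source z
    have hz₀ : q.2 ∈ (extChartAt 𝓘(ℝ, E₀) q.2).source := mem_extChartAt_source q.2
    have hqm : q ∈ mapDomain (E := E) φ 𝒲 z := ⟨hq.1, hz⟩
    have h1 := contDiffAt_chartSol hB h𝒲 hφ hqm hz₀ hq.2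
    have h2 : ContMDiffAt (𝓘(ℝ, ℝ).prod 𝓘(ℝ, E₀)) 𝓘(ℝ, ℝ × E₀) ∞
        (fun y : ℝ × M => (y.1, extChartAt 𝓘(ℝ, E₀) q.2 y.2)) q :=
      contMDiffAt_fst.prodMk_space ((contMDiffAt_chart hz₀).comp q contMDiffAt_snd)
    have h1' : ContMDiffAt 𝓘(ℝ, ℝ × E₀) 𝓘(ℝ, E →L[ℝ] ℝ) ∞
        (fun y => (chartSol B φ q.2 z y).2) (q.1, extChartAt 𝓘(ℝ, E₀) q.2 q.2) :=
      h1.snd.contMDiffAt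
    have h3 : ContMDiffAt (𝓘(ℝ, ℝ).prod 𝓘(ℝ, E₀)) 𝓘(ℝ, E →L[ℝ] ℝ) ∞
        (fun y : ℝ × M => (chartSol B φ q.2 z (y.1, extChartAt 𝓘(ℝ, E₀) q.2 y.2)).2) q :=
      ContMDiffAt.comp (g := fun y : ℝ × E₀ => (chartSol B φ q.2 z y).2)
        (f := fun y : ℝ × M => (y.1, extChartAt 𝓘(ℝ, E₀) q.2 y.2)) q h1' h2
    have h4 : ContMDiffAt (𝓘(ℝ, ℝ).prod 𝓘(ℝ, E₀)) 𝓘(ℝ, H →L[ℝ] E) ∞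
        (fun y : ℝ × M => fderiv ℝ (fun y => extChartAt 𝓘(ℝ, E) z (r y)) (e (φ y))) q :=
      (hr.contDiffAt_fderiv_chart hz).contMDiffAt.comp q
        ((hr.contMDiff _).comp q (hφ.contMDiffAt (h𝒲.mem_nhds hq.1)))
    refine ((h3.clm_comp h4).congr_of_eventuallyEq ?_).contMDiffWithinAt
    filter_upwards [(hopen.inter (isOpen_mapDomain h𝒲 hφ z)).mem_nhds ⟨hq, hqm⟩,
      ((isOpen_extChartAt_source (I := 𝓘(ℝ, E₀)) q.2).preimage continuous_snd).mem_nhds hz₀]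
      with y' hy' hys
    have h6 := congrArg Prod.snd (hsol y' hy'.1 q.2 z hy'.2.2 hys)
    rw [← h6]
    ext v
    change (y y').2 (hr.dr (φ y') v) = (y y').2 (chartDsymm z (extChartAt 𝓘(ℝ, E) z (φ y'))
      (fderiv ℝ (fun y => extChartAt 𝓘(ℝ, E) z (r y)) (e (φ y')) v))
    rw [hr.fderiv_chart hy'.2.2, chartDsymm_chartD hy'.2.2]

end Family

/-! ### The projection to a cosymplectic submanifold -/

section Projection

variable {E₀ M : Type*} [NormedAddCommGroup E₀] [NormedSpace ℝ E₀] [FiniteDimensional ℝ E₀]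
  [TopologicalSpace M] [ChartedSpace E₀ M] [IsManifold 𝓘(ℝ, E₀) ∞ M]
  {E P : Type*} [NormedAddCommGroup E] [NormedSpace ℝ E] [FiniteDimensional ℝ E]
  [TopologicalSpace P] [ChartedSpace E P] [IsManifold 𝓘(ℝ, E) ∞ P] [T2Space P]
  {H' : Type*} [NormedAddCommGroup H'] [InnerProductSpace ℝ H'] [CompleteSpace H']
  {H : Type*} [NormedAddCommGroup H] [InnerProductSpace ℝ H] [CompleteSpace H]

/-- The projection to the tangent spaces of a cosymplectic submanifold `j : M → P` along the images
of their annihilators depends smoothly on the point. -/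
theorem exists_cosymplectic_projection {B : BilinField E P} (hB : IsPoisson B) {j : M → P}
    (hj : ContMDiff 𝓘(ℝ, E₀) 𝓘(ℝ, E) ∞ j)
    (hnd : ∀ x, IsNondeg (md 𝓘(ℝ, E₀) 𝓘(ℝ, E) j x) (sharpL B (j x)))
    {e : P → H} {O : Set H} {r : H → P} (hr : IsRetraction (E := E) e O r)
    {e' : M → H'} {O' : Set H'} {r' : H' → M} (hr' : IsRetraction (E := E₀) e' O' r') :
    ∃ pr : M → E →L[ℝ] E₀,
      (∀ x v, ∃ ξ : E →L[ℝ] ℝ, md 𝓘(ℝ, E₀) 𝓘(ℝ, E) j x (pr x v) + sharpL B (j x) ξ = v ∧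
        ∀ u, ξ (md 𝓘(ℝ, E₀) 𝓘(ℝ, E) j x u) = 0) ∧
      ContMDiff 𝓘(ℝ, E₀) 𝓘(ℝ, H →L[ℝ] H') ∞
        fun x => hr'.de x ∘L pr x ∘L hr.dr (j x) := by
  have hn : (∞ : WithTop ℕ∞) ≠ 0 := by simp
  -- The component `w` of the solution of `T w + ♯ ξ = v` with `ξ` conormal, as a linear function of
  -- `v`.
  let prL : (x : M) → E →L[ℝ] E₀ := fun x => ContinuousLinearMap.fst ℝ E₀ (E →L[ℝ] ℝ) ∘L
    (sysMat (md 𝓘(ℝ, E₀) 𝓘(ℝ, E) j x) (sharpL B (j x))).inverse ∘L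
      ContinuousLinearMap.inl ℝ E (E₀ →L[ℝ] ℝ)
  have hsol : ∀ x v, ∃ ξ : E →L[ℝ] ℝ, md 𝓘(ℝ, E₀) 𝓘(ℝ, E) j x (prL x v) + sharpL B (j x) ξ = v ∧
      ∀ u, ξ (md 𝓘(ℝ, E₀) 𝓘(ℝ, E) j x u) = 0 := by
    intro x v
    obtain ⟨y, h1, h2⟩ := (hnd x).exists_sol v
    have h3 : prL x v = y.1 := (congrArg Prod.fst ((hnd x).sol_eq h1 h2)).symm
    exact ⟨y.2, by rw [h3, h1], h2⟩
  refine ⟨prL, hsol, fun x₀ => ?_⟩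
  -- The constant family makes the chart computations for families applicable.
  let φ : ℝ × M → P := fun q => j q.2
  have hφ : ContMDiffOn (𝓘(ℝ, ℝ).prod 𝓘(ℝ, E₀)) 𝓘(ℝ, E) ∞ φ univ :=
    (hj.comp contMDiff_snd).contMDiffOn
  set z := j x₀ with hz
  have hmap : ∀ x, j x ∈ (extChartAt 𝓘(ℝ, E) z).source →
      ((0, x) : ℝ × M) ∈ mapDomain (E := E) φ univ z := fun x hx => ⟨mem_univ _, hx⟩
  have hzs : j x₀ ∈ (extChartAt 𝓘(ℝ, E) z).source := mem_extChartAt_source z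
  have hx₀ : x₀ ∈ (extChartAt 𝓘(ℝ, E₀) x₀).source := mem_extChartAt_source x₀
  let A : ℝ × E₀ → (E × (E₀ →L[ℝ] ℝ)) →L[ℝ] (E₀ × (E →L[ℝ] ℝ)) := fun y =>
    (sysMat (partialSnd (chartMap (E₀ := E₀) (E := E) φ x₀ z) y)
      (chartSharp B z (chartMap (E₀ := E₀) (E := E) φ x₀ z y))).inverse
  have hA : ContDiffAt ℝ ∞ A (0, extChartAt 𝓘(ℝ, E₀) x₀ x₀) :=
    (contDiffAt_chartSys hB isOpen_univ hφ (q := (0, x₀)) (hmap x₀ hzs) hx₀ (hnd x₀)).1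
  have h1 : ContMDiffAt 𝓘(ℝ, E₀) 𝓘(ℝ, ℝ × E₀) ∞
      (fun x : M => ((0 : ℝ), extChartAt 𝓘(ℝ, E₀) x₀ x)) x₀ :=
    contMDiffAt_const.prodMk_space (contMDiffAt_chart hx₀)
  have h2 : ContMDiffAt 𝓘(ℝ, E₀) 𝓘(ℝ, E →L[ℝ] E₀) ∞
      (fun x : M => ContinuousLinearMap.fst ℝ E₀ (E →L[ℝ] ℝ) ∘L
        A ((0 : ℝ), extChartAt 𝓘(ℝ, E₀) x₀ x) ∘L ContinuousLinearMap.inl ℝ E (E₀ →L[ℝ] ℝ)) x₀ := by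
    have h3 : ContDiffAt ℝ ∞ (fun y => ContinuousLinearMap.fst ℝ E₀ (E →L[ℝ] ℝ) ∘L
        A y ∘L ContinuousLinearMap.inl ℝ E (E₀ →L[ℝ] ℝ)) (0, extChartAt 𝓘(ℝ, E₀) x₀ x₀) :=
      contDiffAt_const.clm_comp (hA.clm_comp contDiffAt_const)
    exact ContMDiffAt.comp (g := fun y => ContinuousLinearMap.fst ℝ E₀ (E →L[ℝ] ℝ) ∘L
        A y ∘L ContinuousLinearMap.inl ℝ E (E₀ →L[ℝ] ℝ))
      (f := fun x : M => ((0 : ℝ), extChartAt 𝓘(ℝ, E₀) x₀ x)) x₀ h3.contMDiffAt h1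
  have h4 : ContMDiffAt 𝓘(ℝ, E₀) 𝓘(ℝ, H →L[ℝ] E) ∞
      (fun x : M => fderiv ℝ (fun y => extChartAt 𝓘(ℝ, E) z (r y)) (e (j x))) x₀ :=
    (hr.contDiffAt_fderiv_chart hzs).contMDiffAt.comp x₀ ((hr.contMDiff _).comp x₀ (hj x₀))
  have h5 : ContMDiffAt 𝓘(ℝ, E₀) 𝓘(ℝ, E₀ →L[ℝ] H') ∞
      (fun x : M => fderiv ℝ (e' ∘ (extChartAt 𝓘(ℝ, E₀) x₀).symm) (extChartAt 𝓘(ℝ, E₀) x₀ x)) x₀ := by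
    have ho : IsOpen (extChartAt 𝓘(ℝ, E₀) x₀).target := isOpen_extChartAt_target x₀
    have h6 : ContDiffOn ℝ ∞ (e' ∘ (extChartAt 𝓘(ℝ, E₀) x₀).symm)
        (extChartAt 𝓘(ℝ, E₀) x₀).target :=
      (hr'.contMDiff.comp_contMDiffOn (contMDiffOn_extChartAt_symm x₀)).contDiffOn
    have h7 : ContDiffAt ℝ ∞ (fderiv ℝ (e' ∘ (extChartAt 𝓘(ℝ, E₀) x₀).symm))
        (extChartAt 𝓘(ℝ, E₀) x₀ x₀) :=
      (h6.fderiv_of_isOpen ho (by simp)).contDiffAt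
        (ho.mem_nhds ((extChartAt 𝓘(ℝ, E₀) x₀).map_source hx₀))
    exact h7.contMDiffAt.comp x₀ (contMDiffAt_chart hx₀)
  refine (h5.clm_comp (h2.clm_comp h4)).congr_of_eventuallyEq ?_
  filter_upwards [(isOpen_extChartAt_source (I := 𝓘(ℝ, E₀)) x₀).mem_nhds hx₀,
    hj.continuous.continuousAt.preimage_mem_nhds
      ((isOpen_extChartAt_source (I := 𝓘(ℝ, E)) z).mem_nhds hzs)] with x hx hxz
  refine ContinuousLinearMap.ext fun v => ?_
  change hr'.de x (prL x (hr.dr (j x) v)) =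
    fderiv ℝ (e' ∘ (extChartAt 𝓘(ℝ, E₀) x₀).symm) (extChartAt 𝓘(ℝ, E₀) x₀ x)
      (A ((0 : ℝ), extChartAt 𝓘(ℝ, E₀) x₀ x)
        (fderiv ℝ (fun y => extChartAt 𝓘(ℝ, E) z (r y)) (e (j x)) v, 0)).1
  rw [hr.fderiv_chart hxz]
  set u := hr.dr (j x) v
  have h8 : (chartD x₀ x (prL x u)) =
      (A ((0 : ℝ), extChartAt 𝓘(ℝ, E₀) x₀ x) (chartD z (j x) u, 0)).1 := by
    obtain ⟨ξ, h9, h10⟩ := hsol x u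
    have hval : chartMap (E₀ := E₀) (E := E) φ x₀ z (0, extChartAt 𝓘(ℝ, E₀) x₀ x) =
        extChartAt 𝓘(ℝ, E) z (j x) := by
      simp only [chartMap, φ]
      rw [(extChartAt 𝓘(ℝ, E₀) x₀).left_inv hx]
    have hT := partialSnd_chartMap isOpen_univ hφ (q := (0, x)) (hmap x hxz) hx
    have hndx := (isNondeg_chart_iff (B := B) isOpen_univ hφ (q := (0, x)) (hmap x hxz) hx).2 (hnd x)
    have h11 := hndx.sol_eq (y := chartD z (j x) u)
      (z := (chartD x₀ x (prL x u), ξ ∘L chartDsymm z (extChartAt 𝓘(ℝ, E) z (j x)))) ?_ ?_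
    · have h12 := congrArg Prod.fst h11
      simp only [A]
      rw [hval]
      exact h12
    · change partialSnd (chartMap (E₀ := E₀) (E := E) φ x₀ z) (0, extChartAt 𝓘(ℝ, E₀) x₀ x)
        (chartD x₀ x (prL x u)) + chartSharp B z (extChartAt 𝓘(ℝ, E) z (j x))
          (ξ ∘L chartDsymm z (extChartAt 𝓘(ℝ, E) z (j x))) = _
      rw [hT, chartSharp_eq B hxz]
      have h13 : (ξ ∘L chartDsymm z (extChartAt 𝓘(ℝ, E) z (j x))) ∘L chartD z (j x) = ξ := by
        ext v
        exact congrArg ξ (chartDsymm_chartD hxz v)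
      rw [h13]
      exact (map_add (chartD z (j x)) _ _).symm.trans (congrArg (chartD z (j x)) h9)
    · intro v
      have h14 := hT (chartDsymm x₀ (extChartAt 𝓘(ℝ, E₀) x₀ x) v)
      rw [chartD_symm_chart hx] at h14
      change ξ (chartDsymm z (extChartAt 𝓘(ℝ, E) z (j x)) (partialSnd
        (chartMap (E₀ := E₀) (E := E) φ x₀ z) (0, extChartAt 𝓘(ℝ, E₀) x₀ x) v)) = 0
      rw [h14, show φ (0, x) = j x from rfl, chartDsymm_chartD hxz]
      exact h10 _
  rw [← h8]
  exact md_eq_fderiv_chart hx (hr'.contMDiff x) (prL x u)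

end Projection

/-! ### Interpolation between two submanifolds -/

section MdAdd

variable {ES S HS : Type*} [NormedAddCommGroup ES] [NormedSpace ℝ ES] [TopologicalSpace HS]
  {I : ModelWithCorners ℝ ES HS} [TopologicalSpace S] [ChartedSpace HS S]
  {F : Type*} [NormedAddCommGroup F] [NormedSpace ℝ F]

theorem md_add {f g : S → F} {x : S} (hf : MDifferentiableAt I 𝓘(ℝ, F) f x)
    (hg : MDifferentiableAt I 𝓘(ℝ, F) g x) (v : ES) :
    md I 𝓘(ℝ, F) (fun y => f y + g y) x v = md I 𝓘(ℝ, F) f x v + md I 𝓘(ℝ, F) g x v :=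
  congrArg (fun T : ES →L[ℝ] F => T v) (mfderiv_add hf hg)

theorem md_sub {f g : S → F} {x : S} (hf : MDifferentiableAt I 𝓘(ℝ, F) f x)
    (hg : MDifferentiableAt I 𝓘(ℝ, F) g x) (v : ES) :
    md I 𝓘(ℝ, F) (fun y => f y - g y) x v = md I 𝓘(ℝ, F) f x v - md I 𝓘(ℝ, F) g x v :=
  congrArg (fun T : ES →L[ℝ] F => T v) (mfderiv_sub hf hg)

theorem md_smul (a : ℝ) {f : S → F} {x : S} (hf : MDifferentiableAt I 𝓘(ℝ, F) f x) (v : ES) :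
    md I 𝓘(ℝ, F) (fun y => a • f y) x v = a • md I 𝓘(ℝ, F) f x v :=
  congrArg (fun T : ES →L[ℝ] F => T v) (const_smul_mfderiv hf a)

end MdAdd

/-! ### The projected map and the retracted segments -/

section Interpolation

variable {E₀ M₀ : Type*} [NormedAddCommGroup E₀] [NormedSpace ℝ E₀] [FiniteDimensional ℝ E₀]
  [TopologicalSpace M₀] [ChartedSpace E₀ M₀] [IsManifold 𝓘(ℝ, E₀) ∞ M₀]
  {E₁ M₁ : Type*} [NormedAddCommGroup E₁] [NormedSpace ℝ E₁] [FiniteDimensional ℝ E₁]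
  [TopologicalSpace M₁] [ChartedSpace E₁ M₁] [IsManifold 𝓘(ℝ, E₁) ∞ M₁]
  {E P : Type*} [NormedAddCommGroup E] [NormedSpace ℝ E] [FiniteDimensional ℝ E]
  [TopologicalSpace P] [ChartedSpace E P] [IsManifold 𝓘(ℝ, E) ∞ P] [T2Space P]
  {H : Type*} [NormedAddCommGroup H] [InnerProductSpace ℝ H] [CompleteSpace H]
  {C : Type*} {i₀ : C → M₀} {i₁ : C → M₁} {j₀ : M₀ → P} {j₁ : M₁ → P}

/-- There is a map from `M₀` to the cosymplectic submanifold `M₁` near a common part of both whose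
differential is the projection along the images of the annihilators of the tangent spaces. -/
theorem exists_projected_map {B : BilinField E P} (hB : IsPoisson B)
    (hj₀ : ContMDiff 𝓘(ℝ, E₀) 𝓘(ℝ, E) ∞ j₀) (hj₁ : ContMDiff 𝓘(ℝ, E₁) 𝓘(ℝ, E) ∞ j₁)
    (hnd : ∀ x, IsNondeg (md 𝓘(ℝ, E₁) 𝓘(ℝ, E) j₁ x) (sharpL B (j₁ x)))
    (hij : ∀ c, j₀ (i₀ c) = j₁ (i₁ c))
    {e : P → H} {O : Set H} {r : H → P} (hr : IsRetraction (E := E) e O r)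
    {O₁ : Set H} {r₁ : H → M₁} (hr₁ : IsRetraction (E := E₁) (e ∘ j₁) O₁ r₁) :
    ∃ (W : Set M₀) (σ : M₀ → M₁), IsOpen W ∧ (∀ c, i₀ c ∈ W) ∧
      ContMDiffOn 𝓘(ℝ, E₀) 𝓘(ℝ, E₁) ∞ σ W ∧ (∀ c, σ (i₀ c) = i₁ c) ∧
      ∀ c v, ∃ ξ : E →L[ℝ] ℝ,
        md 𝓘(ℝ, E₁) 𝓘(ℝ, E) j₁ (i₁ c) (md 𝓘(ℝ, E₀) 𝓘(ℝ, E₁) σ (i₀ c) v) +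
          sharpL B (j₁ (i₁ c)) ξ = md 𝓘(ℝ, E₀) 𝓘(ℝ, E) j₀ (i₀ c) v ∧
        ∀ u, ξ (md 𝓘(ℝ, E₁) 𝓘(ℝ, E) j₁ (i₁ c) u) = 0 := by
  have hn : (∞ : WithTop ℕ∞) ≠ 0 := by simp
  obtain ⟨pr, hpr, hL⟩ := exists_cosymplectic_projection hB hj₁ hnd hr hr₁
  let L : M₁ → H →L[ℝ] H := fun x => hr₁.de x ∘L pr x ∘L hr.dr (j₁ x)
  have hprj : ∀ x u, pr x (md 𝓘(ℝ, E₁) 𝓘(ℝ, E) j₁ x u) = u := by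
    intro x u
    obtain ⟨ξ, h1, h2⟩ := hpr x (md 𝓘(ℝ, E₁) 𝓘(ℝ, E) j₁ x u)
    refine sub_eq_zero.1 (hnd x (pr x (md 𝓘(ℝ, E₁) 𝓘(ℝ, E) j₁ x u) - u) ξ ?_ h2).1
    rw [map_sub, sub_add_eq_add_sub, h1, sub_self]
  have he₀ : ContMDiff 𝓘(ℝ, E₀) 𝓘(ℝ, H) ∞ (e ∘ j₀) := hr.contMDiff.comp hj₀
  let W₁ : Set M₀ := (e ∘ j₀) ⁻¹' O₁
  have hW₁ : IsOpen W₁ := hr₁.isOpen.preimage he₀.continuous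
  have hiW₁ : ∀ c, i₀ c ∈ W₁ := fun c => by
    change e (j₀ (i₀ c)) ∈ O₁
    rw [hij]
    exact hr₁.mem _
  let y : M₀ → M₁ := fun x => r₁ (e (j₀ x))
  have hy : ContMDiffOn 𝓘(ℝ, E₀) 𝓘(ℝ, E₁) ∞ y W₁ :=
    hr₁.contMDiffOn.comp he₀.contMDiffOn fun x hx => hx
  have hyi : ∀ c, y (i₀ c) = i₁ c := fun c => by
    simp only [y]
    rw [hij]
    exact hr₁.left_inv _
  let b : M₀ → H := fun x => (e ∘ j₀) x - ((e ∘ j₁) ∘ y) x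
  have he₁y : ContMDiffOn 𝓘(ℝ, E₀) 𝓘(ℝ, H) ∞ ((e ∘ j₁) ∘ y) W₁ := hr₁.contMDiff.comp_contMDiffOn hy
  have hb : ContMDiffOn 𝓘(ℝ, E₀) 𝓘(ℝ, H) ∞ b W₁ := he₀.contMDiffOn.sub he₁y
  have hbi : ∀ c, b (i₀ c) = 0 := fun c => by
    simp only [b, Function.comp_apply]
    rw [hyi, hij, sub_self]
  have hLy : ContMDiffOn 𝓘(ℝ, E₀) 𝓘(ℝ, H →L[ℝ] H) ∞ (fun x => L (y x)) W₁ :=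
    hL.comp_contMDiffOn hy
  -- The differential of `y` along `C` is not prescribed. The added term vanishes on `C` and
  -- corrects it to first order: `dy + pr ∘ (dj₀ - dj₁ ∘ dy) = pr ∘ dj₀`. The retraction `r₁` brings
  -- the values back to `M₁`.
  let ε : M₀ → H := fun x => ((e ∘ j₁) ∘ y) x + L (y x) (b x)
  have hLb : ContMDiffOn 𝓘(ℝ, E₀) 𝓘(ℝ, H) ∞ (fun x => L (y x) (b x)) W₁ := hLy.clm_apply hb
  have hε : ContMDiffOn 𝓘(ℝ, E₀) 𝓘(ℝ, H) ∞ ε W₁ := he₁y.add hLb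
  have hεi : ∀ c, ε (i₀ c) = (e ∘ j₁) (i₁ c) := fun c => by
    change (e ∘ j₁) (y (i₀ c)) + L (y (i₀ c)) (b (i₀ c)) = _
    rw [hbi, map_zero, add_zero, hyi]
  let W : Set M₀ := W₁ ∩ ε ⁻¹' O₁
  have hW : IsOpen W := hε.continuousOn.isOpen_inter_preimage hW₁ hr₁.isOpen
  have hiW : ∀ c, i₀ c ∈ W := fun c => ⟨hiW₁ c, by
    change ε (i₀ c) ∈ O₁
    rw [hεi]
    exact hr₁.mem _⟩
  refine ⟨W, fun x => r₁ (ε x), hW, hiW,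
    hr₁.contMDiffOn.comp (hε.mono inter_subset_left) fun x hx => hx.2, fun c => ?_, fun c v => ?_⟩
  · change r₁ (ε (i₀ c)) = i₁ c
    rw [hεi]
    exact hr₁.left_inv _
  · have hm := hW₁.mem_nhds (hiW₁ c)
    have hyd := (hy.contMDiffAt hm).mdifferentiableAt hn
    have he₁d : MDifferentiableAt 𝓘(ℝ, E₁) 𝓘(ℝ, H) (e ∘ j₁) (y (i₀ c)) :=
      (hr₁.contMDiff _).mdifferentiableAt hn
    have hDe₀ : md 𝓘(ℝ, E₀) 𝓘(ℝ, H) (e ∘ j₀) (i₀ c) v =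
        hr.de (j₁ (i₁ c)) (md 𝓘(ℝ, E₀) 𝓘(ℝ, E) j₀ (i₀ c) v) := by
      rw [← hij]
      exact md_comp ((hr.contMDiff _).mdifferentiableAt hn) ((hj₀ _).mdifferentiableAt hn) v
    have hDe₁ : ∀ u, hr₁.de (i₁ c) u =
        hr.de (j₁ (i₁ c)) (md 𝓘(ℝ, E₁) 𝓘(ℝ, E) j₁ (i₁ c) u) := fun u =>
      md_comp ((hr.contMDiff _).mdifferentiableAt hn) ((hj₁ _).mdifferentiableAt hn) u
    have hDy : md 𝓘(ℝ, E₀) 𝓘(ℝ, H) ((e ∘ j₁) ∘ y) (i₀ c) v =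
        hr₁.de (i₁ c) (md 𝓘(ℝ, E₀) 𝓘(ℝ, E₁) y (i₀ c) v) := by
      rw [md_comp he₁d hyd, hyi]
      rfl
    have hDb : md 𝓘(ℝ, E₀) 𝓘(ℝ, H) b (i₀ c) v =
        hr.de (j₁ (i₁ c)) (md 𝓘(ℝ, E₀) 𝓘(ℝ, E) j₀ (i₀ c) v) -
          hr.de (j₁ (i₁ c)) (md 𝓘(ℝ, E₁) 𝓘(ℝ, E) j₁ (i₁ c)
            (md 𝓘(ℝ, E₀) 𝓘(ℝ, E₁) y (i₀ c) v)) := by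
      rw [← hDe₁, ← hDe₀, ← hDy]
      exact md_sub ((he₀ _).mdifferentiableAt hn) ((he₁y.contMDiffAt hm).mdifferentiableAt hn) v
    have hDLb : md 𝓘(ℝ, E₀) 𝓘(ℝ, H) (fun x => L (y x) (b x)) (i₀ c) v =
        L (i₁ c) (md 𝓘(ℝ, E₀) 𝓘(ℝ, H) b (i₀ c) v) := by
      rw [← hyi]
      exact mfderiv_clm_apply_of_eq_zero (hLy.contMDiffAt hm) (hb.contMDiffAt hm) (hbi c) v
    have hDε : md 𝓘(ℝ, E₀) 𝓘(ℝ, H) ε (i₀ c) v =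
        hr₁.de (i₁ c) (pr (i₁ c) (md 𝓘(ℝ, E₀) 𝓘(ℝ, E) j₀ (i₀ c) v)) := by
      have h1 : md 𝓘(ℝ, E₀) 𝓘(ℝ, H) ε (i₀ c) v = md 𝓘(ℝ, E₀) 𝓘(ℝ, H) ((e ∘ j₁) ∘ y) (i₀ c) v +
          md 𝓘(ℝ, E₀) 𝓘(ℝ, H) (fun x => L (y x) (b x)) (i₀ c) v :=
        md_add ((he₁y.contMDiffAt hm).mdifferentiableAt hn)
          ((hLb.contMDiffAt hm).mdifferentiableAt hn) v
      rw [h1, hDLb, hDb, hDy, ← map_sub]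
      change _ + hr₁.de (i₁ c) (pr (i₁ c) (hr.dr (j₁ (i₁ c)) (hr.de (j₁ (i₁ c)) _))) = _
      rw [hr.dr_de, map_sub, hprj, map_sub, add_sub_cancel]
    have hDσ : md 𝓘(ℝ, E₀) 𝓘(ℝ, E₁) (fun x => r₁ (ε x)) (i₀ c) v =
        pr (i₁ c) (md 𝓘(ℝ, E₀) 𝓘(ℝ, E) j₀ (i₀ c) v) := by
      have h1 : MDifferentiableAt 𝓘(ℝ, H) 𝓘(ℝ, E₁) r₁ (ε (i₀ c)) := by
        rw [hεi]
        exact (hr₁.contMDiffAt_r _).mdifferentiableAt hn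
      have h2 := md_comp (f := ε) (g := r₁) h1 ((hε.contMDiffAt hm).mdifferentiableAt hn) v
      rw [hDε, hεi] at h2
      exact h2.trans (hr₁.dr_de _ _)
    rw [hDσ]
    exact hpr (i₁ c) _

/-- The family of maps that interpolates between `j₀` and `j₁ ∘ σ`. -/
theorem exists_interpolation (hj₀ : ContMDiff 𝓘(ℝ, E₀) 𝓘(ℝ, E) ∞ j₀)
    (hj₁ : ContMDiff 𝓘(ℝ, E₁) 𝓘(ℝ, E) ∞ j₁) (hij : ∀ c, j₀ (i₀ c) = j₁ (i₁ c))
    {e : P → H} {O : Set H} {r : H → P} (hr : IsRetraction (E := E) e O r)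
    {W : Set M₀} {σ : M₀ → M₁} (hW : IsOpen W) (hiW : ∀ c, i₀ c ∈ W)
    (hσ : ContMDiffOn 𝓘(ℝ, E₀) 𝓘(ℝ, E₁) ∞ σ W) (hσi : ∀ c, σ (i₀ c) = i₁ c) :
    ∃ (𝒲 : Set (ℝ × M₀)) (φ : ℝ × M₀ → P), IsOpen 𝒲 ∧ (∀ q ∈ 𝒲, q.2 ∈ W) ∧
      (∀ s c, (s, i₀ c) ∈ 𝒲) ∧
      ContMDiffOn (𝓘(ℝ, ℝ).prod 𝓘(ℝ, E₀)) 𝓘(ℝ, E) ∞ φ 𝒲 ∧ (∀ s c, φ (s, i₀ c) = j₀ (i₀ c)) ∧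
      (∀ x, φ (0, x) = j₀ x) ∧ (∀ x, φ (1, x) = j₁ (σ x)) ∧
      (∀ s c v, dx φ (s, i₀ c) v = (1 - s) • md 𝓘(ℝ, E₀) 𝓘(ℝ, E) j₀ (i₀ c) v +
        s • md 𝓘(ℝ, E₁) 𝓘(ℝ, E) j₁ (i₁ c) (md 𝓘(ℝ, E₀) 𝓘(ℝ, E₁) σ (i₀ c) v)) ∧
      ∀ s c, dt (E := E) φ (s, i₀ c) = 0 := by
  have hn : (∞ : WithTop ℕ∞) ≠ 0 := by simp
  let f₀ : M₀ → H := e ∘ j₀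
  let f₁ : M₀ → H := (e ∘ j₁) ∘ σ
  have hf₀ : ContMDiff 𝓘(ℝ, E₀) 𝓘(ℝ, H) ∞ f₀ := hr.contMDiff.comp hj₀
  have hf₁ : ContMDiffOn 𝓘(ℝ, E₀) 𝓘(ℝ, H) ∞ f₁ W := (hr.contMDiff.comp hj₁).comp_contMDiffOn hσ
  have hf₁i : ∀ c, f₁ (i₀ c) = f₀ (i₀ c) := fun c => by
    simp only [f₁, f₀, Function.comp_apply]
    rw [hσi, hij]
  -- The segment in the Hilbert space, to be retracted to `P`. Over `C` its end points coincide, so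
  -- it is constant there.
  let k : ℝ × M₀ → H := fun q => (1 - q.1) • f₀ q.2 + q.1 • f₁ q.2
  have hki : ∀ s c, k (s, i₀ c) = e (j₀ (i₀ c)) := fun s c => by
    simp only [k]
    rw [hf₁i, ← add_smul, sub_add_cancel, one_smul]
    rfl
  have hWo : IsOpen (Prod.snd ⁻¹' W : Set (ℝ × M₀)) := hW.preimage continuous_snd
  have hk : ContMDiffOn (𝓘(ℝ, ℝ).prod 𝓘(ℝ, E₀)) 𝓘(ℝ, H) ∞ k (Prod.snd ⁻¹' W) := by
    have h1 : ContMDiffOn (𝓘(ℝ, ℝ).prod 𝓘(ℝ, E₀)) 𝓘(ℝ, ℝ) ∞ (Prod.fst : ℝ × M₀ → ℝ)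
      (Prod.snd ⁻¹' W) := contMDiffOn_fst
    exact ((contMDiffOn_const.sub h1).smul (hf₀.comp_contMDiffOn contMDiffOn_snd)).add
      (h1.smul (hf₁.comp contMDiffOn_snd fun _ hq => hq))
  refine ⟨Prod.snd ⁻¹' W ∩ k ⁻¹' O, fun q => r (k q),
    hk.continuousOn.isOpen_inter_preimage hWo hr.isOpen, fun q hq => hq.1, fun s c => ⟨hiW c, ?_⟩,
    hr.contMDiffOn.comp (hk.mono inter_subset_left) fun q hq => hq.2, fun s c => ?_, fun x => ?_,
    fun x => ?_, fun s c v => ?_, fun s c => ?_⟩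
  · rw [mem_preimage, hki]
    exact hr.mem _
  · change r (k (s, i₀ c)) = _
    rw [hki, hr.left_inv]
  · simp only [k, sub_zero, one_smul, zero_smul, add_zero]
    exact hr.left_inv _
  · simp only [k, sub_self, one_smul, zero_smul, zero_add]
    exact hr.left_inv _
  · have hm := hW.mem_nhds (hiW c)
    have hσd := (hσ.contMDiffAt hm).mdifferentiableAt hn
    have hd₀ : MDifferentiableAt 𝓘(ℝ, E₀) 𝓘(ℝ, H) f₀ (i₀ c) := (hf₀ _).mdifferentiableAt hn
    have hd₁ : MDifferentiableAt 𝓘(ℝ, E₀) 𝓘(ℝ, H) f₁ (i₀ c) :=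
      (hf₁.contMDiffAt hm).mdifferentiableAt hn
    have hD₀ : md 𝓘(ℝ, E₀) 𝓘(ℝ, H) f₀ (i₀ c) v =
        hr.de (j₀ (i₀ c)) (md 𝓘(ℝ, E₀) 𝓘(ℝ, E) j₀ (i₀ c) v) :=
      md_comp ((hr.contMDiff _).mdifferentiableAt hn) ((hj₀ _).mdifferentiableAt hn) v
    have hD₁ : md 𝓘(ℝ, E₀) 𝓘(ℝ, H) f₁ (i₀ c) v = hr.de (j₀ (i₀ c))
        (md 𝓘(ℝ, E₁) 𝓘(ℝ, E) j₁ (i₁ c) (md 𝓘(ℝ, E₀) 𝓘(ℝ, E₁) σ (i₀ c) v)) := by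
      have h1 := md_comp (g := e ∘ j₁) (f := σ) (x := i₀ c)
        (((hr.contMDiff.comp hj₁) _).mdifferentiableAt hn) hσd v
      rw [hσi] at h1
      have h2 := md_comp (g := e) (f := j₁) (x := i₁ c) (I := 𝓘(ℝ, E₁)) (I'' := 𝓘(ℝ, H))
        ((hr.contMDiff _).mdifferentiableAt hn)
        ((hj₁ _).mdifferentiableAt hn) (md 𝓘(ℝ, E₀) 𝓘(ℝ, E₁) σ (i₀ c) v)
      rw [← hij] at h2
      exact h1.trans h2
    have hDk : md 𝓘(ℝ, E₀) 𝓘(ℝ, H) (fun x => k (s, x)) (i₀ c) v =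
        (1 - s) • md 𝓘(ℝ, E₀) 𝓘(ℝ, H) f₀ (i₀ c) v + s • md 𝓘(ℝ, E₀) 𝓘(ℝ, H) f₁ (i₀ c) v := by
      rw [← md_smul _ hd₀, ← md_smul _ hd₁]
      exact md_add (hd₀.const_smul (1 - s)) (hd₁.const_smul s) v
    have hkd : MDifferentiableAt 𝓘(ℝ, E₀) 𝓘(ℝ, H) (fun x => k (s, x)) (i₀ c) :=
      (hd₀.const_smul (1 - s)).add (hd₁.const_smul s)
    have h1 : MDifferentiableAt 𝓘(ℝ, H) 𝓘(ℝ, E) r (k (s, i₀ c)) := by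
      rw [hki]
      exact (hr.contMDiffAt_r _).mdifferentiableAt hn
    have h2 := md_comp (g := r) (f := fun x => k (s, x)) h1 hkd v
    have h3 : ∀ a b : E, (1 - s) • hr.de (j₀ (i₀ c)) a + s • hr.de (j₀ (i₀ c)) b =
        hr.de (j₀ (i₀ c)) ((1 - s) • a + s • b) := fun a b => by
      rw [map_add, map_smul, map_smul]
    rw [hDk, hki, hD₀, hD₁, h3] at h2
    exact h2.trans (hr.dr_de _ _)
  · have h1 : (fun s => r (k (s, i₀ c))) = fun _ => r (e (j₀ (i₀ c))) := by
      funext s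
      rw [hki]
    change md 𝓘(ℝ, ℝ) 𝓘(ℝ, E) (fun s => r (k (s, i₀ c))) s 1 = 0
    rw [h1]
    exact congrArg (fun T : ℝ →L[ℝ] E => T 1) mfderiv_const

end Interpolation

/-! ### Hamiltonian isotopies -/

section Isotopy

variable {E₀ M : Type*} [NormedAddCommGroup E₀] [NormedSpace ℝ E₀] [FiniteDimensional ℝ E₀]
  [TopologicalSpace M] [ChartedSpace E₀ M] [IsManifold 𝓘(ℝ, E₀) ∞ M]
  {E P : Type*} [NormedAddCommGroup E] [NormedSpace ℝ E] [FiniteDimensional ℝ E]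
  [TopologicalSpace P] [ChartedSpace E P] [IsManifold 𝓘(ℝ, E) ∞ P]
  {H : Type*} [NormedAddCommGroup H] [InnerProductSpace ℝ H] [CompleteSpace H]
  {C : Type*} [TopologicalSpace C] {i₀ : C → M} {i : C → P}
  {φ : ℝ × M → P} {𝒲 : Set (ℝ × M)}

theorem mfderiv_family {q : ℝ × M}
    (hφ : MDifferentiableAt (𝓘(ℝ, ℝ).prod 𝓘(ℝ, E₀)) 𝓘(ℝ, E) φ q) (a : ℝ) (v : E₀) :
    md (𝓘(ℝ, ℝ).prod 𝓘(ℝ, E₀)) 𝓘(ℝ, E) φ q (a, v) = a • dt (E := E) φ q + dx φ q v := by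
  have h1 : md (𝓘(ℝ, ℝ).prod 𝓘(ℝ, E₀)) 𝓘(ℝ, E) φ q (a, v) =
      md 𝓘(ℝ, ℝ) 𝓘(ℝ, E) (fun s => φ (s, q.2)) q.1 a + dx φ q v :=
    mfderiv_prod_eq_add_apply (v := (a, v)) hφ
  have h2 : md 𝓘(ℝ, ℝ) 𝓘(ℝ, E) (fun s => φ (s, q.2)) q.1 a = a • dt (E := E) φ q := by
    rw [dt, ← map_smul, smul_eq_mul, mul_one]
  rw [h1, h2]

theorem HasVelocity.family {δ : ℝ → M} {θ : ℝ → ℝ} {t a : ℝ} {X : E₀} (h : HasVelocity δ t X)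
    (hθ : HasDerivAt θ a t)
    (hφ : MDifferentiableAt (𝓘(ℝ, ℝ).prod 𝓘(ℝ, E₀)) 𝓘(ℝ, E) φ (θ t, δ t)) :
    HasVelocity (fun t => φ (θ t, δ t)) t
      (a • dt (E := E) φ (θ t, δ t) + dx φ (θ t, δ t) X) := by
  have h1 : HasMFDerivWithinAt 𝓘(ℝ, ℝ) 𝓘(ℝ, ℝ) θ (Icc 0 1) t
      ((1 : ℝ →L[ℝ] ℝ).smulRight a) := hθ.hasFDerivAt.hasMFDerivAt.hasMFDerivWithinAt
  have h2 := hφ.hasMFDerivAt.comp_hasMFDerivWithinAt t (h1.prodMk h)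
  refine HasMFDerivWithinAt.congr_mfderiv h2 ?_
  refine ContinuousLinearMap.ext fun (b : ℝ) => ?_
  change md (𝓘(ℝ, ℝ).prod 𝓘(ℝ, E₀)) 𝓘(ℝ, E) φ (θ t, δ t) (b • a, b • X) = b • (_ : E)
  rw [← mfderiv_family hφ, ← map_smul]
  rfl

/-- For a family of immersions `φ s` and covectors `ξ` that annihilate the images of their
differentials, there is a family of functions with the differentials `ξ`. -/
theorem exists_generating_function [TopologicalSpace.MetrizableSpace M] [Nonempty M]
    (h𝒲 : IsOpen 𝒲) (hφ : ContMDiffOn (𝓘(ℝ, ℝ).prod 𝓘(ℝ, E₀)) 𝓘(ℝ, E) ∞ φ 𝒲)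
    {e : P → H} {O : Set H} {r : H → P} (hr : IsRetraction (E := E) e O r)
    {ξ : ℝ × M → E →L[ℝ] ℝ}
    (hξ : ContMDiffOn (𝓘(ℝ, ℝ).prod 𝓘(ℝ, E₀)) 𝓘(ℝ, H →L[ℝ] ℝ) ∞ (fun q => ξ q ∘L hr.dr (φ q)) 𝒲)
    (hξφ : ∀ q ∈ 𝒲, ∀ v : E₀, ξ q (dx φ q v) = 0) (hi₀ : Continuous i₀)
    (hi : Topology.IsInducing i) (hmem : ∀ s c, (s, i₀ c) ∈ 𝒲)
    (hφi : ∀ s c, φ (s, i₀ c) = i c)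
    (hinj : ∀ s c v, dx (E₀ := E₀) (E := E) φ (s, i₀ c) v = 0 → v = 0) :
    ∃ (𝒩 : Set (ℝ × P)) (𝒲' : Set (ℝ × M)) (f : ℝ × P → ℝ), IsOpen 𝒩 ∧ IsOpen 𝒲' ∧ 𝒲' ⊆ 𝒲 ∧
      (∀ s c, (s, i₀ c) ∈ 𝒲') ∧ (∀ q ∈ 𝒲', (q.1, φ q) ∈ 𝒩) ∧
      ContMDiffOn (𝓘(ℝ, ℝ).prod 𝓘(ℝ, E)) 𝓘(ℝ, ℝ) ∞ f 𝒩 ∧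
      ∀ q ∈ 𝒲', ∀ v, md 𝓘(ℝ, E) 𝓘(ℝ, ℝ) (fun p => f (q.1, p)) (φ q) v = ξ q v := by
  have hn : (∞ : WithTop ℕ∞) ≠ 0 := by simp
  have heφ : ContMDiffOn (𝓘(ℝ, ℝ).prod 𝓘(ℝ, E₀)) 𝓘(ℝ, H) ∞ (fun q => e (φ q)) 𝒲 :=
    hr.contMDiff.comp_contMDiffOn hφ
  -- Keeping the time as a coordinate, one left inverse serves all the immersions `φ s` near `C` and
  -- depends smoothly on `s`.
  obtain ⟨𝒪, 𝒲', ϖ, h𝒪, h𝒲', hsub, hiW, hm𝒪, hϖ, hϖφ⟩ := exists_leftInverse_prod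
    (I := 𝓘(ℝ, ℝ).prod 𝓘(ℝ, E₀)) (i := fun y : ℝ × C => (y.1, i₀ y.2))
    (a := (Prod.fst : ℝ × M → ℝ)) (b := fun q => e (φ q))
    (continuous_fst.prodMk (hi₀.comp continuous_snd)) h𝒲 (fun y => hmem y.1 y.2) contMDiffOn_fst heφ
    (by
      rintro ⟨s, c⟩ ⟨a, v⟩ h1 h2
      have h3 : a = 0 := by
        have h4 := congrArg (fun T : ℝ × E₀ →L[ℝ] ℝ => T (a, v))
          (mfderiv_fst (I := 𝓘(ℝ, ℝ)) (I' := 𝓘(ℝ, E₀)) (x := (s, i₀ c)))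
        exact h4.symm.trans h1
      subst h3
      have hφd := (hφ.contMDiffAt (h𝒲.mem_nhds (hmem s c))).mdifferentiableAt hn
      have h4 := md_comp (g := e) (f := φ) (I'' := 𝓘(ℝ, H))
        ((hr.contMDiff _).mdifferentiableAt hn) hφd ((0 : ℝ), v)
      rw [mfderiv_family hφd, zero_smul, zero_add] at h4
      have h5 : hr.de (φ (s, i₀ c)) (dx φ (s, i₀ c) v) = 0 := h4.symm.trans h2
      have h6 := hinj s c v ((map_eq_zero_iff _ (hr.de_injective _)).1 h5)
      subst h6
      rfl)
    (by
      have h1 : (fun y : ℝ × C => (y.1, e (φ (y.1, i₀ y.2)))) = Prod.map id (e ∘ i) := by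
        funext y
        exact Prod.ext rfl (congrArg e (hφi y.1 y.2))
      change Topology.IsInducing (fun y : ℝ × C => (y.1, e (φ (y.1, i₀ y.2))))
      rw [h1]
      exact Topology.IsInducing.id.prodMap (hr.isEmbedding.isInducing.comp hi))
  let ι : ℝ × P → ℝ × H := fun y => (y.1, e y.2)
  have hι : ContMDiff (𝓘(ℝ, ℝ).prod 𝓘(ℝ, E)) 𝓘(ℝ, ℝ × H) ∞ ι :=
    contMDiff_fst.prodMk_space (hr.contMDiff.comp contMDiff_snd)
  let y : ℝ × P → ℝ × M := fun p => (p.1, (ϖ (ι p)).2)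
  have h𝒩₁ : IsOpen (ι ⁻¹' 𝒪) := h𝒪.preimage hι.continuous
  have hy : ContMDiffOn (𝓘(ℝ, ℝ).prod 𝓘(ℝ, E)) (𝓘(ℝ, ℝ).prod 𝓘(ℝ, E₀)) ∞ y (ι ⁻¹' 𝒪) :=
    contMDiffOn_fst.prodMk
      (contMDiff_snd.comp_contMDiffOn (hϖ.comp hι.contMDiffOn fun _ hp => hp))
  let 𝒩 : Set (ℝ × P) := ι ⁻¹' 𝒪 ∩ y ⁻¹' 𝒲
  have h𝒩 : IsOpen 𝒩 := hy.continuousOn.isOpen_inter_preimage h𝒩₁ h𝒲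
  let A : ℝ × M → H →L[ℝ] ℝ := fun q => ξ q ∘L hr.dr (φ q)
  -- `f` applies `ξ` to the displacement of `p` from the point `φ (y p)` of the image. On the image
  -- the displacement vanishes, so only its derivative counts; this is `v` minus a vector tangent to
  -- the image, and `ξ` annihilates the latter.
  let f : ℝ × P → ℝ := fun p => A (y p) (e p.2 - e (φ (y p)))
  have hyφ : ∀ q ∈ 𝒲', y (q.1, φ q) = q := fun q hq =>
    Prod.ext rfl (show (ϖ (q.1, e (φ q))).2 = q.2 from congrArg Prod.snd (hϖφ q hq))
  have hmem𝒩 : ∀ q ∈ 𝒲', (q.1, φ q) ∈ 𝒩 := fun q hq => ⟨hm𝒪 q hq, by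
    rw [mem_preimage, hyφ q hq]
    exact hsub hq⟩
  have hAy : ContMDiffOn (𝓘(ℝ, ℝ).prod 𝓘(ℝ, E)) 𝓘(ℝ, H →L[ℝ] ℝ) ∞ (fun p => A (y p)) 𝒩 :=
    hξ.comp (hy.mono inter_subset_left) fun _ hp => hp.2
  have heφy : ContMDiffOn (𝓘(ℝ, ℝ).prod 𝓘(ℝ, E)) 𝓘(ℝ, H) ∞ (fun p => e (φ (y p))) 𝒩 :=
    heφ.comp (hy.mono inter_subset_left) fun _ hp => hp.2
  have hb : ContMDiffOn (𝓘(ℝ, ℝ).prod 𝓘(ℝ, E)) 𝓘(ℝ, H) ∞ (fun p => e p.2 - e (φ (y p))) 𝒩 :=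
    (hr.contMDiff.comp_contMDiffOn contMDiffOn_snd).sub heφy
  refine ⟨𝒩, 𝒲', f, h𝒩, h𝒲', hsub, fun s c => hiW (s, c), hmem𝒩, hAy.clm_apply hb,
    fun q hq v => ?_⟩
  have hm := h𝒩.mem_nhds (hmem𝒩 q hq)
  have hfix : ContMDiffAt 𝓘(ℝ, E) (𝓘(ℝ, ℝ).prod 𝓘(ℝ, E)) ∞ (fun p : P => (q.1, p)) (φ q) :=
    contMDiffAt_const.prodMk contMDiffAt_id
  have hA' : ContMDiffAt 𝓘(ℝ, E) 𝓘(ℝ, H →L[ℝ] ℝ) ∞ (fun p => A (y (q.1, p))) (φ q) :=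
    ContMDiffAt.comp (g := fun p => A (y p)) (φ q) (hAy.contMDiffAt hm) hfix
  have hb' : ContMDiffAt 𝓘(ℝ, E) 𝓘(ℝ, H) ∞ (fun p => e p - e (φ (y (q.1, p)))) (φ q) :=
    ContMDiffAt.comp (g := fun p : ℝ × P => e p.2 - e (φ (y p))) (φ q) (hb.contMDiffAt hm) hfix
  have hb0 : e (φ q) - e (φ (y (q.1, φ q))) = 0 := by rw [hyφ q hq, sub_self]
  have h1 : md 𝓘(ℝ, E) 𝓘(ℝ, ℝ) (fun p => f (q.1, p)) (φ q) v =
      A (y (q.1, φ q)) (md 𝓘(ℝ, E) 𝓘(ℝ, H) (fun p => e p - e (φ (y (q.1, p)))) (φ q) v) :=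
    mfderiv_clm_apply_of_eq_zero hA' hb' hb0 v
  let y' : P → M := fun p => (ϖ (ι (q.1, p))).2
  have hy' : ContMDiffAt 𝓘(ℝ, E) 𝓘(ℝ, E₀) ∞ y' (φ q) :=
    ContMDiffAt.comp (g := Prod.snd) (f := y ∘ Prod.mk q.1) (φ q) contMDiffAt_snd
      (ContMDiffAt.comp (g := y) (φ q) (hy.contMDiffAt (h𝒩₁.mem_nhds (hmem𝒩 q hq).1)) hfix)
  have hy'q : y' (φ q) = q.2 :=
    show (ϖ (q.1, e (φ q))).2 = q.2 from congrArg Prod.snd (hϖφ q hq)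
  have hs : ContMDiffAt 𝓘(ℝ, E₀) 𝓘(ℝ, E) ∞ (fun x => φ (q.1, x)) (y' (φ q)) := by
    rw [hy'q]
    exact contMDiffAt_space h𝒲 hφ (hsub hq)
  have h2 := md_comp (g := fun x => φ (q.1, x)) (f := y') (hs.mdifferentiableAt hn)
    (hy'.mdifferentiableAt hn) v
  have h3 := md_comp (I'' := 𝓘(ℝ, H)) (g := e) (f := (fun x => φ (q.1, x)) ∘ y') (x := φ q)
    ((hr.contMDiff _).mdifferentiableAt hn) ((hs.comp _ hy').mdifferentiableAt hn) v
  have h4 : md 𝓘(ℝ, E) 𝓘(ℝ, H) (fun p => e p - e (φ (y (q.1, p)))) (φ q) v =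
      hr.de (φ q) v - hr.de (φ q) (dx φ q (md 𝓘(ℝ, E) 𝓘(ℝ, E₀) y' (φ q) v)) := by
    have h5 := md_sub (f := e) (g := e ∘ (fun x => φ (q.1, x)) ∘ y') (x := φ q)
      ((hr.contMDiff _).mdifferentiableAt hn)
      (((hr.contMDiff _).comp _ (hs.comp _ hy')).mdifferentiableAt hn) v
    refine h5.trans ?_
    rw [h3, h2]
    simp only [Function.comp_apply]
    rw [hy'q]
    rfl
  rw [h1, h4, hyφ q hq]
  change ξ q (hr.dr (φ q) (_ - _)) = ξ q v
  rw [map_sub, hr.dr_de, hr.dr_de, map_sub, hξφ q (hsub hq), sub_zero]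

end Isotopy

/-! ### From the generating function to the Hamiltonian isotopy -/

section Isotopy

variable {E₀ M : Type*} [NormedAddCommGroup E₀] [NormedSpace ℝ E₀] [FiniteDimensional ℝ E₀]
  [TopologicalSpace M] [ChartedSpace E₀ M] [IsManifold 𝓘(ℝ, E₀) ∞ M]
  {E P : Type*} [NormedAddCommGroup E] [NormedSpace ℝ E] [FiniteDimensional ℝ E]
  [TopologicalSpace P] [ChartedSpace E P] [IsManifold 𝓘(ℝ, E) ∞ P]
  {H : Type*} [NormedAddCommGroup H] [InnerProductSpace ℝ H] [CompleteSpace H]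
  {C : Type*} [TopologicalSpace C] {i₀ : C → M} {i : C → P}
  {φ : ℝ × M → P} {𝒲 : Set (ℝ × M)}

theorem hamVector_eq (B : BilinField E P) {f : P → ℝ} {p : P} {ξ : E →L[ℝ] ℝ}
    (h : ∀ v, md 𝓘(ℝ, E) 𝓘(ℝ, ℝ) f p v = ξ v) : hamVector B f p = sharpL B p ξ :=
  congrArg (sharp (bil B p)) (LinearMap.ext fun v => h v)

theorem isOpen_setOf_forall_mem {X : Type*} [TopologicalSpace X] {𝒩 : Set (ℝ × X)}
    (h : IsOpen 𝒩) : IsOpen {x | ∀ s ∈ Icc (0 : ℝ) 1, (s, x) ∈ 𝒩} := by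
  rw [isOpen_iff_mem_nhds]
  intro x hx
  exact isCompact_Icc.eventually_forall_of_forall_eventually fun s hs =>
    (continuous_swap.tendsto (x, s)).eventually_mem (h.mem_nhds (hx s hs))

/-- A family of cosymplectic submanifolds that is constant along `C` is, near `C`, the
restriction of a Hamiltonian isotopy, up to reparametrization. -/
theorem exists_hamiltonian_isotopy [T2Space P] [TopologicalSpace.MetrizableSpace M] [Nonempty C]
    {B : BilinField E P} (hB : IsPoisson B)
    (h𝒲 : IsOpen 𝒲) (hφ : ContMDiffOn (𝓘(ℝ, ℝ).prod 𝓘(ℝ, E₀)) 𝓘(ℝ, E) ∞ φ 𝒲)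
    {e : P → H} {O : Set H} {r : H → P} (hr : IsRetraction (E := E) e O r)
    (hi₀ : Continuous i₀) (hi : Topology.IsInducing i) (hmem : ∀ s c, (s, i₀ c) ∈ 𝒲)
    (hφi : ∀ s c, φ (s, i₀ c) = i c)
    (hnd : ∀ s c, IsNondeg (dx (E₀ := E₀) φ (s, i₀ c)) (sharpL B (φ (s, i₀ c))))
    (hdt : ∀ s c, dt (E := E) φ (s, i₀ c) = 0) :
    ∃ (U : Set P) (f : ℝ × P → ℝ) (W : Set M) (g : M → M) (γ : M → ℝ → P),
      IsOpen U ∧ (∀ c, i c ∈ U) ∧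
      ContMDiffOn (𝓘(ℝ, ℝ).prod 𝓘(ℝ, E)) 𝓘(ℝ, ℝ) ∞ f (univ ×ˢ U) ∧
      (∀ t c, hamVector B (fun p => f (t, p)) (i c) = 0) ∧
      IsOpen W ∧ (∀ c, i₀ c ∈ W) ∧ ContMDiffOn 𝓘(ℝ, E₀) 𝓘(ℝ, E₀) ∞ g W ∧
      (∀ x ∈ W, Function.Injective (md 𝓘(ℝ, E₀) 𝓘(ℝ, E₀) g x)) ∧ (∀ c, g (i₀ c) = i₀ c) ∧
      (∀ x ∈ W, (1, g x) ∈ 𝒲 ∧ γ x 0 = φ (0, x) ∧ γ x 1 = φ (1, g x) ∧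
        ∀ t ∈ Icc (0 : ℝ) 1, γ x t ∈ U ∧
          HasVelocity (γ x) t (hamVector B (fun p => f (t, p)) (γ x t))) ∧
      ∀ c, ∀ N ∈ 𝓝 (i c), ∀ᶠ x in 𝓝 (i₀ c), ∀ t ∈ Icc (0 : ℝ) 1, γ x t ∈ N := by
  have hn : (∞ : WithTop ℕ∞) ≠ 0 := by simp
  have : Nonempty M := Nonempty.map i₀ inferInstance
  obtain ⟨w, ξ, hwξ, hw, hξ⟩ := exists_decomposition hB h𝒲 hφ hr
  set 𝒟 := nondegSet (E₀ := E₀) B φ 𝒲 with h𝒟def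
  have h𝒟 : IsOpen 𝒟 := isOpen_nondegSet hB h𝒲 hφ
  have h𝒟𝒲 : 𝒟 ⊆ 𝒲 := fun q hq => hq.1
  have hi𝒟 : ∀ s c, (s, i₀ c) ∈ 𝒟 := fun s c => ⟨hmem s c, hnd s c⟩
  -- Along `C` the velocity vanishes, hence by uniqueness so do both of its components: `C` consists
  -- of rest points.
  have hzero : ∀ s c, w (s, i₀ c) = 0 ∧ ξ (s, i₀ c) = 0 := fun s c =>
    hnd s c _ _ ((hwξ _ (hi𝒟 s c)).1.trans (hdt s c)) (hwξ _ (hi𝒟 s c)).2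
  obtain ⟨𝒩, 𝒲', f, h𝒩, h𝒲', hsub, hi𝒲', hφ𝒩, hf, hdf⟩ := exists_generating_function h𝒟
    (hφ.mono h𝒟𝒲) hr hξ (fun q hq => (hwξ q hq).2) hi₀ hi hi𝒟 hφi
    (fun s c v hv => (hnd s c v 0 (by rw [hv, map_zero, add_zero]) fun _ => rfl).1)
  -- The domain of `f` may shrink as the time varies over the line. With values of `θ` in `[0, 1]`
  -- only a compact set of times matters, so one open set `U` serves all real `t`. The end points
  -- `0` and `1` are kept, and the chain rule contributes the factor `deriv θ`.
  let θ : ℝ → ℝ := Real.smoothTransition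
  have hθ : ContDiff ℝ ∞ θ := Real.smoothTransition.contDiff
  have hθ' : ContDiff ℝ ∞ (deriv θ) := ((contDiff_infty_iff_deriv).1 hθ).2
  have hθd : ∀ t, HasDerivAt θ (deriv θ t) t := fun t =>
    ((hθ.differentiable hn) t).hasDerivAt
  have hθI : ∀ t, θ t ∈ Icc (0 : ℝ) 1 := fun t =>
    ⟨Real.smoothTransition.nonneg t, Real.smoothTransition.le_one t⟩
  have hθ0 : θ 0 = 0 := Real.smoothTransition.zero
  have hθ1 : θ 1 = 1 := Real.smoothTransition.one
  let U : Set P := {p | ∀ s ∈ Icc (0 : ℝ) 1, (s, p) ∈ 𝒩}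
  have hU : IsOpen U := isOpen_setOf_forall_mem h𝒩
  have hiU : ∀ c, i c ∈ U := fun c s _ => by
    have h1 := hφ𝒩 _ (hi𝒲' s c)
    rwa [hφi] at h1
  let F : ℝ × P → ℝ := fun y => deriv θ y.1 * f (θ y.1, y.2)
  have hF : ContMDiffOn (𝓘(ℝ, ℝ).prod 𝓘(ℝ, E)) 𝓘(ℝ, ℝ) ∞ F (univ ×ˢ U) := by
    have h1 : ContMDiffOn (𝓘(ℝ, ℝ).prod 𝓘(ℝ, E)) 𝓘(ℝ, ℝ) ∞ (fun y : ℝ × P => deriv θ y.1)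
        (univ ×ˢ U) := hθ'.contMDiff.comp_contMDiffOn contMDiffOn_fst
    have h2 : ContMDiffOn (𝓘(ℝ, ℝ).prod 𝓘(ℝ, E)) (𝓘(ℝ, ℝ).prod 𝓘(ℝ, E)) ∞
        (fun y : ℝ × P => (θ y.1, y.2)) (univ ×ˢ U) :=
      (hθ.contMDiff.comp_contMDiffOn contMDiffOn_fst).prodMk contMDiffOn_snd
    exact h1.mul (hf.comp h2 fun y hy => hy.2 _ (hθI y.1))
  have hham : ∀ t x, (θ t, x) ∈ 𝒲' → hamVector B (fun p => F (t, p)) (φ (θ t, x)) =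
      deriv θ t • sharpL B (φ (θ t, x)) (ξ (θ t, x)) := by
    intro t x hx
    have h1 : ContMDiffAt 𝓘(ℝ, E) 𝓘(ℝ, ℝ) ∞ (fun p => f (θ t, p)) (φ (θ t, x)) :=
      ContMDiffAt.comp (g := f) (φ (θ t, x)) (hf.contMDiffAt (h𝒩.mem_nhds (hφ𝒩 _ hx)))
        (contMDiffAt_const.prodMk contMDiffAt_id)
    rw [← map_smul]
    refine hamVector_eq B fun v => ?_
    have h2 := md_smul (deriv θ t) (h1.mdifferentiableAt hn) v
    rw [hdf _ hx] at h2
    exact h2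
  let 𝒲₁ : Set (ℝ × M) := 𝒲' ∩ φ ⁻¹' U
  have h𝒲₁ : IsOpen 𝒲₁ :=
    (hφ.continuousOn.mono (hsub.trans h𝒟𝒲)).isOpen_inter_preimage h𝒲' hU
  let τ : ℝ × M → ℝ × M := fun q => (θ q.1, q.2)
  have hτ : Continuous τ := (hθ.continuous.comp continuous_fst).prodMk continuous_snd
  -- Moving the parameter with `-w` cancels the tangential part of the velocity of `φ`; the curve `φ
  -- (θ t, g x t)` is left with the multiple `deriv θ t` of `♯ ξ`, which is the Hamiltonian field.
  let v : ℝ × M → E₀ := fun q => -deriv θ q.1 • w (τ q)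
  have hv : ∀ z, ContDiffOn ℝ ∞ (chartField v z) (chartDomain (τ ⁻¹' 𝒲₁) z) := by
    intro z
    have h1 : ContDiffOn ℝ ∞ (fun y : ℝ × E₀ => chartField w z (θ y.1, y.2))
        (chartDomain (τ ⁻¹' 𝒲₁) z) := by
      refine (hw z).comp (((hθ.comp contDiff_fst).prodMk contDiff_snd).contDiffOn) fun y hy => ?_
      exact ⟨hy.1, hsub hy.2.1⟩
    have h2 : ContDiffOn ℝ ∞ (fun y : ℝ × E₀ => -deriv θ y.1) (chartDomain (τ ⁻¹' 𝒲₁) z) :=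
      (hθ'.comp contDiff_fst).neg.contDiffOn
    refine (h2.smul h1).congr fun y _ => ?_
    exact map_smul (chartD z ((extChartAt 𝓘(ℝ, E₀) z).symm y.2)) _ _
  obtain ⟨W, g, hW, hiW, hg, hg1, hginj, hgi, hgN⟩ := exists_flow (i := i₀) (h𝒲₁.preimage hτ) hv
    (fun c t _ => ⟨hi𝒲' (θ t) c, by
      change φ (θ t, i₀ c) ∈ U
      rw [hφi]
      exact hiU c⟩)
    (fun c t _ => by
      change -deriv θ t • w (θ t, i₀ c) = 0
      rw [(hzero _ c).1, smul_zero])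
  have h1I : (1 : ℝ) ∈ Icc (0 : ℝ) 1 := ⟨zero_le_one, le_rfl⟩
  refine ⟨U, F, W, fun x => g x 1, fun x t => φ (θ t, g x t), hU, hiU, hF, fun t c => ?_, hW, hiW,
    hg1, hginj, fun c => hgi c 1 h1I, fun x hx => ⟨?_, ?_, ?_, fun t ht => ?_⟩, fun c N hN => ?_⟩
  · have h1 := hham t (i₀ c) (hi𝒲' _ c)
    rwa [(hzero _ c).2, map_zero, smul_zero, hφi] at h1
  · have h1 := h𝒟𝒲 (hsub ((hg x hx).2 1 h1I).1.1)
    simp only [τ] at h1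
    rwa [hθ1] at h1
  · change φ (θ 0, g x 0) = φ (0, x)
    rw [hθ0, (hg x hx).1]
  · change φ (θ 1, g x 1) = φ (1, g x 1)
    rw [hθ1]
  · obtain ⟨hm, hvel⟩ := (hg x hx).2 t ht
    refine ⟨hm.2, ?_⟩
    have hq : (θ t, g x t) ∈ 𝒟 := hsub hm.1
    have h1 := hvel.family (hθd t)
      ((hφ.contMDiffAt (h𝒲.mem_nhds (h𝒟𝒲 hq))).mdifferentiableAt hn)
    have h2 : deriv θ t • dt (E := E) φ (θ t, g x t) + dx φ (θ t, g x t) (v (t, g x t)) =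
        hamVector B (fun p => F (t, p)) (φ (θ t, g x t)) := by
      rw [hham t _ hm.1, ← (hwξ _ hq).1]
      change _ + dx φ (θ t, g x t) (-deriv θ t • w (θ t, g x t)) = _
      rw [map_smul, smul_add, neg_smul]
      abel
    rw [h2] at h1
    exact h1
  -- A neighborhood of `i₀ c` is mapped into `N` by all `φ s` with `s` in the compact interval, and
  -- the curves `g x` stay in it for `x` near `i₀ c`.
  · have hopen : IsOpen (𝒲 ∩ φ ⁻¹' interior N) :=
      hφ.continuousOn.isOpen_inter_preimage h𝒲 isOpen_interior
    have hmemN : {y | ∀ s ∈ Icc (0 : ℝ) 1, (s, y) ∈ 𝒲 ∩ φ ⁻¹' interior N} ∈ 𝓝 (i₀ c) :=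
      (isOpen_setOf_forall_mem hopen).mem_nhds fun s _ => ⟨hmem s c, by
        rw [mem_preimage, hφi]
        exact mem_interior_iff_mem_nhds.2 hN⟩
    filter_upwards [hgN c _ hmemN] with x hx t ht
    exact interior_subset (hx t ht (θ t) (hθI t)).2

end Isotopy

/-! ### Cosymplectic submanifolds containing a common coisotropic submanifold -/

/-- The range of `T` and the hull intersect in `K` and span `V`, so `B` and `K` alone determine the
dimension of `W`. Hence the two cosymplectic submanifolds have equal dimension. -/
theorem IsTransverse.finrank_eq {V W : Type*} [AddCommGroup V] [Module ℝ V] [FiniteDimensional ℝ V]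
    [AddCommGroup W] [Module ℝ W] {B : LinearMap.BilinForm ℝ (Module.Dual ℝ V)} {K : Submodule ℝ V}
    {T : W →ₗ[ℝ] V} (h : IsTransverse B K T) :
    Module.finrank ℝ W + Module.finrank ℝ (hull B K) = Module.finrank ℝ V + Module.finrank ℝ K := by
  have h1 : LinearMap.range T ⊓ hull B K = K := by
    refine le_antisymm ?_ (le_inf h.le_range le_sup_left)
    rintro _ ⟨⟨w, rfl⟩, hw⟩
    exact h.mem_of_mem_hull w hw
  have h2 := Submodule.finrank_sup_add_finrank_inf_eq (LinearMap.range T) (hull B K)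
  rw [h1, h.sup_hull, finrank_top, LinearMap.finrank_range_of_inj h.injective] at h2
  exact h2.symm

section Cosymplectic

variable {EC C : Type*} [NormedAddCommGroup EC] [NormedSpace ℝ EC] [FiniteDimensional ℝ EC]
  [TopologicalSpace C] [ChartedSpace EC C] [IsManifold 𝓘(ℝ, EC) ∞ C]
  {E₀ M : Type*} [NormedAddCommGroup E₀] [NormedSpace ℝ E₀] [FiniteDimensional ℝ E₀]
  [TopologicalSpace M] [ChartedSpace E₀ M] [IsManifold 𝓘(ℝ, E₀) ∞ M]
  {E P : Type*} [NormedAddCommGroup E] [NormedSpace ℝ E] [FiniteDimensional ℝ E]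
  [TopologicalSpace P] [ChartedSpace E P] [IsManifold 𝓘(ℝ, E) ∞ P]
  {B : BilinField E P} {j : M → P}

theorem IsCosymplectic.contMDiff (h : IsCosymplectic (E := E₀) B j) :
    ContMDiff 𝓘(ℝ, E₀) 𝓘(ℝ, E) ∞ j := h.embedding.contMDiff

theorem IsCosymplectic.injective (h : IsCosymplectic (E := E₀) B j) (x : M) :
    Function.Injective (md 𝓘(ℝ, E₀) 𝓘(ℝ, E) j x) := tangentMapAt_injective h.embedding x

/-- Directness of the sum gives `T w = 0` and `♯ ξ = 0`. Then `ξ` vanishes on the tangent space by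
assumption and on the complement by antisymmetry, so `ξ` itself is zero, even where `♯` has a
kernel. -/
theorem IsCosymplectic.isNondeg (hB : IsPoisson B) (h : IsCosymplectic (E := E₀) B j) (x : M) :
    IsNondeg (md 𝓘(ℝ, E₀) 𝓘(ℝ, E) j x) (sharpL B (j x)) := by
  intro w ξ h1 h2
  let T : E₀ →ₗ[ℝ] E := (md 𝓘(ℝ, E₀) 𝓘(ℝ, E) j x).toLinearMap
  have hc : IsCompl (LinearMap.range T) (sharpAnn (bil B (j x)) (LinearMap.range T)) := h.isCompl x
  have hann : ξ.toLinearMap ∈ (LinearMap.range T).dualAnnihilator := by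
    rw [Submodule.mem_dualAnnihilator]
    rintro _ ⟨v, rfl⟩
    exact h2 v
  have h3 : sharp (bil B (j x)) ξ.toLinearMap ∈ LinearMap.range T := by
    refine ⟨-w, ?_⟩
    rw [map_neg]
    exact neg_eq_of_add_eq_zero_right h1
  have h4 : sharp (bil B (j x)) ξ.toLinearMap = 0 :=
    Submodule.disjoint_def.1 hc.disjoint _ h3 (Submodule.mem_map_of_mem hann)
  have h5 : md 𝓘(ℝ, E₀) 𝓘(ℝ, E) j x w = 0 := by
    rw [sharpL_apply, h4, add_zero] at h1
    exact h1
  refine ⟨(map_eq_zero_iff _ (h.injective x)).1 h5, ContinuousLinearMap.ext fun v => ?_⟩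
  have hv : v ∈ LinearMap.range T ⊔ sharpAnn (bil B (j x)) (LinearMap.range T) := by
    rw [hc.sup_eq_top]
    trivial
  obtain ⟨_, ⟨u, rfl⟩, _, ⟨η, -, rfl⟩, rfl⟩ := Submodule.mem_sup.1 hv
  have h6 := apply_sharp_comm (B := bil B (j x)) (hB.alt (j x)) η ξ.toLinearMap
  rw [h4, map_zero, neg_zero] at h6
  change ξ (T u + sharp (bil B (j x)) η) = 0
  rw [map_add]
  exact (congrArg₂ (· + ·) (h2 u) h6).trans (add_zero 0)

/-- Coisotropy inside `M` is converted into a condition on the ambient tangent space. The subspace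
`K` is then that of `j ∘ i₀`, so two submanifolds through `C` can be compared. -/
theorem IsCosymplectic.isTransverse (hB : IsPoisson B) (h : IsCosymplectic (E := E₀) B j)
    {i₀ : C → M} (hi₀ : ContMDiff 𝓘(ℝ, EC) 𝓘(ℝ, E₀) ∞ i₀)
    (hC : IsCoisotropic (E := EC) h.induced i₀) (c : C) :
    IsTransverse (bil B (j (i₀ c)))
      (LinearMap.range (md 𝓘(ℝ, EC) 𝓘(ℝ, E) (j ∘ i₀) c).toLinearMap)
      (md 𝓘(ℝ, E₀) 𝓘(ℝ, E) j (i₀ c)).toLinearMap := by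
  have hn : (∞ : WithTop ℕ∞) ≠ 0 := by simp
  let K : Submodule ℝ E₀ := LinearMap.range (md 𝓘(ℝ, EC) 𝓘(ℝ, E₀) i₀ c).toLinearMap
  have h1 : IsTransverse (bil B (j (i₀ c))) (K.map (md 𝓘(ℝ, E₀) 𝓘(ℝ, E) j (i₀ c)).toLinearMap)
      (md 𝓘(ℝ, E₀) 𝓘(ℝ, E) j (i₀ c)).toLinearMap :=
    isTransverse_of_coisotropic (B := bil B (j (i₀ c)))
      (L := (md 𝓘(ℝ, E₀) 𝓘(ℝ, E) j (i₀ c)).toLinearMap) (K := K) (hB.alt (j (i₀ c)))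
      (h.injective (i₀ c)) (h.isCompl (i₀ c)) (hC c)
  have h2 : (md 𝓘(ℝ, EC) 𝓘(ℝ, E) (j ∘ i₀) c).toLinearMap =
      (md 𝓘(ℝ, E₀) 𝓘(ℝ, E) j (i₀ c)).toLinearMap ∘ₗ (md 𝓘(ℝ, EC) 𝓘(ℝ, E₀) i₀ c).toLinearMap :=
    LinearMap.ext fun v => md_comp ((h.contMDiff _).mdifferentiableAt hn)
      ((hi₀ _).mdifferentiableAt hn) v
  rw [h2, LinearMap.range_comp]
  exact h1

end Cosymplectic

/-! ### Transport of tubular neighborhoods -/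

section Tubular

variable {EC C : Type*} [NormedAddCommGroup EC] [NormedSpace ℝ EC] [FiniteDimensional ℝ EC]
  [TopologicalSpace C] [ChartedSpace EC C]
  {E₀ M₀ : Type*} [NormedAddCommGroup E₀] [NormedSpace ℝ E₀] [FiniteDimensional ℝ E₀]
  [TopologicalSpace M₀] [ChartedSpace E₀ M₀]
  {E₁ M₁ : Type*} [NormedAddCommGroup E₁] [NormedSpace ℝ E₁] [FiniteDimensional ℝ E₁]
  [TopologicalSpace M₁] [ChartedSpace E₁ M₁]

/-- The image of a tubular neighborhood under a diffeomorphism is a tubular neighborhood. -/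
theorem IsTubularNeighborhood.image {i₀ : C → M₀} {i₁ : C → M₁}
    {Φ : PartialDiffeomorph 𝓘(ℝ, E₀) 𝓘(ℝ, E₁) M₀ M₁ ∞}
    (h : IsTubularNeighborhood (E := EC) (E' := E₀) i₀ Φ.source) (hi : ∀ c, Φ (i₀ c) = i₁ c) :
    IsTubularNeighborhood (E := EC) (E' := E₁) i₁ Φ.target := by
  obtain ⟨k, N, a1, a2, a3, a4, a5, a6, a7, ψ, hψ, h0, hstar⟩ := h
  have hsrc : (ψ.trans Φ).source = ψ.source :=
    (PartialEquiv.trans_source _ _).trans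
      (inter_eq_left.2 fun y hy => hψ ▸ ψ.map_source' hy)
  have htgt : (ψ.trans Φ).target = Φ.target :=
    (PartialEquiv.trans_target _ _).trans
      (inter_eq_left.2 fun y hy => show Φ.invFun y ∈ ψ.target from hψ ▸ Φ.map_target' hy)
  refine ⟨k, N, a1, a2, a3, a4, a5, a6, a7, ψ.trans Φ, htgt, fun c => ?_, fun c v hv s hs => ?_⟩
  · rw [hsrc]
    refine ⟨(h0 c).1, ?_⟩
    change Φ (ψ ⟨c, 0⟩) = i₁ c
    rw [(h0 c).2, hi]
  · rw [hsrc] at hv ⊢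
    exact hstar c v hv s hs

end Tubular

/-! ### Equivalence of cosymplectic submanifolds -/

section Equivalence

variable {EC C : Type*} [NormedAddCommGroup EC] [NormedSpace ℝ EC] [FiniteDimensional ℝ EC]
  [TopologicalSpace C] [ChartedSpace EC C] [IsManifold 𝓘(ℝ, EC) ∞ C]
  {E₀ M₀ : Type*} [NormedAddCommGroup E₀] [NormedSpace ℝ E₀] [FiniteDimensional ℝ E₀]
  [TopologicalSpace M₀] [ChartedSpace E₀ M₀] [IsManifold 𝓘(ℝ, E₀) ∞ M₀]
  {E₁ M₁ : Type*} [NormedAddCommGroup E₁] [NormedSpace ℝ E₁] [FiniteDimensional ℝ E₁]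
  [TopologicalSpace M₁] [ChartedSpace E₁ M₁] [IsManifold 𝓘(ℝ, E₁) ∞ M₁]
  {E P : Type*} [NormedAddCommGroup E] [NormedSpace ℝ E] [FiniteDimensional ℝ E]
  [TopologicalSpace P] [ChartedSpace E P] [IsManifold 𝓘(ℝ, E) ∞ P]
  {B : BilinField E P} {j₀ : M₀ → P} {j₁ : M₁ → P}

/-- `T` differs from `T₀` by multiples of `♯ ξ` with `ξ` conormal to the second submanifold, hence
annihilating `K`; on `K` nothing changes, since the projection fixes vectors in the range of `T₁`.
So `IsTransverse.deform` applies for every real `s`. -/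
theorem isNondeg_interpolation (hB : IsPoisson B) {p : P} {T₀ T : E₀ →L[ℝ] E} {T₁ : E₁ →L[ℝ] E}
    {S : E₀ →L[ℝ] E₁} {K : Submodule ℝ E} (h₀ : IsTransverse (bil B p) K T₀.toLinearMap)
    (hK : K ≤ LinearMap.range T₁.toLinearMap) (h₁ : IsNondeg T₁ (sharpL B p))
    (hS : ∀ v, ∃ ξ : E →L[ℝ] ℝ, T₁ (S v) + sharpL B p ξ = T₀ v ∧ ∀ u, ξ (T₁ u) = 0) {s : ℝ}
    (hT : ∀ v, T v = (1 - s) • T₀ v + s • T₁ (S v)) : IsNondeg T (sharpL B p) := by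
  have h : IsTransverse (bil B p) K T.toLinearMap := by
    refine h₀.deform (fun v => ?_) fun v hv => ?_
    · obtain ⟨ξ, h1, h2⟩ := hS v
      have h3 : T v - T₀ v = -(s • sharpL B p ξ) := by
        rw [hT, ← h1, sub_smul, one_smul, smul_add]
        abel
      change T v - T₀ v ∈ hull (bil B p) K
      rw [h3]
      refine neg_mem (Submodule.smul_mem _ _ (Submodule.mem_sup_right ?_))
      refine Submodule.mem_map_of_mem ?_
      rw [Submodule.mem_dualAnnihilator]
      intro k hk
      obtain ⟨u, rfl⟩ := hK hk
      exact h2 u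
    · obtain ⟨ξ, h1, h2⟩ := hS v
      obtain ⟨u, hu⟩ := hK hv
      have hu' : T₁ u = T₀ v := hu
      have h3 := (h₁ (S v - u) ξ (by rw [map_sub, sub_add_eq_add_sub, h1, hu', sub_self]) h2).1
      rw [sub_eq_zero] at h3
      change T v = T₀ v
      rw [hT, h3, hu', ← add_smul, sub_add_cancel, one_smul]
  intro w ξ h1 h2
  obtain ⟨h3, h4⟩ := h.eq_zero (hB.alt p) (ξ := ξ.toLinearMap) h1 (LinearMap.ext h2)
  exact ⟨h3, ContinuousLinearMap.ext fun v => congrArg (fun l : E →ₗ[ℝ] ℝ => l v) h4⟩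

theorem IsRetraction.contMDiff_of_comp {H : Type*} [NormedAddCommGroup H] [InnerProductSpace ℝ H]
    [CompleteSpace H] {e : M₀ → H} {O : Set H} {r : H → M₀} (hr : IsRetraction (E := E₀) e O r)
    {u : C → M₀} (hu : ContMDiff 𝓘(ℝ, EC) 𝓘(ℝ, H) ∞ (e ∘ u)) :
    ContMDiff 𝓘(ℝ, EC) 𝓘(ℝ, E₀) ∞ u := by
  have h1 : r ∘ e ∘ u = u := funext fun c => hr.left_inv (u c)
  rw [← h1]
  exact fun c => (hr.contMDiffAt_r (u c)).comp c (hu c)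

/-- A map between cosymplectic submanifolds that is the restriction of a Poisson map is a Poisson
map. -/
theorem induced_apply_of_eventuallyEq (h₀ : IsCosymplectic (E := E₀) B j₀)
    (h₁ : IsCosymplectic (E := E₁) B j₁) {F : M₀ → M₁} {x : M₀}
    (hF : MDifferentiableAt 𝓘(ℝ, E₀) 𝓘(ℝ, E₁) F x)
    (hFs : Function.Surjective (md 𝓘(ℝ, E₀) 𝓘(ℝ, E₁) F x)) {Ψ : P → P}
    (hΨ : MDifferentiableAt 𝓘(ℝ, E) 𝓘(ℝ, E) Ψ (j₀ x))
    (hΨb : Function.Bijective (md 𝓘(ℝ, E) 𝓘(ℝ, E) Ψ (j₀ x)))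
    (hΨB : ∀ ξ η : Module.Dual ℝ E, bil B (Ψ (j₀ x)) ξ η =
      bil B (j₀ x) (ξ ∘ₗ (md 𝓘(ℝ, E) 𝓘(ℝ, E) Ψ (j₀ x)).toLinearMap)
        (η ∘ₗ (md 𝓘(ℝ, E) 𝓘(ℝ, E) Ψ (j₀ x)).toLinearMap))
    (heq : j₁ ∘ F =ᶠ[𝓝 x] Ψ ∘ j₀) (ξ η : Module.Dual ℝ (TangentSpace 𝓘(ℝ, E₁) (F x))) :
    h₁.induced (F x) ξ η = h₀.induced x (ξ ∘ₗ tangentMapAt (E := E₀) (E' := E₁) F x)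
      (η ∘ₗ tangentMapAt (E := E₀) (E' := E₁) F x) := by
  have hn : (∞ : WithTop ℕ∞) ≠ 0 := by simp
  have hx : Ψ (j₀ x) = j₁ (F x) := heq.self_of_nhds.symm
  have hcomm : ∀ w : E₀, md 𝓘(ℝ, E₁) 𝓘(ℝ, E) j₁ (F x) (md 𝓘(ℝ, E₀) 𝓘(ℝ, E₁) F x w) =
      md 𝓘(ℝ, E) 𝓘(ℝ, E) Ψ (j₀ x) (md 𝓘(ℝ, E₀) 𝓘(ℝ, E) j₀ x w) := fun w => by
    rw [← md_comp ((h₁.contMDiff _).mdifferentiableAt hn) hF,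
      ← md_comp hΨ ((h₀.contMDiff _).mdifferentiableAt hn), md_congr heq]
  rw [hx] at hΨB
  exact inducedForm_natural (V := E) (W := E₀) (V' := E) (W' := E₁) (B := bil B (j₀ x))
    (L := (md 𝓘(ℝ, E₀) 𝓘(ℝ, E) j₀ x).toLinearMap) (h₀.injective x) (h₀.isCompl x)
    (B' := bil B (j₁ (F x))) (L' := (md 𝓘(ℝ, E₁) 𝓘(ℝ, E) j₁ (F x)).toLinearMap)
    (h₁.injective (F x)) (h₁.isCompl (F x))
    (A := (md 𝓘(ℝ, E) 𝓘(ℝ, E) Ψ (j₀ x)).toLinearMap) hΨb hΨB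
    (S := (md 𝓘(ℝ, E₀) 𝓘(ℝ, E₁) F x).toLinearMap) hFs hcomm ξ η

variable [T2Space P] [SecondCountableTopology P] [Nonempty C]

/-- Two cosymplectic submanifolds that contain `C` coisotropically are related near `C` by the
time-one map of a Hamiltonian flow. -/
theorem exists_hamiltonian_equivalence (hB : IsPoisson B) {i : C → P}
    (hi : Manifold.IsSmoothEmbedding 𝓘(ℝ, EC) 𝓘(ℝ, E) ∞ i)
    (h₀ : IsCosymplectic (E := E₀) B j₀) {i₀ : C → M₀} (hi₀ : j₀ ∘ i₀ = i)
    (hC₀ : IsCoisotropic (E := EC) h₀.induced i₀)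
    (h₁ : IsCosymplectic (E := E₁) B j₁) {i₁ : C → M₁} (hi₁ : j₁ ∘ i₁ = i)
    (hC₁ : IsCoisotropic (E := EC) h₁.induced i₁) :
    ContMDiff 𝓘(ℝ, EC) 𝓘(ℝ, E₀) ∞ i₀ ∧
    ∃ Φ : PartialDiffeomorph 𝓘(ℝ, E₀) 𝓘(ℝ, E₁) M₀ M₁ ∞, (∀ c, i₀ c ∈ Φ.source) ∧
      IsPoissonMapOn h₀.induced h₁.induced Φ Φ.source ∧ (∀ c, Φ (i₀ c) = i₁ c) ∧
      ∃ (U : Set P) (H : ℝ → P → ℝ), IsOpen U ∧ range i ⊆ U ∧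
        ContMDiffOn (𝓘(ℝ, ℝ).prod 𝓘(ℝ, E)) 𝓘(ℝ, ℝ) ∞ (fun q : ℝ × P => H q.1 q.2) (univ ×ˢ U) ∧
        ∀ x ∈ Φ.source, ∃ γ : ℝ → P, γ 0 = j₀ x ∧ γ 1 = j₁ (Φ x) ∧
          IsHamiltonianTrajectory B U H γ := by
  have hn : (∞ : WithTop ℕ∞) ≠ 0 := by simp
  have hij : ∀ c, j₀ (i₀ c) = j₁ (i₁ c) := fun c =>
    (congrFun hi₀ c).trans (congrFun hi₁ c).symm
  have : Nonempty P := Nonempty.map i inferInstance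
  have : Nonempty M₀ := Nonempty.map i₀ inferInstance
  have : Nonempty M₁ := Nonempty.map i₁ inferInstance
  obtain ⟨H, _, _, _, e, he, hee, hei⟩ := exists_embedding_hilbert (E := E) (M := P)
  obtain ⟨O, r, hr⟩ := exists_isRetraction he hee hei
  obtain ⟨O₀, r₀, hr₀⟩ := exists_isRetraction (E := E₀) (he.comp h₀.contMDiff)
    (hee.comp h₀.embedding.isEmbedding) fun x => by
      have h := fun v => md_comp (I'' := 𝓘(ℝ, H)) ((he (j₀ x)).mdifferentiableAt hn)
        ((h₀.contMDiff x).mdifferentiableAt hn) v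
      exact fun v v' hv => h₀.injective x (hr.de_injective (j₀ x)
        ((h v).symm.trans (Eq.trans hv (h v'))))
  obtain ⟨O₁, r₁, hr₁⟩ := exists_isRetraction (E := E₁) (he.comp h₁.contMDiff)
    (hee.comp h₁.embedding.isEmbedding) fun x => by
      have h := fun v => md_comp (I'' := 𝓘(ℝ, H)) ((he (j₁ x)).mdifferentiableAt hn)
        ((h₁.contMDiff x).mdifferentiableAt hn) v
      exact fun v v' hv => h₁.injective x (hr.de_injective (j₁ x)
        ((h v).symm.trans (Eq.trans hv (h v'))))
  have : TopologicalSpace.MetrizableSpace M₀ := hr₀.isEmbedding.metrizableSpace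
  -- A map to the submanifold is smooth as soon as its composite with the embedding in `H` is,
  -- because the retraction undoes the embedding.
  have hi₀s : ContMDiff 𝓘(ℝ, EC) 𝓘(ℝ, E₀) ∞ i₀ := by
    refine hr₀.contMDiff_of_comp ?_
    rw [Function.comp_assoc, hi₀]
    exact he.comp hi.contMDiff
  have hi₁s : ContMDiff 𝓘(ℝ, EC) 𝓘(ℝ, E₁) ∞ i₁ := by
    refine hr₁.contMDiff_of_comp ?_
    rw [Function.comp_assoc, hi₁]
    exact he.comp hi.contMDiff
  refine ⟨hi₀s, ?_⟩
  let K : C → Submodule ℝ E := fun c => LinearMap.range (md 𝓘(ℝ, EC) 𝓘(ℝ, E) i c).toLinearMap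
  have hT₀ : ∀ c, IsTransverse (bil B (j₀ (i₀ c))) (K c)
      (md 𝓘(ℝ, E₀) 𝓘(ℝ, E) j₀ (i₀ c)).toLinearMap := fun c => by
    have h := h₀.isTransverse hB hi₀s hC₀ c
    rwa [hi₀] at h
  have hT₁ : ∀ c, IsTransverse (bil B (j₁ (i₁ c))) (K c)
      (md 𝓘(ℝ, E₁) 𝓘(ℝ, E) j₁ (i₁ c)).toLinearMap := fun c => by
    have h := h₁.isTransverse hB hi₁s hC₁ c
    rwa [hi₁] at h
  have hdim : Module.finrank ℝ E₀ = Module.finrank ℝ E₁ := by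
    obtain ⟨c⟩ := ‹Nonempty C›
    have h1 := (hT₀ c).finrank_eq
    have h2 := (hT₁ c).finrank_eq
    rw [hij] at h1
    omega
  obtain ⟨Wσ, σ, hWσ, hiWσ, hσ, hσi, hσD⟩ := exists_projected_map hB h₀.contMDiff h₁.contMDiff
    (h₁.isNondeg hB) hij hr hr₁
  obtain ⟨𝒲, φ, h𝒲, h𝒲σ, hi𝒲, hφ, hφi, hφ0, hφ1, hdx, hdt⟩ := exists_interpolation h₀.contMDiff
    h₁.contMDiff hij hr hWσ hiWσ hσ hσi
  have hnd : ∀ s c, IsNondeg (dx (E₀ := E₀) φ (s, i₀ c)) (sharpL B (φ (s, i₀ c))) := by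
    intro s c
    rw [hφi]
    refine isNondeg_interpolation hB (hT₀ c) (hT₁ c).le_range ?_ (fun v => ?_) (hdx s c)
    · rw [hij]
      exact h₁.isNondeg hB (i₁ c)
    · rw [hij]
      exact hσD c v
  obtain ⟨U, f, W, g, γ, hU, hiU, hf, hcrit, hW, hiW, hg, hginj, hgi, hγ, hγN⟩ :=
    exists_hamiltonian_isotopy hB h𝒲 hφ hr hi₀s.continuous hi.isEmbedding.isInducing hi𝒲
      (fun s c => (hφi s c).trans (congrFun hi₀ c)) hnd hdt
  let F : M₀ → M₁ := σ ∘ g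
  have hF : ContMDiffOn 𝓘(ℝ, E₀) 𝓘(ℝ, E₁) ∞ F W :=
    hσ.comp hg fun x hx => h𝒲σ _ (hγ x hx).1
  have hFi : ∀ c, F (i₀ c) = i₁ c := fun c => (congrArg σ (hgi c)).trans (hσi c)
  have hFd : ∀ x ∈ W, MDifferentiableAt 𝓘(ℝ, E₀) 𝓘(ℝ, E₁) F x := fun x hx =>
    (hF.contMDiffAt (hW.mem_nhds hx)).mdifferentiableAt hn
  have hFinj : ∀ c, Function.Injective (md 𝓘(ℝ, E₀) 𝓘(ℝ, E₁) F (i₀ c)) := by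
    intro c
    -- At `s = 1` the family has the differential `dj₁ ∘ dσ`, so nondegeneracy there makes `σ` an
    -- immersion along `C`.
    have hσinj : Function.Injective (md 𝓘(ℝ, E₀) 𝓘(ℝ, E₁) σ (i₀ c)) := by
      rw [injective_iff_map_eq_zero]
      intro v hv
      refine (hnd 1 c v 0 ?_ fun _ => rfl).1
      rw [hdx, hv, map_zero, map_zero, smul_zero, sub_self, zero_smul, add_zero, add_zero]
    have hgd := (hg.contMDiffAt (hW.mem_nhds (hiW c))).mdifferentiableAt hn
    have hσd : MDifferentiableAt 𝓘(ℝ, E₀) 𝓘(ℝ, E₁) σ (g (i₀ c)) := by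
      rw [hgi]
      exact (hσ.contMDiffAt (hWσ.mem_nhds (hiWσ c))).mdifferentiableAt hn
    have h := fun v => md_comp hσd hgd v
    rw [hgi] at h
    exact fun v v' hv => hginj _ (hiW c) (hσinj ((h v).symm.trans (hv.trans (h v'))))
  -- `F` is an immersion along `C` but not evidently injective nearby. Followed by the embedding in
  -- `H` it restricts to the embedding `e ∘ i` of `C`, which is what a left inverse near `C`
  -- requires.
  let eF : M₀ → H := (e ∘ j₁) ∘ F
  have heF : ContMDiffOn 𝓘(ℝ, E₀) 𝓘(ℝ, H) ∞ eF W := hr₁.contMDiff.comp_contMDiffOn hF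
  have heFi : eF ∘ i₀ = e ∘ i := by
    rw [← hi₁]
    exact funext fun c => congrArg (e ∘ j₁) (hFi c)
  obtain ⟨O', W', ρ, hO', hW', hW'W, hiW', hmaps, hρ, hρF⟩ := exists_leftInverse
    (I := 𝓘(ℝ, E₀)) hi₀s.continuous hW hiW heF
    (fun c => by
      have h := fun v => md_comp (I'' := 𝓘(ℝ, H)) ((hr₁.contMDiff _).mdifferentiableAt hn)
        (hFd _ (hiW c)) v
      exact fun v v' hv => hFinj c (hr₁.de_injective _ ((h v).symm.trans (Eq.trans hv (h v')))))
    (by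
      rw [heFi]
      exact (hee.comp hi.isEmbedding).isInducing)
  let ρ₁ : M₁ → M₀ := ρ ∘ e ∘ j₁
  let V₁ : Set M₁ := (e ∘ j₁) ⁻¹' O'
  have hV₁ : IsOpen V₁ := hO'.preimage hr₁.contMDiff.continuous
  have hρ₁ : ContMDiffOn 𝓘(ℝ, E₁) 𝓘(ℝ, E₀) ∞ ρ₁ V₁ := hρ.comp hr₁.contMDiff.contMDiffOn fun _ hy => hy
  have hFV₁ : MapsTo F W' V₁ := hmaps
  have hsurj : ∀ x ∈ W', Function.Surjective (md 𝓘(ℝ, E₀) 𝓘(ℝ, E₁) F x) := by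
    intro x hx
    have hinj : Function.Injective (md 𝓘(ℝ, E₀) 𝓘(ℝ, E₁) F x) :=
      Function.LeftInverse.injective (g := md 𝓘(ℝ, E₁) 𝓘(ℝ, E₀) ρ₁ (F x)) fun v => by
        refine md_leftInverse
          ((hρ₁.contMDiffAt (hV₁.mem_nhds (hFV₁ hx))).mdifferentiableAt hn) (hFd x (hW'W hx)) ?_ v
        filter_upwards [hW'.mem_nhds hx] with y hy
        exact hρF y hy
    exact (LinearMap.injective_iff_surjective_of_finrank_eq_finrank hdim
      (f := (md 𝓘(ℝ, E₀) 𝓘(ℝ, E₁) F x).toLinearMap)).1 hinj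
  -- The points near which `F` is the restriction of an ambient map that is Poisson there. `Ψ` may
  -- change with the point, so no common flow on a neighborhood of `C` in `P` is needed: being
  -- Poisson is a local property.
  let G : Set M₀ := {x | ∃ Ψ : P → P, MDifferentiableAt 𝓘(ℝ, E) 𝓘(ℝ, E) Ψ (j₀ x) ∧
    Function.Bijective (md 𝓘(ℝ, E) 𝓘(ℝ, E) Ψ (j₀ x)) ∧
    (∀ ξ η : Module.Dual ℝ E, bil B (Ψ (j₀ x)) ξ η =
      bil B (j₀ x) (ξ ∘ₗ (md 𝓘(ℝ, E) 𝓘(ℝ, E) Ψ (j₀ x)).toLinearMap)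
        (η ∘ₗ (md 𝓘(ℝ, E) 𝓘(ℝ, E) Ψ (j₀ x)).toLinearMap)) ∧ j₁ ∘ F =ᶠ[𝓝 x] Ψ ∘ j₀}
  have hG : ∀ c, G ∈ 𝓝 (i₀ c) := by
    intro c
    obtain ⟨N, Ψ, hN, hcN, hΨ, hΨγ⟩ := exists_hamiltonian_flow hB (isOpen_univ.prod hU) hf
      (z := i c) (fun t _ => ⟨mem_univ _, hiU c⟩) fun t _ => hcrit t c
    have h1 : ∀ᶠ x in 𝓝 (i₀ c), x ∈ W ∧ ∀ t ∈ Icc (0 : ℝ) 1, γ x t ∈ N :=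
      (hW.eventually_mem (hiW c)).and (hγN c N (hN.mem_nhds hcN))
    filter_upwards [h1.eventually_nhds] with x hx
    obtain ⟨hxW, hxN⟩ := hx.self_of_nhds
    have hjN : j₀ x ∈ N := by
      have h2 := hxN 0 ⟨le_rfl, zero_le_one⟩
      rwa [(hγ x hxW).2.1, hφ0] at h2
    refine ⟨Ψ, (hΨ _ hjN).1, (hΨ _ hjN).2.1, (hΨ _ hjN).2.2, ?_⟩
    -- Near `x` the trajectories stay in `N`, so their end points are given by `Ψ`: this is `j₁ ∘ F
    -- = Ψ ∘ j₀`.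
    filter_upwards [hx] with y hy
    obtain ⟨-, hy0, hy1, hyt⟩ := hγ y hy.1
    have h3 := hΨγ (γ y) fun t ht => ⟨hy.2 t ht, ⟨mem_univ _, (hyt t ht).1⟩, (hyt t ht).2⟩
    rw [hy0, hy1, hφ0, hφ1] at h3
    exact h3
  obtain ⟨Φ, hΦs, hΦF⟩ := exists_partialDiffeomorph (I := 𝓘(ℝ, E₀)) (J := 𝓘(ℝ, E₁)) hdim
    (hW'.inter isOpen_interior) hV₁ (hF.mono (inter_subset_left.trans hW'W)) hρ₁
    (hFV₁.mono_left inter_subset_left) fun x hx => hρF x hx.1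
  have hΦF' : (Φ : M₀ → M₁) = F := funext hΦF
  refine ⟨Φ, fun c => ?_, fun x hx => ?_, fun c => (hΦF _).trans (hFi c), U, fun t p => f (t, p), hU,
    range_subset_iff.2 hiU, hf, fun x hx => ?_⟩
  · rw [hΦs]
    exact ⟨hiW' c, mem_interior_iff_mem_nhds.2 (hG c)⟩
  · rw [hΦs] at hx
    obtain ⟨Ψ, h1, h2, h3, h4⟩ := interior_subset hx.2
    rw [hΦF']
    exact induced_apply_of_eventuallyEq h₀ h₁ (hFd x (hW'W hx.1)) (hsurj x hx.1) h1 h2 h3 h4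
  · rw [hΦs] at hx
    obtain ⟨-, h1, h2, h3⟩ := hγ x (hW'W hx.1)
    refine ⟨γ x, h1.trans (hφ0 x), ?_, h3⟩
    rw [h2, hφ1, hΦF]
    rfl

end Equivalence

end PrePoisson

end

/-! ### The equivalence on tubular neighborhoods -/

theorem mainTheorem2
    -- the Poisson manifold `(P, Π)`
    {E : Type*} [NormedAddCommGroup E] [NormedSpace ℝ E] [FiniteDimensional ℝ E]
    {P : Type*} [TopologicalSpace P] [ChartedSpace E P] [IsManifold 𝓘(ℝ, E) ∞ P]
    [T2Space P] [SecondCountableTopology P]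
    (B : PrePoisson.BilinField E P) (hB : PrePoisson.IsPoisson B)
    -- the pre-Poisson submanifold `C`
    {EC : Type*} [NormedAddCommGroup EC] [NormedSpace ℝ EC] [FiniteDimensional ℝ EC]
    {C : Type*} [TopologicalSpace C] [ChartedSpace EC C] [IsManifold 𝓘(ℝ, EC) ∞ C] [Nonempty C]
    (i : C → P) (hi : Manifold.IsSmoothEmbedding 𝓘(ℝ, EC) 𝓘(ℝ, E) ∞ i)
    (hC : PrePoisson.IsPrePoisson (E := EC) B i)
    -- the cosymplectic submanifold `P₀` containing `C` coisotropically
    {E₀ : Type*} [NormedAddCommGroup E₀] [NormedSpace ℝ E₀] [FiniteDimensional ℝ E₀]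
    {P₀ : Type*} [TopologicalSpace P₀] [ChartedSpace E₀ P₀] [IsManifold 𝓘(ℝ, E₀) ∞ P₀]
    (j₀ : P₀ → P) (h₀ : PrePoisson.IsCosymplectic (E := E₀) B j₀)
    (i₀ : C → P₀) (hi₀ : j₀ ∘ i₀ = i)
    (hC₀ : PrePoisson.IsCoisotropic (E := EC) h₀.induced i₀)
    -- the cosymplectic submanifold `P₁` containing `C` coisotropically
    {E₁ : Type*} [NormedAddCommGroup E₁] [NormedSpace ℝ E₁] [FiniteDimensional ℝ E₁]
    {P₁ : Type*} [TopologicalSpace P₁] [ChartedSpace E₁ P₁] [IsManifold 𝓘(ℝ, E₁) ∞ P₁]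
    (j₁ : P₁ → P) (h₁ : PrePoisson.IsCosymplectic (E := E₁) B j₁)
    (i₁ : C → P₁) (hi₁ : j₁ ∘ i₁ = i)
    (hC₁ : PrePoisson.IsCoisotropic (E := EC) h₁.induced i₁) :
    -- a diffeomorphism between tubular neighborhoods of `C` in `P₀` and in `P₁`
    ∃ Φ : PartialDiffeomorph 𝓘(ℝ, E₀) 𝓘(ℝ, E₁) P₀ P₁ ∞,
      PrePoisson.IsTubularNeighborhood (E := EC) (E' := E₀) i₀ Φ.source ∧
      PrePoisson.IsTubularNeighborhood (E := EC) (E' := E₁) i₁ Φ.target ∧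
      PrePoisson.IsPoissonMapOn h₀.induced h₁.induced Φ Φ.source ∧
      (∀ c : C, Φ (i₀ c) = i₁ c) ∧
      -- `Φ` is the time-one map of a time-dependent Hamiltonian flow near `C` in `P`
      ∃ (U : Set P) (H : ℝ → P → ℝ), IsOpen U ∧ Set.range i ⊆ U ∧
        ContMDiffOn (𝓘(ℝ, ℝ).prod 𝓘(ℝ, E)) 𝓘(ℝ, ℝ) ∞ (fun q : ℝ × P => H q.1 q.2)
          (Set.univ ×ˢ U) ∧
        ∀ x ∈ Φ.source, ∃ γ : ℝ → P, γ 0 = j₀ x ∧ γ 1 = j₁ (Φ x) ∧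
          PrePoisson.IsHamiltonianTrajectory B U H γ := by
  have : T2Space P₀ := h₀.embedding.isEmbedding.t2Space
  have : SecondCountableTopology P₀ := h₀.embedding.isEmbedding.secondCountableTopology
  have hn : (∞ : WithTop ℕ∞) ≠ 0 := by simp
  obtain ⟨hi₀s, Φ, hΦi, hΦB, hΦi₁, U, H, hU, hiU, hH, hΦH⟩ :=
    PrePoisson.exists_hamiltonian_equivalence hB hi h₀ hi₀ hC₀ h₁ hi₁ hC₁
  have hemb : Topology.IsEmbedding i₀ :=
    .of_comp hi₀s.continuous h₀.contMDiff.continuous (hi₀ ▸ hi.isEmbedding)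
  have hinj : ∀ c, Function.Injective (mfderiv 𝓘(ℝ, EC) 𝓘(ℝ, E₀) i₀ c) := fun c v v' hv => by
    have h := fun v => PrePoisson.md_comp (I := 𝓘(ℝ, EC)) ((h₀.contMDiff (i₀ c)).mdifferentiableAt hn)
      ((hi₀s c).mdifferentiableAt hn) v
    rw [hi₀] at h
    exact PrePoisson.tangentMapAt_injective hi c
      ((h v).trans ((congrArg (PrePoisson.md 𝓘(ℝ, E₀) 𝓘(ℝ, E) j₀ (i₀ c)) hv).trans (h v').symm))
  -- Only the tubular neighborhood in `P₀` is chosen. Its image is one in `P₁`, with the same bundle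
  -- over `C`, because `Φ` carries `i₀` to `i₁`.
  obtain ⟨V, hVΦ, hV⟩ := PrePoisson.exists_isTubularNeighborhood hi₀s hemb hinj Φ.open_source hΦi
  have hVo : IsOpen V := by
    obtain ⟨k, N, a1, a2, a3, a4, a5, a6, a7, ψ, rfl, -⟩ := hV
    exact ψ.open_target
  obtain ⟨Ψ, hΨs, -, hΨ⟩ := PrePoisson.exists_restr Φ hVo hVΦ
  have hΨΦ : (Ψ : P₀ → P₁) = Φ := funext hΨ
  have hΨi : ∀ c, Ψ (i₀ c) = i₁ c := fun c => (hΨ _).trans (hΦi₁ c)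
  have hΨV : PrePoisson.IsTubularNeighborhood (E := EC) (E' := E₀) i₀ Ψ.source := by rwa [hΨs]
  refine ⟨Ψ, hΨV, hΨV.image hΨi, fun x hx => ?_, hΨi, U, H, hU, hiU, hH, fun x hx => ?_⟩
  · rw [hΨs] at hx
    rw [hΨΦ]
    exact hΦB x (hVΦ hx)
  · rw [hΨs] at hx
    rw [hΨ]
    exact hΦH x (hVΦ hx)
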